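/- Let $p,q$ denote prime numbers. For $\nu\in\{\omega,\Omega\}$, where $\omega(a)$ (resp. $\Omega(a)$) is the number of prime factors of the integer $a\ge 1$ counted without (resp. with) multiplicity, set $r_\omega:=+\infty$, $r_\Omega:=2$ and, for $k\in\mathbb N$, $$\lambda_\nu(p,k):=\sum_{\substack{a\ge 1,\ P^+(a)<p\\ \nu(a)=k}}\frac1a ,$$ where $P^+(a)$ is the largest prime factor of $a$, and $P^+(1):=1$. Let $$\mathscr H_\omega(z):=\prod_q\Big(1-\frac1q\Big)^z\Big(1+\frac z{q-1}\Big)\quad(z\in\mathbb C),\qquad \mathscr H_\Omega(z):=\prod_q\Big(1-\frac1q\Big)^z\Big(1-\frac zq\Big)^{-1}\quad(\Re z<2),$$ and $F_\nu(z):=\mathrm e^{\gamma z}\mathscr H_\nu(z)$ for $|z|<r_\nu$, where $\gamma$ is the Euler–Mascheroni constant. Let $\mathfrak q(z):=\sqrt{z^2/\{2(1+iz-\mathrm e^{iz})\}}$ (principal square root, extended analytically to a neighbourhood of $0$ by $\mathfrak q(0)=1$), and, for $s\in\mathbb C$ of small modulus, $$\mu(s):=\sum_{n\ge1}\Big[\frac{\mathrm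 d^{n-1}\mathfrak q(z)^n}{\mathrm dz^{n-1}}\Big]_{z=0}\frac{s^n}{n!}.$$ Let $(d_n)_{n\ge0}$ be the sequence of coefficients of the asymptotic expansion of $\Gamma(x+1)\mathrm e^x/(x^x\sqrt{2\pi x})$ in increasing powers of $1/x$ as $x\to+\infty$. For $m\in\mathbb N$ and $0<v<r_\nu$ define $$g_{\nu,m}(v):=\sum_{0\le j\le m}\frac{d_{m-j}\,\Gamma(j+\frac12)\,2^j}{v^m\sqrt\pi}\sum_{0\le n\le 2j}\frac{\mu^{(2j-n+1)}(0)}{n!\,(2j-n)!}\Big[\frac{\mathrm d^n F_\nu(v\mathrm e^{i\mu(\tau)})}{\mathrm d\tau^n}\Big]_{\tau=0}.$$ **Theorem.** Write $\log_2 p:=\log\log p$. Let $\nu\in\{\omega,\Omega\}$, let $M\ge0$ be an integer and let $0<a<b<r_\nu$ be real numbers. Then, uniformly for all primes $p\ge3$ and all $k\in\mathbb N$ such that $a\le k/\log_2p\le b$, $$\lambda_\nu(p,k)=\frac{(\log_2p)^k}{k!}\bigg\{\sum_{0\le m\le M}\frac{g_{\nu,m}(k/\log_2p)}{(\log_2p)^m}+O\bigg(\frac1{(\log_2p)^{M+1}}\bigg)\bigg\},$$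 where the implied constant depends at most on $\nu,M,a,b$. -/

import Mathlib

namespace LogMean

open Filter Topology

/-- The two additive functions counting prime factors: `om` stands for `ω` (prime factors counted
without multiplicity), `Om` for `Ω` (prime factors counted with multiplicity). -/
inductive PrimeCount
  | om
  | Om

/-- The arithmetic function `ν ∈ {ω, Ω}`. -/
def nu : PrimeCount → ℕ → ℕ
  | .om, n => ArithmeticFunction.cardDistinctFactors n
  | .Om, n => ArithmeticFunction.cardFactors n

/-- `r_ω = ∞` and `r_Ω = 2`. -/
noncomputable def radius : PrimeCount → EReal
  | .om => ⊤
  | .Om => 2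

/-- The general factor, at the prime `q`, of the Euler product `H_ν(z)`. -/
noncomputable def eulerFactor : PrimeCount → ℂ → ℕ → ℂ
  | .om, z, q => (1 - 1 / (q : ℂ)) ^ z * (1 + z / ((q : ℂ) - 1))
  | .Om, z, q => (1 - 1 / (q : ℂ)) ^ z * (1 - z / (q : ℂ))⁻¹

/-- `H_ν(z)`, a product over all primes. -/
noncomputable def eulerH (ν : PrimeCount) (z : ℂ) : ℂ :=
  ∏' q : Nat.Primes, eulerFactor ν z (q : ℕ)

/-- `F_ν(z) = e^{γ z} H_ν(z)`, where `γ` is the Euler–Mascheroni constant. -/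
noncomputable def eulerF (ν : PrimeCount) (z : ℂ) : ℂ :=
  Complex.exp ((Real.eulerMascheroniConstant : ℂ) * z) * eulerH ν z

/-- `√(z² / (2 (1 + iz - e^{iz})))` (principal determination), extended analytically by the
value `1` at `z = 0`. -/
noncomputable def qfun (z : ℂ) : ℂ :=
  if z = 0 then 1
  else (z ^ 2 / (2 * (1 + Complex.I * z - Complex.exp (Complex.I * z)))) ^ (1 / 2 : ℂ)

/-- The power series `μ(s) = ∑_{n ≥ 1} [d^{n-1} q(z)^n / dz^{n-1}]_{z = 0} s^n / n!`; it has a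
positive radius of convergence, and only its germ at `0` is used. The summation index
below is `n - 1`. -/
noncomputable def mu (s : ℂ) : ℂ :=
  ∑' n : ℕ, iteratedDeriv n (fun z => qfun z ^ (n + 1)) 0 * (s ^ (n + 1) / (Nat.factorial (n + 1)))

/-- `x ↦ Γ(x + 1) e^x / (x^x √(2πx))`. -/
noncomputable def stirlingRatio (x : ℝ) : ℝ :=
  Real.Gamma (x + 1) * Real.exp x / (x ^ x * Real.sqrt (2 * Real.pi * x))

/-- The coefficients `d_n` of the asymptotic expansion of `stirlingRatio x` in increasing powers
of `1 / x`, as `x → +∞`: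
`d_n = lim_{x → +∞} x^n (stirlingRatio x - ∑_{j < n} d_j / x^j)`. -/
noncomputable def stirlingCoeff (n : ℕ) : ℝ :=
  limUnder atTop fun x : ℝ =>
    x ^ n * (stirlingRatio x - ∑ j : Fin n, stirlingCoeff (j : ℕ) / x ^ (j : ℕ))
termination_by n
decreasing_by exact j.isLt

/-- The saddle-point coefficient `C_{m, φ}(v)`. -/
noncomputable def saddleCoeff (m : ℕ) (φ : ℂ → ℂ) (v : ℝ) : ℂ :=
  ∑ j ∈ Finset.range (m + 1),
    ((stirlingCoeff (m - j) * Real.Gamma ((j : ℝ) + 1 / 2) * 2 ^ j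
        / (v ^ m * Real.sqrt Real.pi) : ℝ) : ℂ) *
      ∑ n ∈ Finset.range (2 * j + 1),
        iteratedDeriv (2 * j - n + 1) mu 0 / (Nat.factorial n * Nat.factorial (2 * j - n)) *
          iteratedDeriv n (fun τ : ℂ => φ ((v : ℂ) * Complex.exp (Complex.I * mu τ))) 0

/-- `g_{ν, m}(v) = C_{m, F_ν}(v)`. -/
noncomputable def gCoeff (ν : PrimeCount) (m : ℕ) (v : ℝ) : ℂ :=
  saddleCoeff m (eulerF ν) v

/-- The integers `a ≥ 1` with `P⁺(a) < p` and `ν(a) = k` (with `P⁺(1) = 1`):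
`Nat.smoothNumbers p` is the set of `a ≠ 0` all of whose prime factors are `< p`. -/
def lambdaSet (ν : PrimeCount) (p k : ℕ) : Set ℕ :=
  {a | a ∈ Nat.smoothNumbers p ∧ nu ν a = k}

/-- `λ_ν(p, k)`, the sum of `1 / a` over the `a ≥ 1` with `P⁺(a) < p` and `ν(a) = k`. -/
noncomputable def lambda (ν : PrimeCount) (p k : ℕ) : ℝ :=
  ∑' a : lambdaSet ν p k, 1 / ((a : ℕ) : ℝ)

/-- The series defining `λ_ν(p, k)` converges. -/
theorem summable_lambda (ν : PrimeCount) (p k : ℕ) :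
    Summable fun a : lambdaSet ν p k => 1 / ((a : ℕ) : ℝ) := by
  let f : ℕ →* ℝ :=
    ((invMonoidWithZeroHom : ℝ →*₀ ℝ) : ℝ →* ℝ).comp (Nat.castRingHom ℝ : ℕ →* ℝ)
  have hf : ∀ n : ℕ, f n = 1 / (n : ℝ) := fun n => by
    rw [one_div]; rfl
  have h := (EulerProduct.summable_and_hasSum_smoothNumbers_prod_primesBelow_geometric
    (f := f) (fun {q} hq => by
      have h1 : (1 : ℝ) < q := by exact_mod_cast hq.one_lt
      rw [hf, Real.norm_of_nonneg (by positivity)]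
      exact (div_lt_one (by linarith)).2 h1) p).2.summable
  simp only [hf] at h
  exact h.comp_injective
    (i := fun a : lambdaSet ν p k => (⟨a.1, a.2.1⟩ : Nat.smoothNumbers p))
    (fun a b hab => Subtype.ext (congrArg (fun x : Nat.smoothNumbers p => (x : ℕ)) hab))

/-- `log₂ p = log log p`, the iterated logarithm. -/
noncomputable def loglog (p : ℕ) : ℝ := Real.log (Real.log p)

end LogMean

/-! Write L = log log p, v = k/L, and let (k)_j be the falling factorial. The Euler product turns
the generating function ∑_k λ_ν(p,k) z^k into e^{Lz} G_p(z), where G_p = `partialF` is analytic in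
any disc of radius R < r_ν. Mertens' third theorem with an error term gives G_p = F_ν + O(1/log p)
uniformly for |z| ≤ r < r_ν (`exists_norm_partialF_sub_eulerF_le`). Since log p = e^L, this error is
smaller than any power of 1/L.

The coefficient of z^k is then read off from the Cauchy product (`lambda_eq_sum`), with
L^{k-j}/(k-j)! = (L^k/k!) v^j (k)_j/k^j. The quotient (k)_j/k^j = ∏_{i<j}(1 - i/k) is a polynomial
in 1/k with coefficients `fallingCoeff m j`, and cutting it at order M costs at most
j^{2(M+1)}/k^{M+1}. That loss is summable against f_j v^j, where the f_j are the Taylor coefficients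
of F_ν, because these decay geometrically for v ≤ b < r. The outcome
(`exists_norm_sum_taylorCoeff_sub_le`) is the required expansion, with ∑_j f_j v^j `fallingCoeff m
j` in front of k^{-m} = (vL)^{-m}.

It remains to recognise these sums as v^m g_{ν,m}(v) (`gCoeff_eq_tsum`). Both are linear in F_ν, so
one expands F_ν in powers of z = v e^{iμ} (`hasSum_taylorCoeff_comp_mu`) and is left with an
identity for monomials, `sum_stirlingCoeff_mul_saddleMoment`. The differential equation of μ gives
`saddleMoment` the recursion in j that defines `fallingCoeff`, so only j = 0 matters: there the
Stirling series and the series of the `saddleMoment 0 l` must be formal inverses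
(`sum_stirlingCoeff_mul`).

This last fact is obtained analytically at integers. By Cauchy's formula the integral of
e^{-k(1+iθ-e^{iθ})} over a period, suitably normalised, is exactly the reciprocal of the Stirling
ratio at k. Laplace's method in the coordinate t with θ = μ(t) expands it; Lagrange inversion
identifies the series μ with the local inverse of √(2(1+iz-e^{iz})). The same Laplace theorem,
applied to Euler's integral, shows that the Stirling expansion exists and hence that the limits
defining d_n do. -/

namespace LogMean

open Filter Topology

/-! ### Mertens' theorems -/

/-- The weight `-log (1 - 1 / q)` of the prime `q`. -/
noncomputable def primeWeight (q : ℕ) : ℝ := -Real.log (1 - 1 / (q : ℝ))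

theorem one_div_le_primeWeight {q : ℕ} (hq : 2 ≤ q) : 1 / (q : ℝ) ≤ primeWeight q := by
  have h2 : (2 : ℝ) ≤ q := by exact_mod_cast hq
  have h0 : (0 : ℝ) < 1 - 1 / (q : ℝ) := by
    have : 1 / (q : ℝ) ≤ 1 / 2 := one_div_le_one_div_of_le (by norm_num) h2
    linarith
  have := Real.log_le_sub_one_of_pos h0
  unfold primeWeight
  linarith

theorem primeWeight_le {q : ℕ} (hq : 2 ≤ q) : primeWeight q ≤ 1 / ((q : ℝ) - 1) := by
  have h2 : (2 : ℝ) ≤ q := by exact_mod_cast hq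
  have h0 : (0 : ℝ) < 1 - 1 / (q : ℝ) := by
    have : 1 / (q : ℝ) ≤ 1 / 2 := one_div_le_one_div_of_le (by norm_num) h2
    linarith
  have := Real.log_le_sub_one_of_pos (inv_pos.2 h0)
  unfold primeWeight
  rw [← Real.log_inv]
  refine this.trans (le_of_eq ?_)
  have h3 : (q : ℝ) - 1 ≠ 0 := by linarith
  have h4 : (q : ℝ) ≠ 0 := by linarith
  have h5 : 1 - 1 / (q : ℝ) = (q - 1) / q := by field_simp
  rw [h5, inv_div]
  field_simp
  ring

theorem primeWeight_nonneg {q : ℕ} (hq : 2 ≤ q) : 0 ≤ primeWeight q :=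
  le_trans (by positivity) (one_div_le_primeWeight hq)

theorem log_factorial_eq_sum_primesLE (N : ℕ) :
    Real.log (Nat.factorial N) =
      ∑ q ∈ Nat.primesLE N, ((Nat.factorial N).factorization q : ℝ) * Real.log q := by
  rw [Real.log_nat_eq_sum_factorization, Finsupp.sum]
  refine Finset.sum_subset (fun q hq => ?_) (fun q _ hq => ?_)
  · rw [Nat.support_factorization] at hq
    have hp := Nat.prime_of_mem_primeFactors hq
    exact Nat.mem_primesLE.2 ⟨(hp.dvd_factorial).1 (Nat.dvd_of_mem_primeFactors hq), hp⟩
  · rw [Finsupp.notMem_support_iff.1 hq]; simp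

/-- Legendre's formula: the lower bound keeps only the term ⌊N/q⌋, the upper one sums the geometric
series. -/
theorem factorization_factorial_bounds {q : ℕ} (hq : q.Prime) (N : ℕ) :
    (N : ℝ) / q - 1 ≤ ((Nat.factorial N).factorization q : ℝ) ∧
      ((Nat.factorial N).factorization q : ℝ) ≤ N / ((q : ℝ) - 1) := by
  have h2 : (2 : ℝ) ≤ q := by exact_mod_cast hq.two_le
  constructor
  · have h1 : N / q ≤ (Nat.factorial N).factorization q := by
      rw [Nat.factorization_factorial hq (b := Nat.log q N + 2) (by omega)]
      have := Finset.single_le_sum (f := fun i => N / q ^ i) (fun _ _ => Nat.zero_le _)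
        (Finset.mem_Ico.2 ⟨le_refl 1, by omega⟩ : 1 ∈ Finset.Ico 1 (Nat.log q N + 2))
      simpa using this
    have h3 : (N : ℝ) / q < (N / q : ℕ) + 1 := by
      rw [div_lt_iff₀ (by linarith)]
      have := Nat.lt_mul_div_succ N hq.pos
      have h4 : (N : ℝ) < (q * (N / q + 1) : ℕ) := by exact_mod_cast this
      push_cast at h4 ⊢
      linarith
    have h4 : ((N / q : ℕ) : ℝ) ≤ ((Nat.factorial N).factorization q : ℝ) := by exact_mod_cast h1
    linarith
  · have h1 := Nat.factorization_factorial_le_div_pred hq N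
    have h5 : ((N / (q - 1) : ℕ) : ℝ) ≤ (N : ℝ) / ((q - 1 : ℕ) : ℝ) := Nat.cast_div_le
    rw [Nat.cast_sub hq.one_lt.le, Nat.cast_one] at h5
    exact le_trans (by exact_mod_cast h1) h5

/-- The upper and lower bounds for log N! carry the weights 1/(q-1) and 1/q. Their difference is
O(1/q²), so even against log q it costs only a bounded amount. -/
theorem exists_sum_log_mul_le :
    ∃ K : ℝ, ∀ N : ℕ,
      ∑ q ∈ Nat.primesLE N, Real.log q * (1 / ((q : ℝ) - 1) - 1 / q) ≤ K := by
  have hs : Summable fun n : ℕ => 4 * (1 / (n : ℝ) ^ (3 / 2 : ℝ)) :=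
    (Real.summable_one_div_nat_rpow.2 (by norm_num)).mul_left 4
  refine ⟨∑' n : ℕ, 4 * (1 / (n : ℝ) ^ (3 / 2 : ℝ)), fun N => ?_⟩
  refine le_trans (Finset.sum_le_sum fun q hq => ?_)
    (hs.sum_le_tsum (Nat.primesLE N) fun _ _ => by positivity)
  have hp := Nat.prime_of_mem_primesLE hq
  have h2 : (2 : ℝ) ≤ q := by exact_mod_cast hp.two_le
  have h1 : Real.log q ≤ (q : ℝ) ^ (1 / 2 : ℝ) / (1 / 2) :=
    Real.log_le_rpow_div (by linarith) (by norm_num)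
  have h3 : 1 / ((q : ℝ) - 1) - 1 / q ≤ 2 / (q : ℝ) ^ 2 := by
    have h4 : (q : ℝ) - 1 ≠ 0 := by linarith
    have h5 : (q : ℝ) ≠ 0 := by linarith
    rw [show 1 / ((q : ℝ) - 1) - 1 / q = 1 / (((q : ℝ) - 1) * q) by field_simp; ring]
    rw [div_le_div_iff₀ (by nlinarith) (by positivity)]
    nlinarith
  have h6 : (q : ℝ) ^ (1 / 2 : ℝ) / (1 / 2) * (2 / (q : ℝ) ^ 2)
      = 4 * (1 / (q : ℝ) ^ (3 / 2 : ℝ)) := by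
    have hq0 : (0 : ℝ) < q := by linarith
    have h7 : (q : ℝ) ^ 2 = (q : ℝ) ^ (1 / 2 : ℝ) * (q : ℝ) ^ (3 / 2 : ℝ) := by
      rw [← Real.rpow_add hq0]; norm_num
    have h8 : (0 : ℝ) < (q : ℝ) ^ (1 / 2 : ℝ) := by positivity
    have h9 : (0 : ℝ) < (q : ℝ) ^ (3 / 2 : ℝ) := by positivity
    rw [h7]; field_simp; norm_num
  rw [← h6]
  have h10 : 0 ≤ 1 / ((q : ℝ) - 1) - 1 / q := by
    have : 1 / (q : ℝ) ≤ 1 / ((q : ℝ) - 1) := one_div_le_one_div_of_le (by linarith) (by linarith)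
    linarith
  exact mul_le_mul h1 h3 h10 (by positivity)

/-- Mertens' first theorem. -/
theorem exists_abs_sum_primeWeight_mul_log_sub_log_le :
    ∃ B : ℝ, ∀ N : ℕ, 1 ≤ N →
      |∑ q ∈ Nat.primesLE N, primeWeight q * Real.log q - Real.log N| ≤ B := by
  obtain ⟨K, hK⟩ := exists_sum_log_mul_le
  -- S ≤ A ≤ T and T - S ≤ K, while comparison with log N! gives S ≤ log N + log 4 and T ≥ log N -
  -- 1.
  refine ⟨Real.log 4 + K + 1, fun N hN => ?_⟩
  have hN0 : (0 : ℝ) < N := by exact_mod_cast hN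
  have hlog : ∀ q ∈ Nat.primesLE N, 0 ≤ Real.log (q : ℝ) := fun q hq =>
    Real.log_natCast_nonneg q
  set A := ∑ q ∈ Nat.primesLE N, primeWeight q * Real.log q
  set S := ∑ q ∈ Nat.primesLE N, Real.log q * (1 / (q : ℝ))
  set T := ∑ q ∈ Nat.primesLE N, Real.log q * (1 / ((q : ℝ) - 1))
  have hSA : S ≤ A := Finset.sum_le_sum fun q hq => by
    rw [mul_comm]
    exact mul_le_mul_of_nonneg_right
      (one_div_le_primeWeight (Nat.prime_of_mem_primesLE hq).two_le) (hlog q hq)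
  have hAT : A ≤ T := Finset.sum_le_sum fun q hq => by
    rw [mul_comm (Real.log _)]
    exact mul_le_mul_of_nonneg_right
      (primeWeight_le (Nat.prime_of_mem_primesLE hq).two_le) (hlog q hq)
  have hTS : T - S ≤ K := by
    refine le_trans (le_of_eq ?_) (hK N)
    simp only [T, S, ← Finset.sum_sub_distrib, mul_sub]
  have hK0 : 0 ≤ K := by simpa using hK 0
  have hθ : ∑ q ∈ Nat.primesLE N, Real.log q ≤ Real.log 4 * N := by
    rw [← Chebyshev.theta_eq_sum_primesLE_log]
    exact Chebyshev.theta_le_log4_mul_x hN0.le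
  have hlow : N * S - Real.log 4 * N ≤ Real.log (Nat.factorial N) := by
    rw [log_factorial_eq_sum_primesLE]
    refine le_trans (sub_le_sub_left hθ _) ?_
    rw [Finset.mul_sum, ← Finset.sum_sub_distrib]
    refine Finset.sum_le_sum fun q hq => ?_
    have := mul_le_mul_of_nonneg_right
      (factorization_factorial_bounds (Nat.prime_of_mem_primesLE hq) N).1 (hlog q hq)
    refine le_trans (le_of_eq ?_) this
    ring
  have hup : Real.log (Nat.factorial N) ≤ N * T := by
    rw [log_factorial_eq_sum_primesLE, Finset.mul_sum]
    refine Finset.sum_le_sum fun q hq => ?_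
    have := mul_le_mul_of_nonneg_right
      (factorization_factorial_bounds (Nat.prime_of_mem_primesLE hq) N).2 (hlog q hq)
    refine le_trans this (le_of_eq ?_)
    ring
  have hf1 : Real.log (Nat.factorial N) ≤ N * Real.log N := by
    rw [← Real.log_pow]
    exact Real.log_le_log (by positivity) (by exact_mod_cast Nat.factorial_le_pow N)
  have hf2 : N * Real.log N - N ≤ Real.log (Nat.factorial N) := by
    have h1 := Stirling.le_log_factorial_stirling (n := N) (by omega)
    have h2 : 0 ≤ Real.log N := Real.log_natCast_nonneg N
    have h3 : 0 ≤ Real.log (2 * Real.pi) := Real.log_nonneg (by linarith [Real.pi_gt_three])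
    linarith
  have e1 : S ≤ Real.log N + Real.log 4 := by
    have : N * S ≤ N * (Real.log N + Real.log 4) := by linarith
    exact le_of_mul_le_mul_left this hN0
  have e2 : Real.log N - 1 ≤ T := by
    have : N * (Real.log N - 1) ≤ N * T := by linarith
    exact le_of_mul_le_mul_left this hN0
  have h4 : 0 ≤ Real.log 4 := Real.log_nonneg (by norm_num)
  rw [abs_le]
  constructor <;> linarith

/-- A sequence whose increments are bounded by those of a decreasing null sequence converges, with
the corresponding rate. -/
theorem exists_abs_sub_le_of_abs_succ_sub_le {V u : ℕ → ℝ} {n₀ : ℕ} {K : ℝ}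
    (hu : Tendsto u atTop (𝓝 0)) 
    (h : ∀ n, n₀ ≤ n → |V (n + 1) - V n| ≤ K * (u n - u (n + 1))) :
    ∃ c : ℝ, ∀ n, n₀ ≤ n → |V n - c| ≤ K * u n := by
  have hd : ∀ n m, n₀ ≤ n → n ≤ m → |V m - V n| ≤ K * u n - K * u m := by
    intro n m hn hm
    induction m, hm using Nat.le_induction with
    | base => simp
    | succ m hm ih =>
      have h1 := h m (hn.trans hm)
      have h2 : |V (m + 1) - V n| ≤ |V (m + 1) - V m| + |V m - V n| := abs_sub_le _ _ _
      linarith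
  have hKu : Tendsto (fun n => K * u n) atTop (𝓝 0) := by simpa using hu.const_mul K
  have hc : CauchySeq V := by
    rw [Metric.cauchySeq_iff']
    intro ε hε
    have h1 := (Metric.tendsto_atTop.1 hKu) (ε / 2) (by positivity)
    obtain ⟨N, hN⟩ := h1
    refine ⟨max N n₀, fun n hn => ?_⟩
    have h2 := hd (max N n₀) n (le_max_right _ _) hn
    have h3 := hN (max N n₀) (le_max_left _ _)
    have h4 := hN n ((le_max_left _ _).trans hn)
    rw [Real.dist_eq, sub_zero] at h3 h4
    rw [Real.dist_eq]
    have := abs_lt.1 h3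
    have := abs_lt.1 h4
    linarith
  obtain ⟨c, hc⟩ := cauchySeq_tendsto_of_complete hc
  refine ⟨c, fun n hn => ?_⟩
  have h1 : Tendsto (fun m => |V m - V n|) atTop (𝓝 |c - V n|) := (hc.sub_const _).abs
  have h2 : Tendsto (fun m => K * u n - K * u m) atTop (𝓝 (K * u n - 0)) := hKu.const_sub _
  have h3 := le_of_tendsto_of_tendsto h1 h2
    (eventually_atTop.2 ⟨n, fun m hm => hd n m hn hm⟩)
  rwa [sub_zero, abs_sub_comm] at h3

/-- The increment of log lies between (y-x)/y and (y-x)/x. With x = log N and y = log(N+1) the bound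
on the right telescopes. -/
theorem log_log_succ_sub_bounds {x y : ℝ} (hx : 0 < x) (hxy : x ≤ y) (h1 : y - x ≤ 1) :
    |(y - x) / y - (Real.log y - Real.log x)| ≤ 1 / x - 1 / y := by
  have hy : 0 < y := hx.trans_le hxy
  have e1 : Real.log y - Real.log x = Real.log (y / x) := (Real.log_div hy.ne' hx.ne').symm
  have e2 : Real.log y - Real.log x = -Real.log (x / y) := by
    rw [Real.log_div hx.ne' hy.ne']; ring
  have l1 := Real.log_le_sub_one_of_pos (div_pos hy hx)
  have l2 := Real.log_le_sub_one_of_pos (div_pos hx hy)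
  have e3 : (y - x) / y = 1 - x / y := by field_simp
  have e4 : y / x - 1 - (1 - x / y) = (y - x) * (1 / x - 1 / y) := by field_simp
  have h5 : 0 ≤ 1 / x - 1 / y := sub_nonneg.2 (one_div_le_one_div_of_le hx hxy)
  have h6 : (y - x) * (1 / x - 1 / y) ≤ 1 * (1 / x - 1 / y) := mul_le_mul_of_nonneg_right h1 h5
  rw [abs_le]
  constructor <;> linarith

/-- Mertens' second theorem for the weights `-log (1 - 1 / q)`, with an unspecified constant. -/
theorem exists_abs_sum_primeWeight_sub_loglog_sub_le :
    ∃ c K : ℝ, ∀ N : ℕ, 2 ≤ N →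
      |∑ q ∈ Nat.primesLE N, primeWeight q - loglog N - c| ≤ K / Real.log N := by
  obtain ⟨B, hB⟩ := exists_abs_sum_primeWeight_mul_log_sub_log_le
  set A : ℕ → ℝ := fun N => ∑ q ∈ Nat.primesLE N, primeWeight q * Real.log q with hA
  set D : ℕ → ℝ := fun N => ∑ q ∈ Nat.primesLE N, primeWeight q with hD
  set R : ℕ → ℝ := fun N => A N - Real.log N with hR
  -- Partial summation: once the term R/log N is removed, the increments are dominated by those of
  -- 1/log N, which is what `exists_abs_sub_le_of_abs_succ_sub_le` needs.
  set V : ℕ → ℝ := fun N => D N - loglog N - R N / Real.log N with hV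
  have hstep : ∀ N, 2 ≤ N →
      |V (N + 1) - V N| ≤ (B + 1) * (1 / Real.log N - 1 / Real.log (N + 1 : ℕ)) := by
    intro N hN
    have hN2 : (2 : ℝ) ≤ N := by exact_mod_cast hN
    have hx : 0 < Real.log N := Real.log_pos (by linarith)
    have hxy : Real.log N ≤ Real.log (N + 1 : ℕ) :=
      Real.log_le_log (by linarith) (by push_cast; linarith)
    have hy := hx.trans_le hxy
    have h1 : Real.log (N + 1 : ℕ) - Real.log N ≤ 1 := by
      rw [← Real.log_div (by positivity) (by positivity)]
      have h3 := Real.log_le_sub_one_of_pos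
        (show (0 : ℝ) < ((N + 1 : ℕ) : ℝ) / (N : ℝ) by positivity)
      have h4 : ((N + 1 : ℕ) : ℝ) / N - 1 = 1 / N := by push_cast; field_simp; ring
      have h5 : 1 / (N : ℝ) ≤ 1 := by
        rw [div_le_one (by linarith)]; linarith
      linarith
    have hDA : D (N + 1) - D N = (A (N + 1) - A N) / Real.log (N + 1 : ℕ) := by
      have hsplit : ∀ f : ℕ → ℝ, ∑ q ∈ Nat.primesLE (N + 1), f q - ∑ q ∈ Nat.primesLE N, f q
          = if (N + 1).Prime then f (N + 1) else 0 := by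
        intro f
        rw [Nat.primesLE_eq_filter_range, Nat.primesLE_eq_filter_range, Finset.sum_filter,
          Finset.sum_filter, Finset.sum_range_succ _ (N + 1)]
        ring
      rw [hD, hA]
      simp only [hsplit]
      split_ifs
      · field_simp
      · simp
    have key : V (N + 1) - V N = R N * (1 / Real.log N - 1 / Real.log (N + 1 : ℕ)) +
        ((Real.log (N + 1 : ℕ) - Real.log N) / Real.log (N + 1 : ℕ) -
          (Real.log (Real.log (N + 1 : ℕ)) - Real.log (Real.log N))) := by
      have : D (N + 1) = D N + (A (N + 1) - A N) / Real.log (N + 1 : ℕ) := by linarith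
      simp only [hV, hR, loglog, this]
      field_simp
      ring
    have hb := log_log_succ_sub_bounds hx hxy h1
    have h5 : 0 ≤ 1 / Real.log N - 1 / Real.log (N + 1 : ℕ) :=
      sub_nonneg.2 (one_div_le_one_div_of_le hx hxy)
    rw [key]
    refine (abs_add_le _ _).trans ?_
    rw [abs_mul, abs_of_nonneg h5, add_mul, one_mul]
    exact add_le_add (mul_le_mul_of_nonneg_right (hB N (by omega)) h5) hb
  have hu : Tendsto (fun N : ℕ => 1 / Real.log N) atTop (𝓝 0) := by
    simp only [one_div]
    exact tendsto_inv_atTop_zero.comp (Real.tendsto_log_atTop.comp tendsto_natCast_atTop_atTop)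
  obtain ⟨c, hc⟩ := exists_abs_sub_le_of_abs_succ_sub_le hu hstep
  refine ⟨c, (B + 1) + B, fun N hN => ?_⟩
  have hN2 : (2 : ℝ) ≤ N := by exact_mod_cast hN
  have hx : 0 < Real.log N := Real.log_pos (by linarith)
  have h1 := hc N hN
  have h2 : |R N / Real.log N| ≤ B / Real.log N := by
    rw [abs_div, abs_of_pos hx]
    exact div_le_div_of_nonneg_right (hB N (by omega)) hx.le
  have h3 : D N - loglog N - c = (V N - c) + R N / Real.log N := by simp only [hV]; ring
  rw [h3, add_div]
  refine (abs_add_le _ _).trans (add_le_add (h1.trans (le_of_eq ?_)) h2)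
  ring

/-! ### Identifying the constant in Mertens' theorem through ζ near 1 -/

/-- `primeWeight`, extended by `0` to the integers which are not prime. -/
noncomputable def primeIndWeight (q : ℕ) : ℝ := if q.Prime then primeWeight q else 0

/-- The logarithm of the factor at `q` of `ζ(1 + ε)`, extended by `0` to composite integers. -/
noncomputable def logZetaFactor (ε : ℝ) (q : ℕ) : ℝ :=
  if q.Prime then -Real.log (1 - (q : ℝ) ^ (-(1 + ε))) else 0

theorem primeIndWeight_nonneg (q : ℕ) : 0 ≤ primeIndWeight q := by
  unfold primeIndWeight
  split_ifs with h
  · exact primeWeight_nonneg h.two_le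
  · exact le_rfl

theorem neg_log_one_sub_bounds {x : ℝ} (hx : x < 1) :
    x ≤ -Real.log (1 - x) ∧ -Real.log (1 - x) ≤ x / (1 - x) := by
  have h0 : 0 < 1 - x := by linarith
  have h1 := Real.log_le_sub_one_of_pos h0
  have h2 := Real.log_le_sub_one_of_pos (inv_pos.2 h0)
  rw [Real.log_inv] at h2
  refine ⟨by linarith, h2.trans (le_of_eq ?_)⟩
  field_simp
  ring

/-- At a prime, both terms lie between q^{-1-ε} and q^{-1-ε} + 2q^{-2}. The uniformity in ε is what
dominated convergence uses as ε → 0. -/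
theorem abs_logZetaFactor_sub_le {ε : ℝ} (hε : 0 ≤ ε) (q : ℕ) :
    |logZetaFactor ε q - primeIndWeight q * (q : ℝ) ^ (-ε)| ≤ 2 * (1 / (q : ℝ) ^ 2) := by
  unfold logZetaFactor primeIndWeight primeWeight
  split_ifs with h
  · have h2 : (2 : ℝ) ≤ q := by exact_mod_cast h.two_le
    have hq0 : (0 : ℝ) < q := by linarith
    set y : ℝ := 1 / q with hy
    set t : ℝ := (q : ℝ) ^ (-ε) with ht
    have hy0 : 0 < y := by positivity
    have hy1 : y ≤ 1 / 2 := one_div_le_one_div_of_le (by norm_num) h2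
    have ht0 : 0 < t := by positivity
    have ht1 : t ≤ 1 := Real.rpow_le_one_of_one_le_of_nonpos (by linarith) (by linarith)
    have e1 : (q : ℝ) ^ (-(1 + ε)) = y * t := by
      rw [neg_add, Real.rpow_add hq0, Real.rpow_neg_one, hy, one_div]
    have e2 : 1 / (q : ℝ) ^ 2 = y ^ 2 := by rw [hy]; field_simp
    rw [e1, e2]
    have hyt : y * t ≤ y := by nlinarith
    obtain ⟨a1, a2⟩ := neg_log_one_sub_bounds (x := y) (by linarith)
    obtain ⟨b1, b2⟩ := neg_log_one_sub_bounds (x := y * t) (by linarith)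
    have c1 : y / (1 - y) ≤ y + 2 * y ^ 2 := by
      rw [div_le_iff₀ (by linarith)]; nlinarith
    have c2 : y * t / (1 - y * t) ≤ y * t + 2 * y ^ 2 := by
      rw [div_le_iff₀ (by linarith)]
      have : (y * t) * (y * t) ≤ y * y := mul_le_mul hyt hyt (by positivity) hy0.le
      nlinarith
    have d1 : y * t ≤ -Real.log (1 - y) * t := mul_le_mul_of_nonneg_right a1 ht0.le
    have d2 : -Real.log (1 - y) * t ≤ y * t + 2 * y ^ 2 := by
      have : -Real.log (1 - y) * t ≤ (y + 2 * y ^ 2) * t :=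
        mul_le_mul_of_nonneg_right (a2.trans c1) ht0.le
      nlinarith [sq_nonneg y]
    rw [abs_le]
    constructor <;> linarith
  · simp only [zero_mul, sub_zero, abs_zero]
    positivity

theorem summable_primeIndWeight_mul {ε : ℝ} (hε : 0 < ε) :
    Summable fun q : ℕ => primeIndWeight q * (q : ℝ) ^ (-ε) := by
  have hs : Summable fun q : ℕ => 2 * (q : ℝ) ^ (-1 - ε) :=
    (Real.summable_nat_rpow.2 (by linarith)).mul_left 2
  refine Summable.of_nonneg_of_le
    (fun q => mul_nonneg (primeIndWeight_nonneg q) (by positivity)) (fun q => ?_) hs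
  unfold primeIndWeight
  split_ifs with h
  · have h2 : (2 : ℝ) ≤ q := by exact_mod_cast h.two_le
    have hq0 : (0 : ℝ) < q := by linarith
    rw [sub_eq_add_neg, Real.rpow_add hq0, ← mul_assoc]
    refine mul_le_mul_of_nonneg_right ((primeWeight_le h.two_le).trans ?_) (by positivity)
    rw [Real.rpow_neg_one, ← div_eq_mul_inv, div_le_div_iff₀ (by linarith) hq0]
    linarith
  · rw [zero_mul]; positivity

theorem summable_logZetaFactor_sub {ε : ℝ} (hε : 0 ≤ ε) :
    Summable fun q : ℕ => logZetaFactor ε q - primeIndWeight q * (q : ℝ) ^ (-ε) := by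
  have hs : Summable fun q : ℕ => 2 * (1 / (q : ℝ) ^ 2) :=
    (Real.summable_one_div_nat_pow.2 (by norm_num)).mul_left 2
  exact Summable.of_norm_bounded hs fun q => by
    rw [Real.norm_eq_abs]; exact abs_logZetaFactor_sub_le hε q

theorem summable_logZetaFactor {ε : ℝ} (hε : 0 < ε) : Summable (logZetaFactor ε) := by
  have := (summable_logZetaFactor_sub hε.le).add (summable_primeIndWeight_mul hε)
  simpa using this

theorem tendsto_tsum_logZetaFactor_sub :
    Tendsto (fun ε : ℝ => ∑' q : ℕ, logZetaFactor ε q -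
      ∑' q : ℕ, primeIndWeight q * (q : ℝ) ^ (-ε)) (𝓝[>] 0) (𝓝 0) := by
  have hs : Summable fun q : ℕ => 2 * (1 / (q : ℝ) ^ 2) :=
    (Real.summable_one_div_nat_pow.2 (by norm_num)).mul_left 2
  have key : Tendsto (fun ε : ℝ => ∑' q : ℕ, (logZetaFactor ε q -
      primeIndWeight q * (q : ℝ) ^ (-ε))) (𝓝[>] 0) (𝓝 (∑' _ : ℕ, (0 : ℝ))) := by
    refine tendsto_tsum_of_dominated_convergence hs (fun q => ?_) ?_
    · unfold logZetaFactor primeIndWeight primeWeight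
      split_ifs with h
      · have h2 : (2 : ℝ) ≤ q := by exact_mod_cast h.two_le
        have hq0 : (0 : ℝ) < q := by linarith
        have hc : ContinuousAt (fun ε : ℝ => -Real.log (1 - (q : ℝ) ^ (-(1 + ε))) -
            -Real.log (1 - 1 / (q : ℝ)) * (q : ℝ) ^ (-ε)) 0 := by
          have h3 : 1 - (q : ℝ) ^ (-(1 + (0 : ℝ))) ≠ 0 := by
            rw [add_zero, Real.rpow_neg_one]
            have : (q : ℝ)⁻¹ ≤ 2⁻¹ := inv_anti₀ (by norm_num) h2
            intro h; linarith
          have h4 : ContinuousAt (fun ε : ℝ => (q : ℝ) ^ (-(1 + ε))) 0 :=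
            (Real.continuousAt_const_rpow hq0.ne').comp (by fun_prop)
          have h5 : ContinuousAt (fun ε : ℝ => (q : ℝ) ^ (-ε)) 0 :=
            (Real.continuousAt_const_rpow hq0.ne').comp (by fun_prop)
          exact ((continuousAt_const.sub h4).log h3).neg.sub (continuousAt_const.mul h5)
        have h6 := hc.tendsto.mono_left (nhdsWithin_le_nhds (s := Set.Ioi 0))
        simpa [Real.rpow_neg_one] using h6
      · simp
    · filter_upwards [self_mem_nhdsWithin] with ε hε q
      rw [Real.norm_eq_abs]
      exact abs_logZetaFactor_sub_le (le_of_lt hε) q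
  rw [tsum_zero] at key
  refine key.congr' ?_
  filter_upwards [self_mem_nhdsWithin] with ε hε
  exact (summable_logZetaFactor hε).tsum_sub (summable_primeIndWeight_mul hε)

theorem riemannZeta_one_add_eq {ε : ℝ} (hε : 0 < ε) :
    riemannZeta (1 + ε) = ((Real.exp (∑' q : ℕ, logZetaFactor ε q) : ℝ) : ℂ) := by
  rw [← riemannZeta_eulerProduct_exp_log (by simpa using hε), Complex.ofReal_exp,
    Complex.ofReal_tsum]
  congr 1
  have h1 := tsum_subtype {p : ℕ | p.Prime}
    (fun p : ℕ => -Complex.log (1 - (p : ℂ) ^ (-(1 + (ε : ℂ)))))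
  refine Eq.trans h1 (tsum_congr fun q => ?_)
  unfold logZetaFactor
  by_cases h : q.Prime
  · rw [Set.indicator_of_mem (by exact h), if_pos h]
    have h2 : (2 : ℝ) ≤ q := by exact_mod_cast h.two_le
    have h3 : (q : ℝ) ^ (-(1 + ε)) ≤ 1 :=
      Real.rpow_le_one_of_one_le_of_nonpos (by linarith) (by linarith)
    rw [Complex.ofReal_neg, Complex.ofReal_log (by linarith), Complex.ofReal_sub,
      Complex.ofReal_cpow (by positivity)]
    push_cast
    rfl
  · rw [Set.indicator_of_notMem (by exact h), if_neg h]; simp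

/-- The logarithm of ε ζ(1+ε) → 1, i.e. of the residue of ζ at 1. -/
theorem tendsto_tsum_logZetaFactor_add_log :
    Tendsto (fun ε : ℝ => ∑' q : ℕ, logZetaFactor ε q + Real.log ε) (𝓝[>] 0) (𝓝 0) := by
  have h1 : Tendsto (fun ε : ℝ => (1 : ℂ) + ε) (𝓝[>] 0) (𝓝[≠] 1) := by
    refine tendsto_nhdsWithin_iff.2 ⟨?_, ?_⟩
    · have : Continuous fun ε : ℝ => (1 : ℂ) + ε := by fun_prop
      have := this.tendsto 0
      simp only [Complex.ofReal_zero, add_zero] at this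
      exact this.mono_left nhdsWithin_le_nhds
    · filter_upwards [self_mem_nhdsWithin] with ε hε
      have : ε ≠ 0 := ne_of_gt hε
      simpa using this
  have h2 := riemannZeta_residue_one.comp h1
  have h3 : Tendsto (fun ε : ℝ => ε * Real.exp (∑' q : ℕ, logZetaFactor ε q))
      (𝓝[>] 0) (𝓝 1) := by
    have h4 := (Complex.continuous_re.tendsto _).comp h2
    rw [Complex.one_re] at h4
    refine h4.congr' ?_
    filter_upwards [self_mem_nhdsWithin] with ε hε
    simp only [Function.comp_apply]
    rw [riemannZeta_one_add_eq hε, add_sub_cancel_left, ← Complex.ofReal_mul, Complex.ofReal_re]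
  have h5 := h3.log one_ne_zero
  rw [Real.log_one] at h5
  refine h5.congr' ?_
  filter_upwards [self_mem_nhdsWithin] with ε hε
  rw [Real.log_mul (ne_of_gt hε) (Real.exp_ne_zero _), Real.log_exp, add_comm]

theorem sum_range_primeIndWeight (N : ℕ) :
    ∑ q ∈ Finset.range (N + 1), primeIndWeight q = ∑ q ∈ Nat.primesLE N, primeWeight q := by
  rw [Nat.primesLE_eq_filter_range, Finset.sum_filter]
  rfl

/-- The sum of the weights of the primes in `(e^m, e^(m + 1)]`. -/
noncomputable def blockWeight (m : ℕ) : ℝ :=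
  ∑ q ∈ Finset.Ico (⌊Real.exp m⌋₊ + 1) (⌊Real.exp (m + 1 : ℕ)⌋₊ + 1), primeIndWeight q

theorem floor_exp_mono {m n : ℕ} (h : m ≤ n) : ⌊Real.exp m⌋₊ + 1 ≤ ⌊Real.exp n⌋₊ + 1 := by
  gcongr

/-- The first block begins after ⌊e^0⌋ = 1, so the terms at 0 and 1 have to vanish. -/
theorem sum_range_floor_exp_eq (f : ℕ → ℝ) (hf : ∀ q < 3, q ≠ 2 → f q = 0) (n : ℕ) :
    ∑ q ∈ Finset.range (⌊Real.exp n⌋₊ + 1), f q =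
      ∑ m ∈ Finset.range n,
        ∑ q ∈ Finset.Ico (⌊Real.exp m⌋₊ + 1) (⌊Real.exp (m + 1 : ℕ)⌋₊ + 1), f q := by
  induction n with
  | zero =>
    simp [Finset.sum_range_succ, hf]
  | succ n ih =>
    rw [Finset.sum_range_succ _ n, ← ih]
    exact (Finset.sum_range_add_sum_Ico f (floor_exp_mono (Nat.le_succ n))).symm

theorem mem_block_bounds {m q : ℕ}
    (hq : q ∈ Finset.Ico (⌊Real.exp m⌋₊ + 1) (⌊Real.exp (m + 1 : ℕ)⌋₊ + 1)) :
    (m : ℝ) ≤ Real.log q ∧ Real.log q ≤ m + 1 := by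
  rw [Finset.mem_Ico] at hq
  have h1 : Real.exp m < q := (Nat.floor_lt (by positivity)).1 (by omega)
  have h2 : (q : ℝ) ≤ Real.exp (m + 1 : ℕ) := (Nat.le_floor_iff (by positivity)).1 (by omega)
  have hq0 : (0 : ℝ) < q := (Real.exp_pos _).trans h1
  constructor
  · exact (Real.le_log_iff_exp_le hq0).2 h1.le
  · have := (Real.log_le_iff_le_exp hq0).2 h2
    simpa using this

theorem tendsto_floor_exp_atTop : Tendsto (fun n : ℕ => ⌊Real.exp n⌋₊ + 1) atTop atTop :=
  (tendsto_add_atTop_nat 1).comp (tendsto_nat_floor_atTop.comp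
    (Real.tendsto_exp_atTop.comp tendsto_natCast_atTop_atTop))

theorem blockWeight_nonneg (m : ℕ) : 0 ≤ blockWeight m :=
  Finset.sum_nonneg fun q _ => primeIndWeight_nonneg q

/-- The series `∑ w_q q^{-ε}` lies between `e^{-ε} ∑ B_m e^{-ε m}` and `∑ B_m e^{-ε m}`, where
`B_m` are the block weights. -/
theorem summable_blockWeight_and_bounds {ε : ℝ} (hε : 0 < ε) :
    Summable (fun m : ℕ => blockWeight m * Real.exp (-ε) ^ m) ∧
    Real.exp (-ε) * ∑' m : ℕ, blockWeight m * Real.exp (-ε) ^ m ≤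
      ∑' q : ℕ, primeIndWeight q * (q : ℝ) ^ (-ε) ∧
    ∑' q : ℕ, primeIndWeight q * (q : ℝ) ^ (-ε) ≤
      ∑' m : ℕ, blockWeight m * Real.exp (-ε) ^ m := by
  set x := Real.exp (-ε) with hx
  have hx0 : 0 < x := Real.exp_pos _
  set f : ℕ → ℝ := fun q => primeIndWeight q * (q : ℝ) ^ (-ε) with hf
  have hsf : Summable f := summable_primeIndWeight_mul hε
  have hf0 : ∀ q, 0 ≤ f q := fun q => mul_nonneg (primeIndWeight_nonneg q) (by positivity)
  have hfz : ∀ q < 3, q ≠ 2 → f q = 0 := by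
    intro q h3 h2
    have : ¬ q.Prime := by
      interval_cases q <;> first | decide | exact absurd rfl h2
    simp [hf, primeIndWeight, this]
  have hblock : ∀ m : ℕ, x * (blockWeight m * x ^ m) ≤
      ∑ q ∈ Finset.Ico (⌊Real.exp m⌋₊ + 1) (⌊Real.exp (m + 1 : ℕ)⌋₊ + 1), f q ∧
      ∑ q ∈ Finset.Ico (⌊Real.exp m⌋₊ + 1) (⌊Real.exp (m + 1 : ℕ)⌋₊ + 1), f q ≤
        blockWeight m * x ^ m := by
    intro m
    have hpow : ∀ q ∈ Finset.Ico (⌊Real.exp m⌋₊ + 1) (⌊Real.exp (m + 1 : ℕ)⌋₊ + 1),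
        x * x ^ m ≤ (q : ℝ) ^ (-ε) ∧ (q : ℝ) ^ (-ε) ≤ x ^ m := by
      intro q hq
      obtain ⟨h1, h2⟩ := mem_block_bounds hq
      have hq0 : (0 : ℝ) < q := by
        have := (Finset.mem_Ico.1 hq).1
        exact_mod_cast (Nat.succ_pos _).trans_le this
      rw [Real.rpow_def_of_pos hq0, ← pow_succ', hx, ← Real.exp_nat_mul, ← Real.exp_nat_mul,
        Real.exp_le_exp, Real.exp_le_exp]
      push_cast
      constructor <;> nlinarith
    unfold blockWeight
    constructor
    · rw [mul_comm (Finset.sum _ _), ← mul_assoc, Finset.mul_sum]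
      refine Finset.sum_le_sum fun q hq => ?_
      rw [mul_comm]
      exact mul_le_mul_of_nonneg_left (hpow q hq).1 (primeIndWeight_nonneg q)
    · rw [Finset.sum_mul]
      exact Finset.sum_le_sum fun q hq =>
        mul_le_mul_of_nonneg_left (hpow q hq).2 (primeIndWeight_nonneg q)
  have hpart : ∀ n : ℕ, x * ∑ m ∈ Finset.range n, blockWeight m * x ^ m ≤
      ∑ q ∈ Finset.range (⌊Real.exp n⌋₊ + 1), f q ∧
      ∑ q ∈ Finset.range (⌊Real.exp n⌋₊ + 1), f q ≤
        ∑ m ∈ Finset.range n, blockWeight m * x ^ m := by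
    intro n
    rw [sum_range_floor_exp_eq f hfz, Finset.mul_sum]
    exact ⟨Finset.sum_le_sum fun m _ => (hblock m).1, Finset.sum_le_sum fun m _ => (hblock m).2⟩
  have hs : Summable (fun m : ℕ => blockWeight m * x ^ m) := by
    refine summable_of_sum_range_le (c := (∑' q, f q) / x)
      (fun m => mul_nonneg (blockWeight_nonneg m) (by positivity)) (fun n => ?_)
    rw [le_div_iff₀ hx0, mul_comm]
    exact (hpart n).1.trans (hsf.sum_le_tsum _ fun q _ => hf0 q)
  have t1 := hs.hasSum.tendsto_sum_nat
  have t2 := hsf.hasSum.tendsto_sum_nat.comp tendsto_floor_exp_atTop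
  exact ⟨hs, le_of_tendsto_of_tendsto' (t1.const_mul x) t2 fun n => (hpart n).1,
    le_of_tendsto_of_tendsto' t2 t1 fun n => (hpart n).2⟩

/-- log ⌊e^n⌋ lies between n - log 2 and n, so its ratio to n tends to 1. -/
theorem tendsto_loglog_floor_exp_sub_log :
    Tendsto (fun n : ℕ => loglog ⌊Real.exp n⌋₊ - Real.log n) atTop (𝓝 0) := by
  have h1 : Tendsto (fun n : ℕ => Real.log ⌊Real.exp n⌋₊ / n) atTop (𝓝 1) := by
    have h2 : Tendsto (fun n : ℕ => 1 - Real.log 2 / (n : ℝ)) atTop (𝓝 1) := by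
      simpa using (tendsto_const_div_atTop_nhds_zero_nat (Real.log 2)).const_sub 1
    refine tendsto_of_tendsto_of_tendsto_of_le_of_le' h2 tendsto_const_nhds ?_ ?_
    · filter_upwards [eventually_ge_atTop 1] with n hn
      have hn0 : (0 : ℝ) < n := by exact_mod_cast hn
      have h3 : Real.exp n / 2 ≤ ⌊Real.exp n⌋₊ := by
        have := Nat.lt_floor_add_one (Real.exp n)
        have h4 : (n : ℝ) + 1 ≤ Real.exp n := Real.add_one_le_exp _
        have h5 : (1 : ℝ) ≤ n := by exact_mod_cast hn
        linarith
      have h4 := Real.log_le_log (by positivity) h3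
      rw [Real.log_div (by positivity) (by norm_num), Real.log_exp] at h4
      rw [le_div_iff₀ hn0, sub_mul, one_mul, div_mul_cancel₀ _ hn0.ne']
      exact h4
    · filter_upwards [eventually_ge_atTop 1] with n hn
      have hn0 : (0 : ℝ) < n := by exact_mod_cast hn
      rw [div_le_one hn0]
      have h3 : ((⌊Real.exp n⌋₊ : ℕ) : ℝ) ≤ Real.exp n := Nat.floor_le (by positivity)
      have h4 : 1 ≤ ⌊Real.exp n⌋₊ :=
        (Nat.le_floor_iff (by positivity)).2 (by simp)
      have h5 : (0 : ℝ) < ⌊Real.exp n⌋₊ := by exact_mod_cast h4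
      exact (Real.log_le_iff_le_exp h5).2 h3
  have h2 := h1.log one_ne_zero
  rw [Real.log_one] at h2
  refine h2.congr' ?_
  filter_upwards [eventually_ge_atTop 1] with n hn
  have hn0 : (0 : ℝ) < n := by exact_mod_cast hn
  have h4 : 2 ≤ ⌊Real.exp n⌋₊ := by
    refine (Nat.le_floor_iff (by positivity)).2 ?_
    have h4 : (n : ℝ) + 1 ≤ Real.exp n := Real.add_one_le_exp _
    have h5 : (1 : ℝ) ≤ n := by exact_mod_cast hn
    push_cast
    linarith
  have h5 : (1 : ℝ) < ⌊Real.exp n⌋₊ := by exact_mod_cast h4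
  rw [Real.log_div (Real.log_pos h5).ne' hn0.ne']
  rfl

/-- Mertens' third theorem, with an error term. -/
theorem exists_abs_sum_primeWeight_sub_loglog_sub_eulerMascheroni_le :
    ∃ K : ℝ, ∀ N : ℕ, 2 ≤ N →
      |∑ q ∈ Nat.primesLE N, primeWeight q - loglog N - Real.eulerMascheroniConstant| ≤
        K / Real.log N := by
  obtain ⟨c, K, hcK⟩ := exists_abs_sum_primeWeight_sub_loglog_sub_le
  suffices hc : c - Real.eulerMascheroniConstant = 0 by
    rw [sub_eq_zero] at hc
    exact ⟨K, hc ▸ hcK⟩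
  have hN : Tendsto (fun n : ℕ => ⌊Real.exp n⌋₊) atTop atTop :=
    tendsto_nat_floor_atTop.comp (Real.tendsto_exp_atTop.comp tendsto_natCast_atTop_atTop)
  have hD : Tendsto (fun N : ℕ => ∑ q ∈ Nat.primesLE N, primeWeight q - loglog N) atTop (𝓝 c) := by
    rw [tendsto_iff_norm_sub_tendsto_zero]
    have h0 : Tendsto (fun N : ℕ => K / Real.log N) atTop (𝓝 0) :=
      (Real.tendsto_log_atTop.comp tendsto_natCast_atTop_atTop).const_div_atTop K
    refine squeeze_zero' (Eventually.of_forall fun _ => norm_nonneg _) ?_ h0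
    filter_upwards [eventually_ge_atTop 2] with N hN
    exact hcK N hN
  -- The block (e^m, e^{m+1}] is compared with the harmonic term 1/(m+1). This is where γ enters:
  -- the partial sums of `a` tend to c - γ.
  set a : ℕ → ℝ := fun m => blockWeight m - 1 / ((m : ℝ) + 1) with ha
  have hpart : Tendsto (fun n => ∑ m ∈ Finset.range n, a m) atTop
      (𝓝 (c - Real.eulerMascheroniConstant)) := by
    have h1 := ((hD.comp hN).add tendsto_loglog_floor_exp_sub_log).sub
      Real.tendsto_harmonic_sub_log
    rw [add_zero] at h1
    refine h1.congr fun n => ?_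
    have hz : ∀ q < 3, q ≠ 2 → primeIndWeight q = 0 := by
      intro q h3 h2
      have : ¬ q.Prime := by
        interval_cases q <;> first | decide | exact absurd rfl h2
      simp [primeIndWeight, this]
    have h2 := sum_range_floor_exp_eq primeIndWeight hz n
    rw [sum_range_primeIndWeight] at h2
    simp only [Function.comp_apply, ha, Finset.sum_sub_distrib]
    rw [h2]
    simp only [blockWeight, harmonic]
    push_cast
    simp only [one_div]
    ring
  -- Abel's theorem gives ∑ a_n x^n → c - γ as x → 1⁻. With x = e^{-ε}, the behaviour of ζ(1+ε) will
  -- show that the same limit is 0.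
  have habel := Real.tendsto_tsum_powerSeries_nhdsWithin_lt hpart
  have hxt : Tendsto (fun ε : ℝ => Real.exp (-ε)) (𝓝[>] 0) (𝓝[<] 1) := by
    refine tendsto_nhdsWithin_iff.2 ⟨?_, ?_⟩
    · have : Continuous fun ε : ℝ => Real.exp (-ε) := by fun_prop
      have := this.tendsto 0
      simp only [neg_zero, Real.exp_zero] at this
      exact this.mono_left nhdsWithin_le_nhds
    · filter_upwards [self_mem_nhdsWithin] with ε hε
      have : (0 : ℝ) < ε := hε
      simpa using this
  set P : ℝ → ℝ := fun x => ∑' n, a n * x ^ n with hP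
  set W : ℝ → ℝ := fun ε => ∑' q : ℕ, primeIndWeight q * (q : ℝ) ^ (-ε) with hW
  set S : ℝ → ℝ := fun x => ∑' m : ℕ, blockWeight m * x ^ m with hS
  have hPx : Tendsto (fun ε : ℝ => P (Real.exp (-ε))) (𝓝[>] 0)
      (𝓝 (c - Real.eulerMascheroniConstant)) := habel.comp hxt
  have hx1 : Tendsto (fun ε : ℝ => Real.exp (-ε)) (𝓝[>] 0) (𝓝 1) :=
    hxt.mono_right nhdsWithin_le_nhds
  -- The harmonic part sums to a logarithm: ∑ x^{m+1}/(m+1) = -log(1-x).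
  have hPS : ∀ ε : ℝ, 0 < ε → Real.exp (-ε) * P (Real.exp (-ε)) =
      Real.exp (-ε) * S (Real.exp (-ε)) + Real.log (1 - Real.exp (-ε)) := by
    intro ε hε
    have hlt : Real.exp (-ε) < 1 := by simpa using hε
    have hs1 := (summable_blockWeight_and_bounds hε).1
    have hs2 := Real.hasSum_pow_div_log_of_abs_lt_one (x := Real.exp (-ε))
      (by rwa [abs_of_pos (Real.exp_pos _)])
    have hs3 := (hs1.hasSum.mul_left (Real.exp (-ε))).sub hs2
    rw [hP, hS]
    simp only
    rw [← tsum_mul_left]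
    refine Eq.trans (tsum_congr fun m => ?_) (hs3.tsum_eq.trans (by ring))
    simp only [ha]
    ring
  have hu : Tendsto (fun ε : ℝ => 1 - Real.exp (-ε)) (𝓝[>] 0) (𝓝 0) := by
    simpa using hx1.const_sub 1
  have hulog : Tendsto (fun ε : ℝ => (1 - Real.exp (-ε)) * Real.log (1 - Real.exp (-ε)))
      (𝓝[>] 0) (𝓝 0) := by
    have := (Real.continuous_mul_log.tendsto 0).comp hu
    simpa [Function.comp_def] using this
  have hlogratio : Tendsto (fun ε : ℝ => Real.log (1 - Real.exp (-ε)) - Real.log ε)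
      (𝓝[>] 0) (𝓝 0) := by
    have hd : HasDerivAt (fun ε : ℝ => 1 - Real.exp (-ε)) 1 0 := by
      have := ((hasDerivAt_neg (0 : ℝ)).exp).const_sub 1
      simpa using this
    have h1 := (hasDerivAt_iff_tendsto_slope_zero.1 hd).mono_left
      (nhdsWithin_mono (0 : ℝ) (fun y (hy : (0 : ℝ) < y) => ne_of_gt hy))
    have h2 := h1.log one_ne_zero
    rw [Real.log_one] at h2
    refine h2.congr' ?_
    filter_upwards [self_mem_nhdsWithin] with ε hε
    have hε0 : (0 : ℝ) < ε := hε
    have hlt : Real.exp (-ε) < 1 := by simpa using hε0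
    simp only [zero_add, neg_zero, Real.exp_zero, sub_self, sub_zero, smul_eq_mul]
    rw [Real.log_mul (by positivity) (by linarith), Real.log_inv]
    ring
  -- W lies between xS and S, so the gap is at most (1-x)S. It vanishes in the limit because S = P -
  -- log(1-x)/x with P convergent, so S grows only logarithmically.
  have hgap : Tendsto (fun ε : ℝ => W ε - Real.exp (-ε) * S (Real.exp (-ε))) (𝓝[>] 0) (𝓝 0) := by
    have h1 : Tendsto (fun ε : ℝ => (1 - Real.exp (-ε)) * P (Real.exp (-ε)) -
        (1 - Real.exp (-ε)) * Real.log (1 - Real.exp (-ε)) / Real.exp (-ε)) (𝓝[>] 0) (𝓝 0) := by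
      have := (hu.mul hPx).sub (hulog.div hx1 one_ne_zero)
      simpa using this
    refine squeeze_zero' ?_ ?_ h1
    · filter_upwards [self_mem_nhdsWithin] with ε hε
      exact sub_nonneg.2 (summable_blockWeight_and_bounds hε).2.1
    · filter_upwards [self_mem_nhdsWithin] with ε hε
      have h2 := (summable_blockWeight_and_bounds hε).2.2
      have h3 := hPS ε hε
      have hpos := Real.exp_pos (-ε)
      have h4 : S (Real.exp (-ε)) = P (Real.exp (-ε)) -
          Real.log (1 - Real.exp (-ε)) / Real.exp (-ε) := by
        field_simp
        linarith
      have h5 : W ε - Real.exp (-ε) * S (Real.exp (-ε)) ≤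
          (1 - Real.exp (-ε)) * S (Real.exp (-ε)) := by
        have : W ε ≤ S (Real.exp (-ε)) := h2
        linarith
      refine h5.trans (le_of_eq ?_)
      rw [h4]
      ring
  have hlim : Tendsto (fun ε : ℝ => Real.exp (-ε) * P (Real.exp (-ε))) (𝓝[>] 0) (𝓝 0) := by
    have h1 := ((tendsto_tsum_logZetaFactor_add_log.sub tendsto_tsum_logZetaFactor_sub).sub
      hgap).add hlogratio
    rw [sub_zero, sub_zero, add_zero] at h1
    refine h1.congr' ?_
    filter_upwards [self_mem_nhdsWithin] with ε hε
    rw [hPS ε hε]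
    ring
  have hlim2 := hx1.mul hPx
  rw [one_mul] at hlim2
  exact tendsto_nhds_unique hlim2 hlim

/-! ### The Euler products -/

/-- The factor at `q` of the generating function `∑ z^{ν(a)} / a`. -/
noncomputable def localFactor : PrimeCount → ℂ → ℕ → ℂ
  | .om, z, q => 1 + z / ((q : ℂ) - 1)
  | .Om, z, q => (1 - z / (q : ℂ))⁻¹

/-- Writing (1-1/q)^z as e^{-w z}, with w the prime weight, collects the convergence factors of a
finite product into one exponential, to which Mertens' theorem applies. -/
theorem eulerFactor_eq (ν : PrimeCount) (z : ℂ) {q : ℕ} (hq : 2 ≤ q) :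
    eulerFactor ν z q = Complex.exp (-((primeWeight q : ℝ) : ℂ) * z) * localFactor ν z q := by
  have h2 : (2 : ℝ) ≤ q := by exact_mod_cast hq
  have h1 : 1 / (q : ℝ) ≤ 1 / 2 := one_div_le_one_div_of_le (by norm_num) h2
  have h3 : (1 - 1 / (q : ℂ)) ^ z = Complex.exp (-((primeWeight q : ℝ) : ℂ) * z) := by
    have h4 : (1 - 1 / (q : ℂ)) = ((1 - 1 / (q : ℝ) : ℝ) : ℂ) := by push_cast; rfl
    rw [h4, Complex.cpow_def_of_ne_zero (by
      rw [Ne, Complex.ofReal_eq_zero]; intro h; linarith), ← Complex.ofReal_log (by linarith)]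
    congr 2
    rw [primeWeight]
    push_cast
    ring
  cases ν <;> simp only [eulerFactor, localFactor, h3]

theorem lt_two_of_lt_radius {R : ℝ} (h : (R : EReal) < radius .Om) : R < 2 := by
  have : (R : EReal) < ((2 : ℝ) : EReal) := h
  exact_mod_cast this

/-- For Ω, the bound R < 2 gives |z/q| ≤ R/2 < 1 for every q ≥ 2, which keeps z away from the poles.
For ω no upper bound on R is needed. -/
theorem exists_norm_localFactor_sub_le (ν : PrimeCount) {R : ℝ} (hR : 0 ≤ R)
    (hRν : (R : EReal) < radius ν) :
    ∃ C : ℝ, 0 ≤ C ∧ ∀ z : ℂ, ‖z‖ ≤ R → ∀ q : ℕ, 2 ≤ q →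
      ‖localFactor ν z q - 1 - z / q‖ ≤ C * (1 / (q : ℝ) ^ 2) := by
  cases ν with
  | om =>
    refine ⟨2 * R, by positivity, fun z hz q hq => ?_⟩
    have h2 : (2 : ℝ) ≤ q := by exact_mod_cast hq
    have e : localFactor .om z q - 1 - z / q = z * ((1 / (((q : ℝ) - 1) * q) : ℝ) : ℂ) := by
      have h1 : (q : ℂ) ≠ 0 := by exact_mod_cast (by omega : q ≠ 0)
      have h3 : (q : ℂ) - 1 ≠ 0 := by
        rw [sub_ne_zero]; exact_mod_cast (by omega : q ≠ 1)
      simp only [localFactor]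
      push_cast
      field_simp
      ring
    rw [e, norm_mul, Complex.norm_real, Real.norm_of_nonneg (by
      have : 0 < (q : ℝ) - 1 := by linarith
      positivity)]
    have h4 : 1 / (((q : ℝ) - 1) * q) ≤ 2 * (1 / (q : ℝ) ^ 2) := by
      rw [mul_one_div, div_le_div_iff₀ (by nlinarith) (by positivity)]
      nlinarith
    calc ‖z‖ * (1 / (((q : ℝ) - 1) * q)) ≤ R * (2 * (1 / (q : ℝ) ^ 2)) :=
          mul_le_mul hz h4 (by
            have : 0 < (q : ℝ) - 1 := by linarith
            positivity) hR
      _ = 2 * R * (1 / (q : ℝ) ^ 2) := by ring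
  | Om =>
    have hR2 := lt_two_of_lt_radius hRν
    refine ⟨R ^ 2 / (1 - R / 2), div_nonneg (by positivity) (by linarith), fun z hz q hq => ?_⟩
    have h2 : (2 : ℝ) ≤ q := by exact_mod_cast hq
    set x : ℂ := z / q with hx
    have hxn : ‖x‖ = ‖z‖ / q := by rw [hx, norm_div, Complex.norm_natCast]
    have hx1 : ‖x‖ ≤ R / 2 := by
      rw [hxn]; exact div_le_div₀ hR hz (by norm_num) h2
    have hlow : 1 - R / 2 ≤ ‖1 - x‖ := by
      have := norm_sub_norm_le (1 : ℂ) x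
      rw [norm_one] at this
      linarith
    have hne : 1 - x ≠ 0 := by
      rw [← norm_pos_iff]; linarith
    have e : localFactor .Om z q - 1 - z / q = x ^ 2 / (1 - x) := by
      simp only [localFactor, ← hx]
      field_simp
      ring
    rw [e, norm_div, norm_pow, hxn]
    have h5 : (‖z‖ / q) ^ 2 ≤ R ^ 2 * (1 / (q : ℝ) ^ 2) := by
      rw [div_pow, mul_one_div]
      gcongr
    calc (‖z‖ / q) ^ 2 / ‖1 - x‖ ≤ (R ^ 2 * (1 / (q : ℝ) ^ 2)) / (1 - R / 2) :=
          div_le_div₀ (by positivity) h5 (by linarith) hlow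
      _ = R ^ 2 / (1 - R / 2) * (1 / (q : ℝ) ^ 2) := by ring

theorem exists_norm_eulerFactor_sub_one_le (ν : PrimeCount) {R : ℝ} (hR : 0 ≤ R)
    (hRν : (R : EReal) < radius ν) :
    ∃ C : ℝ, 0 ≤ C ∧ ∀ z : ℂ, ‖z‖ ≤ R → ∀ q : ℕ, 2 ≤ q →
      ‖eulerFactor ν z q - 1‖ ≤ C * (1 / (q : ℝ) ^ 2) := by
  obtain ⟨C, hC0, hC⟩ := exists_norm_localFactor_sub_le ν hR hRν
  set E : ℝ := (2 * R) ^ 2 * Real.exp (2 * R) with hE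
  refine ⟨2 * R + 2 * R ^ 2 + (1 + 2 * R) * C + E * (1 + R + C), by positivity,
    fun z hz q hq => ?_⟩
  have h2 : (2 : ℝ) ≤ q := by exact_mod_cast hq
  set t : ℝ := 1 / q with ht
  have ht2 : 1 / (q : ℝ) ^ 2 = t ^ 2 := by rw [ht]; field_simp
  have ht0 : 0 < t := by positivity
  have ht1 : t ≤ 1 / 2 := one_div_le_one_div_of_le (by norm_num) h2
  set w := primeWeight q with hw
  have hw1 : t ≤ w := one_div_le_primeWeight hq
  have hw2 : w ≤ t + 2 * t ^ 2 := by
    refine (primeWeight_le hq).trans ?_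
    rw [ht, div_le_iff₀ (by linarith)]
    field_simp
    nlinarith
  have hw3 : w ≤ 2 * t := by nlinarith
  have hw0 : 0 ≤ w := ht0.le.trans hw1
  set ρ := localFactor ν z q - 1 - z / q with hρ
  have hρb : ‖ρ‖ ≤ C * t ^ 2 := by rw [← ht2]; exact hC z hz q hq
  have hzt : z / q = z * (t : ℂ) := by rw [ht]; push_cast; ring
  set e := Complex.exp (-(w : ℂ) * z) - 1 - (-(w : ℂ) * z) with he
  have hwz : ‖-(w : ℂ) * z‖ ≤ 2 * t * R := by
    rw [norm_mul, norm_neg, Complex.norm_real, Real.norm_of_nonneg hw0]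
    exact mul_le_mul hw3 hz (norm_nonneg _) (by positivity)
  have heb : ‖e‖ ≤ E * t ^ 2 := by
    have h1 := Complex.norm_exp_sub_sum_le_norm_mul_exp (-(w : ℂ) * z) 2
    have h3 : Complex.exp (-(w : ℂ) * z) -
        ∑ m ∈ Finset.range 2, (-(w : ℂ) * z) ^ m / (Nat.factorial m : ℂ) = e := by
      simp [Finset.sum_range_succ, he]; ring
    rw [h3] at h1
    calc ‖e‖ ≤ ‖-(w : ℂ) * z‖ ^ 2 * Real.exp ‖-(w : ℂ) * z‖ := h1
      _ ≤ (2 * t * R) ^ 2 * Real.exp (2 * R) := by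
        gcongr
        refine hwz.trans ?_
        nlinarith
      _ = E * t ^ 2 := by rw [hE]; ring
  rw [eulerFactor_eq ν z hq, ht2]
  -- The exponential is 1 - wz + e and the local factor 1 + zt + ρ, with e and ρ of size O(t²). The
  -- linear terms leave only z(t-w), also O(t²). The bounds b1 to b4 on the four pieces add up to
  -- the announced constant.
  have key : Complex.exp (-(w : ℂ) * z) * localFactor ν z q - 1 =
      z * ((t - w : ℝ) : ℂ) + (-(w : ℂ) * z) * (z * t) + (1 + -(w : ℂ) * z) * ρ +
        e * (1 + z * t + ρ) := by
    have h1 : localFactor ν z q = 1 + z * t + ρ := by rw [hρ, hzt]; ring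
    have h3 : Complex.exp (-(w : ℂ) * z) = 1 + -(w : ℂ) * z + e := by rw [he]; ring
    rw [h1, h3]
    push_cast
    ring
  rw [key]
  have b1 : ‖z * ((t - w : ℝ) : ℂ)‖ ≤ R * (2 * t ^ 2) := by
    rw [norm_mul, Complex.norm_real, Real.norm_eq_abs]
    refine mul_le_mul hz ?_ (abs_nonneg _) hR
    rw [abs_le]
    constructor <;> nlinarith
  have hzt' : ‖z * (t : ℂ)‖ ≤ R * t := by
    rw [norm_mul, Complex.norm_real, Real.norm_of_nonneg ht0.le]
    exact mul_le_mul_of_nonneg_right hz ht0.le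
  have b2 : ‖(-(w : ℂ) * z) * (z * t)‖ ≤ (2 * t * R) * (R * t) := by
    rw [norm_mul]
    exact mul_le_mul hwz hzt' (norm_nonneg _) (by positivity)
  have b3 : ‖(1 + -(w : ℂ) * z) * ρ‖ ≤ (1 + 2 * R) * (C * t ^ 2) := by
    rw [norm_mul]
    refine mul_le_mul ?_ hρb (norm_nonneg _) (by positivity)
    refine (norm_add_le _ _).trans ?_
    rw [norm_one]
    nlinarith
  have b4 : ‖e * (1 + z * t + ρ)‖ ≤ (E * t ^ 2) * (1 + R + C) := by
    rw [norm_mul]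
    refine mul_le_mul heb ?_ (norm_nonneg _) (by positivity)
    have c1 : R * t ≤ R := mul_le_of_le_one_right hR (by linarith)
    have c2 : C * t ^ 2 ≤ C := mul_le_of_le_one_right hC0 (by nlinarith)
    refine (norm_add₃_le).trans ?_
    rw [norm_one]
    linarith
  refine (norm_add_le _ _).trans (le_trans (add_le_add ((norm_add₃_le).trans
    (add_le_add (add_le_add b1 b2) b3)) b4) (le_of_eq ?_))
  ring

/-- The partial products of `eulerH`. -/
noncomputable def partialEulerH (ν : PrimeCount) (N : ℕ) (z : ℂ) : ℂ :=
  ∏ q ∈ Nat.primesBelow N, eulerFactor ν z q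

/-- The partial products of an infinite product with factors `1 + O(1 / q ^ 2)` are bounded and
converge at a rate `O(1 / N)`. -/
theorem norm_prod_range_bounds {u : ℕ → ℂ} {C : ℝ} (hC : 0 ≤ C)
    (hu : ∀ q, ‖u q‖ ≤ C * (1 / (q : ℝ) ^ 2)) (N : ℕ) :
    ‖∏ q ∈ Finset.range (N + 1), (1 + u q)‖ ≤ Real.exp (2 * C) ∧
    ‖∏ q ∈ Finset.range (N + 1), (1 + u q) - ∏' q, (1 + u q)‖ ≤
      Real.exp (2 * C) * (2 * C * Real.exp (2 * C)) / (N + 1) := by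
  have htail : ∀ n m : ℕ, ∑ q ∈ Finset.Ico (n + 1) m, ‖u q‖ ≤ 2 * C / (n + 1) := by
    intro n m
    have h1 := sum_Ioo_inv_sq_le (α := ℝ) n m
    have h3 : Finset.Ico (n + 1) m = Finset.Ioo n m := by ext; simp
    calc ∑ q ∈ Finset.Ico (n + 1) m, ‖u q‖
        ≤ ∑ q ∈ Finset.Ioo n m, C * ((q : ℝ) ^ 2)⁻¹ := by
          rw [h3]
          exact Finset.sum_le_sum fun q _ => by simpa [one_div] using hu q
      _ ≤ C * (2 / (n + 1)) := by
          rw [← Finset.mul_sum]; exact mul_le_mul_of_nonneg_left h1 hC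
      _ = 2 * C / (n + 1) := by ring
  have hu0 : u 0 = 0 := by
    have := hu 0
    simpa using this
  have hprod : ∀ n m : ℕ, ‖∏ q ∈ Finset.Ico (n + 1) m, (1 + u q) - 1‖ ≤
      2 * C * Real.exp (2 * C) / (n + 1) := by
    intro n m
    refine (Finset.norm_prod_one_add_sub_one_le _ _).trans ?_
    set x := ∑ q ∈ Finset.Ico (n + 1) m, ‖u q‖ with hx
    have hx0 : 0 ≤ x := Finset.sum_nonneg fun _ _ => norm_nonneg _
    have hx1 : x ≤ 2 * C / (n + 1) := htail n m
    have hx2 : x ≤ 2 * C := hx1.trans (div_le_self (by positivity) (by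
      have : (0 : ℝ) ≤ n := by positivity
      linarith))
    have h1 : Real.exp x - 1 ≤ x * Real.exp x := by
      have h3 := Real.add_one_le_exp (-x)
      have h4 : Real.exp (-x) * Real.exp x = 1 := by rw [← Real.exp_add]; simp
      nlinarith [Real.exp_pos x]
    calc Real.exp x - 1 ≤ x * Real.exp x := h1
      _ ≤ (2 * C / (n + 1)) * Real.exp (2 * C) := by gcongr
      _ = 2 * C * Real.exp (2 * C) / (n + 1) := by ring
  have hbound : ‖∏ q ∈ Finset.range (N + 1), (1 + u q)‖ ≤ Real.exp (2 * C) := by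
    have h1 : ∏ q ∈ Finset.range (N + 1), (1 + u q) = ∏ q ∈ Finset.Ico (0 + 1) (N + 1), (1 + u q) := by
      rw [Finset.range_eq_Ico, Finset.prod_eq_prod_Ico_succ_bot (Nat.succ_pos N), hu0]
      simp
    rw [h1]
    have h3 := Finset.norm_prod_one_add_sub_one_le (Finset.Ico (0 + 1) (N + 1)) u
    have h4 := htail 0 (N + 1)
    have h5 := norm_sub_norm_le (∏ q ∈ Finset.Ico (0 + 1) (N + 1), (1 + u q)) 1
    rw [norm_one] at h5
    have h6 : Real.exp (∑ q ∈ Finset.Ico (0 + 1) (N + 1), ‖u q‖) ≤ Real.exp (2 * C) := by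
      refine Real.exp_le_exp.2 (h4.trans (le_of_eq ?_))
      simp
    linarith
  refine ⟨hbound, ?_⟩
  have hs : Summable fun q => ‖u q‖ :=
    Summable.of_nonneg_of_le (fun _ => norm_nonneg _) hu
      ((Real.summable_one_div_nat_pow.2 (by norm_num)).mul_left C)
  have hlim := (multipliable_one_add_of_summable hs).hasProd.tendsto_prod_nat
  have hlim2 : Tendsto (fun m => ‖∏ q ∈ Finset.range (N + 1), (1 + u q) -
      ∏ q ∈ Finset.range m, (1 + u q)‖) atTop
      (𝓝 ‖∏ q ∈ Finset.range (N + 1), (1 + u q) - ∏' q, (1 + u q)‖) := (hlim.const_sub _).norm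
  refine le_of_tendsto hlim2 (eventually_atTop.2 ⟨N + 1, fun m hm => ?_⟩)
  -- The difference of two partial products is the shorter one times (1 - tail product).
  rw [← Finset.prod_range_mul_prod_Ico _ hm, ← mul_one_sub, norm_mul, norm_sub_rev 1, mul_div_assoc]
  exact mul_le_mul hbound (hprod N m) (norm_nonneg _) (Real.exp_pos _).le

/-- Giving composite integers the factor 1 makes both products run over ℕ, where
`norm_prod_range_bounds` applies with a constant uniform in |z| ≤ R. The uniform rate also yields
the analyticity of the limit. -/
theorem exists_norm_partialEulerH_le (ν : PrimeCount) {R : ℝ} (hR : 0 ≤ R)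
    (hRν : (R : EReal) < radius ν) :
    ∃ K : ℝ, 0 ≤ K ∧ ∀ z : ℂ, ‖z‖ ≤ R → ∀ N : ℕ, 1 ≤ N →
      ‖partialEulerH ν N z‖ ≤ K ∧ ‖partialEulerH ν N z - eulerH ν z‖ ≤ K / N := by
  obtain ⟨C, hC0, hC⟩ := exists_norm_eulerFactor_sub_one_le ν hR hRν
  refine ⟨max (Real.exp (2 * C)) (Real.exp (2 * C) * (2 * C * Real.exp (2 * C))),
    le_max_of_le_left (Real.exp_pos _).le, fun z hz N hN => ?_⟩
  obtain ⟨n, rfl⟩ : ∃ n, N = n + 1 := ⟨N - 1, by omega⟩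
  set u : ℕ → ℂ := fun q => if q.Prime then eulerFactor ν z q - 1 else 0 with hu
  have hub : ∀ q, ‖u q‖ ≤ C * (1 / (q : ℝ) ^ 2) := by
    intro q
    simp only [hu]
    split_ifs with h
    · exact hC z hz q h.two_le
    · rw [norm_zero]; positivity
  have h1 : partialEulerH ν (n + 1) z = ∏ q ∈ Finset.range (n + 1), (1 + u q) := by
    rw [partialEulerH, Nat.primesBelow_eq_filter_range, Finset.prod_filter]
    refine Finset.prod_congr rfl fun q _ => ?_
    simp only [hu]
    split_ifs <;> ring
  have h2 : eulerH ν z = ∏' q, (1 + u q) := by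
    refine Eq.trans (tprod_subtype {q : ℕ | q.Prime} (fun q : ℕ => eulerFactor ν z q))
      (tprod_congr fun q => ?_)
    simp only [hu, Set.mulIndicator, Set.mem_ofPred_eq]
    split_ifs <;> ring
  obtain ⟨a1, a2⟩ := norm_prod_range_bounds hC0 hub n
  rw [h1, h2]
  refine ⟨a1.trans (le_max_left _ _), a2.trans ?_⟩
  push_cast
  gcongr
  exact le_max_right _ _

theorem differentiableOn_localFactor (ν : PrimeCount) {R : ℝ} (hRν : (R : EReal) < radius ν)
    {q : ℕ} (hq : 2 ≤ q) :
    DifferentiableOn ℂ (fun z => localFactor ν z q) (Metric.ball 0 R) := by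
  cases ν with
  | om => simp only [localFactor]; fun_prop
  | Om =>
    have hR2 := lt_two_of_lt_radius hRν
    simp only [localFactor]
    refine DifferentiableOn.inv (by fun_prop) fun z hz h0 => ?_
    have h2 : (2 : ℝ) ≤ q := by exact_mod_cast hq
    rw [mem_ball_zero_iff] at hz
    have h3 : ‖z / (q : ℂ)‖ = 1 := by rw [← sub_eq_zero.1 h0, norm_one]
    rw [norm_div, Complex.norm_natCast, div_eq_one_iff_eq (by linarith)] at h3
    linarith

theorem differentiableOn_partialEulerH (ν : PrimeCount) {R : ℝ} (hRν : (R : EReal) < radius ν)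
    (N : ℕ) : DifferentiableOn ℂ (partialEulerH ν N) (Metric.ball 0 R) := by
  unfold partialEulerH
  refine DifferentiableOn.fun_finsetProd fun q hq => ?_
  have h2 := (Nat.prime_of_mem_primesBelow hq).two_le
  simp only [eulerFactor_eq ν _ h2]
  exact DifferentiableOn.mul (by fun_prop) (differentiableOn_localFactor ν hRν h2)

theorem differentiableOn_eulerF (ν : PrimeCount) {R : ℝ} (hR : 0 ≤ R)
    (hRν : (R : EReal) < radius ν) : DifferentiableOn ℂ (eulerF ν) (Metric.ball 0 R) := by
  obtain ⟨K, hK0, hK⟩ := exists_norm_partialEulerH_le ν hR hRν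
  have h1 : TendstoLocallyUniformlyOn (fun N => partialEulerH ν N) (eulerH ν) atTop
      (Metric.ball 0 R) := by
    refine TendstoUniformlyOn.tendstoLocallyUniformlyOn ?_
    rw [Metric.tendstoUniformlyOn_iff]
    intro ε hε
    have h2 : Tendsto (fun N : ℕ => K / (N : ℝ)) atTop (𝓝 0) :=
      tendsto_const_div_atTop_nhds_zero_nat K
    filter_upwards [h2.eventually_lt_const hε, eventually_ge_atTop 1] with N hN hN1 z hz
    rw [dist_comm, dist_eq_norm]
    exact ((hK z (mem_ball_zero_iff.1 hz).le N hN1).2).trans_lt hN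
  have h3 : DifferentiableOn ℂ (eulerH ν) (Metric.ball 0 R) :=
    h1.differentiableOn (Eventually.of_forall fun N => differentiableOn_partialEulerH ν hRν N)
      Metric.isOpen_ball
  unfold eulerF
  exact DifferentiableOn.mul (by fun_prop) h3

/-- The generating function of `λ_ν(p, ·)`, divided by `exp (z log log p)`. -/
noncomputable def partialF (ν : PrimeCount) (p : ℕ) (z : ℂ) : ℂ :=
  Complex.exp (((∑ q ∈ Nat.primesBelow p, primeWeight q - loglog p : ℝ) : ℂ) * z) *
    partialEulerH ν p z

theorem exp_loglog_mul_partialF (ν : PrimeCount) (p : ℕ) (z : ℂ) :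
    Complex.exp (loglog p * z) * partialF ν p z =
      ∏ q ∈ Nat.primesBelow p, localFactor ν z q := by
  have h1 : partialEulerH ν p z =
      (∏ q ∈ Nat.primesBelow p, Complex.exp (-((primeWeight q : ℝ) : ℂ) * z)) *
        ∏ q ∈ Nat.primesBelow p, localFactor ν z q := by
    rw [partialEulerH, ← Finset.prod_mul_distrib]
    exact Finset.prod_congr rfl fun q hq =>
      eulerFactor_eq ν z (Nat.prime_of_mem_primesBelow hq).two_le
  rw [partialF, h1, ← Complex.exp_sum, ← mul_assoc, ← mul_assoc, ← Complex.exp_add,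
    ← Complex.exp_add]
  convert one_mul _
  rw [Complex.exp_eq_one_iff]
  refine ⟨0, ?_⟩
  rw [← Finset.sum_mul, Finset.sum_neg_distrib]
  push_cast
  ring

theorem differentiableOn_partialF (ν : PrimeCount) {R : ℝ} (hRν : (R : EReal) < radius ν)
    (p : ℕ) : DifferentiableOn ℂ (partialF ν p) (Metric.ball 0 R) := by
  unfold partialF
  exact DifferentiableOn.mul (by fun_prop) (differentiableOn_partialEulerH ν hRν p)

theorem log_pos_of_three_le {p : ℕ} (hp : 3 ≤ p) : 1 < Real.log p := by
  have h3 : (3 : ℝ) ≤ p := by exact_mod_cast hp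
  rw [Real.lt_log_iff_exp_lt (by linarith)]
  linarith [Real.exp_one_lt_d9]

/-- Mertens' theorem over q < p instead of q ≤ p: the omitted weight is at most 1/(p-1) ≤ 2/log p.
-/
theorem exists_abs_sum_primesBelow_primeWeight_le :
    ∃ K : ℝ, 0 ≤ K ∧ ∀ p : ℕ, p.Prime → 3 ≤ p →
      |∑ q ∈ Nat.primesBelow p, primeWeight q - loglog p - Real.eulerMascheroniConstant| ≤
        K / Real.log p := by
  obtain ⟨K, hK⟩ := exists_abs_sum_primeWeight_sub_loglog_sub_eulerMascheroni_le
  have hK0 : 0 ≤ K := by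
    have h1 := (abs_nonneg _).trans (hK 3 (by norm_num))
    by_contra h
    have h2 : K / Real.log (3 : ℕ) < 0 :=
      div_neg_of_neg_of_pos (by linarith) (by linarith [log_pos_of_three_le (le_refl 3)])
    linarith
  refine ⟨K + 2, by linarith, fun p hp h3 => ?_⟩
  have h3' : (3 : ℝ) ≤ p := by exact_mod_cast h3
  have hl := log_pos_of_three_le h3
  have h1 := hK p (by omega)
  have h2 : ∑ q ∈ Nat.primesLE p, primeWeight q =
      ∑ q ∈ Nat.primesBelow p, primeWeight q + primeWeight p := by
    rw [Nat.primesLE_eq_filter_range, Nat.primesBelow_eq_filter_range, Finset.sum_filter,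
      Finset.sum_filter, Finset.sum_range_succ, if_pos hp]
  have h4 : primeWeight p ≤ 2 / Real.log p := by
    refine (primeWeight_le hp.two_le).trans ?_
    rw [div_le_div_iff₀ (by linarith) (by linarith)]
    have := Real.log_le_sub_one_of_pos (show (0 : ℝ) < p by linarith)
    linarith
  have h5 := primeWeight_nonneg hp.two_le
  rw [h2] at h1
  rw [add_div]
  rw [abs_le] at h1 ⊢
  constructor <;> linarith

/-- Two replacements are made: the exponent ∑ w_q - log log p becomes γ, at the cost O(1/log p) by
Mertens, and the partial product becomes the full one, at the cost O(1/p). -/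
theorem exists_norm_partialF_sub_eulerF_le (ν : PrimeCount) {R : ℝ} (hR : 0 ≤ R)
    (hRν : (R : EReal) < radius ν) :
    ∃ K : ℝ, 0 ≤ K ∧ ∀ p : ℕ, p.Prime → 3 ≤ p → ∀ z : ℂ, ‖z‖ ≤ R →
      ‖partialF ν p z - eulerF ν z‖ ≤ K / Real.log p := by
  obtain ⟨K, hK0, hK⟩ := exists_norm_partialEulerH_le ν hR hRν
  obtain ⟨M, hM0, hM⟩ := exists_abs_sum_primesBelow_primeWeight_le
  set γ := Real.eulerMascheroniConstant with hγ
  have hγ0 : 0 ≤ γ := by linarith [Real.one_half_lt_eulerMascheroniConstant]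
  set G := Real.exp (γ * R) with hG
  refine ⟨G * (M * R * Real.exp (M * R)) * K + G * K, by positivity, fun p hp h3 z hz => ?_⟩
  have h3' : (3 : ℝ) ≤ p := by exact_mod_cast h3
  have hl := log_pos_of_three_le h3
  set δ := ∑ q ∈ Nat.primesBelow p, primeWeight q - loglog p - γ with hδ
  have hδb : |δ| ≤ M / Real.log p := hM p hp h3
  have e1 : partialF ν p z = Complex.exp (γ * z) * Complex.exp (δ * z) * partialEulerH ν p z := by
    rw [partialF, ← Complex.exp_add]
    congr 2
    rw [hδ]
    push_cast
    ring
  have e2 : partialF ν p z - eulerF ν z =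
      Complex.exp (γ * z) * (Complex.exp (δ * z) - 1) * partialEulerH ν p z +
        Complex.exp (γ * z) * (partialEulerH ν p z - eulerH ν z) := by
    rw [e1, eulerF]
    ring
  have hg : ‖Complex.exp (γ * z)‖ ≤ G := by
    refine (Complex.norm_exp_le_exp_norm _).trans (Real.exp_le_exp.2 ?_)
    rw [norm_mul, Complex.norm_real, Real.norm_of_nonneg hγ0]
    exact mul_le_mul_of_nonneg_left hz hγ0
  have hδz : ‖(δ : ℂ) * z‖ ≤ M / Real.log p * R := by
    rw [norm_mul, Complex.norm_real, Real.norm_eq_abs]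
    exact mul_le_mul hδb hz (norm_nonneg _) (by positivity)
  have hδz' : ‖(δ : ℂ) * z‖ ≤ M * R := hδz.trans
    (mul_le_mul_of_nonneg_right (div_le_self hM0 hl.le) hR)
  have hexp : ‖Complex.exp (δ * z) - 1‖ ≤ (M * R * Real.exp (M * R)) / Real.log p := by
    have h1 := Complex.norm_exp_sub_sum_le_norm_mul_exp ((δ : ℂ) * z) 1
    simp only [Finset.sum_range_one, pow_zero, Nat.factorial_zero, Nat.cast_one, div_one,
      pow_one] at h1
    calc _ ≤ ‖(δ : ℂ) * z‖ * Real.exp ‖(δ : ℂ) * z‖ := h1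
      _ ≤ (M / Real.log p * R) * Real.exp (M * R) := by gcongr
      _ = _ := by ring
  obtain ⟨k1, k2⟩ := hK z hz p (by omega)
  have k3 : K / p ≤ K / Real.log p := by
    refine div_le_div_of_nonneg_left hK0 (by linarith) ?_
    have := Real.log_le_sub_one_of_pos (show (0 : ℝ) < p by linarith)
    linarith
  rw [e2]
  calc _ ≤ G * ((M * R * Real.exp (M * R)) / Real.log p) * K + G * (K / Real.log p) := by
        refine (norm_add_le _ _).trans (add_le_add ?_ ?_)
        · rw [norm_mul, norm_mul]; gcongr
        · rw [norm_mul]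
          exact mul_le_mul hg (k2.trans k3) (norm_nonneg _) (Real.exp_pos _).le
    _ = _ := by ring

/-! ### Taylor coefficients at the origin -/

/-- The `n`-th Taylor coefficient of `f` at `0`. -/
noncomputable def taylorCoeff (f : ℂ → ℂ) (n : ℕ) : ℂ := iteratedDeriv n f 0 / (Nat.factorial n : ℂ)

theorem taylorCoeff_congr {f g : ℂ → ℂ} (h : f =ᶠ[𝓝 0] g) (n : ℕ) :
    taylorCoeff f n = taylorCoeff g n := by
  rw [taylorCoeff, taylorCoeff, h.iteratedDeriv_eq]

theorem eventually_hasSum_taylorCoeff {f : ℂ → ℂ} (hf : AnalyticAt ℂ f 0) :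
    ∀ᶠ z in 𝓝 (0 : ℂ), HasSum (fun n => taylorCoeff f n * z ^ n) (f z) := by
  have h := hasFPowerSeriesAt_iff.1 hf.hasFPowerSeriesAt
  simpa [FormalMultilinearSeries.coeff_ofScalars, taylorCoeff, mul_comm] using h

theorem taylorCoeff_eq_of_hasSum {f : ℂ → ℂ} {c : ℕ → ℂ}
    (h : ∀ᶠ z in 𝓝 (0 : ℂ), HasSum (fun n => c n * z ^ n) (f z)) (n : ℕ) :
    taylorCoeff f n = c n := by
  have h1 : HasFPowerSeriesAt f (FormalMultilinearSeries.ofScalars ℂ c) 0 := by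
    rw [hasFPowerSeriesAt_iff]
    simpa [FormalMultilinearSeries.coeff_ofScalars, mul_comm] using h
  have h2 := h1.analyticAt.hasFPowerSeriesAt.eq_formalMultilinearSeries h1
  have h3 := congrArg (fun P => FormalMultilinearSeries.coeff P n) h2
  simpa [FormalMultilinearSeries.coeff_ofScalars, taylorCoeff] using h3

theorem hasSum_taylorCoeff_of_differentiableOn {f : ℂ → ℂ} {R : ℝ}
    (hf : DifferentiableOn ℂ f (Metric.ball 0 R)) {z : ℂ} (hz : ‖z‖ < R) :
    HasSum (fun n => taylorCoeff f n * z ^ n) (f z) := by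
  have h := Complex.hasSum_taylorSeries_on_ball hf (mem_ball_zero_iff.2 hz)
  refine h.congr_fun ?_
  intro n
  simp only [taylorCoeff, sub_zero, smul_eq_mul]
  ring

theorem taylorCoeff_mul {f g : ℂ → ℂ} (hf : AnalyticAt ℂ f 0) (hg : AnalyticAt ℂ g 0) (n : ℕ) :
    taylorCoeff (fun z => f z * g z) n =
      ∑ i ∈ Finset.range (n + 1), taylorCoeff f i * taylorCoeff g (n - i) := by
  rw [taylorCoeff, iteratedDeriv_fun_mul hf.contDiffAt hg.contDiffAt, Finset.sum_div]
  refine Finset.sum_congr rfl fun i hi => ?_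
  have hi' : i ≤ n := Nat.lt_succ_iff.1 (Finset.mem_range.1 hi)
  have h1 : ((n.choose i : ℕ) : ℂ) * (Nat.factorial i : ℂ) * (Nat.factorial (n - i) : ℂ) =
      (Nat.factorial n : ℂ) := by
    exact_mod_cast congrArg (Nat.cast (R := ℂ)) (Nat.choose_mul_factorial_mul_factorial hi')
  have h2 : (Nat.factorial n : ℂ) ≠ 0 := by exact_mod_cast Nat.factorial_ne_zero n
  have h3 : (Nat.factorial i : ℂ) ≠ 0 := by exact_mod_cast Nat.factorial_ne_zero i
  have h4 : (Nat.factorial (n - i) : ℂ) ≠ 0 := by exact_mod_cast Nat.factorial_ne_zero (n - i)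
  simp only [taylorCoeff]
  rw [div_mul_div_comm, div_eq_div_iff h2 (mul_ne_zero h3 h4), ← h1]
  ring

theorem taylorCoeff_sub {f g : ℂ → ℂ} (hf : AnalyticAt ℂ f 0) (hg : AnalyticAt ℂ g 0) (n : ℕ) :
    taylorCoeff (fun z => f z - g z) n = taylorCoeff f n - taylorCoeff g n := by
  simp only [taylorCoeff]
  rw [iteratedDeriv_fun_sub hf.contDiffAt hg.contDiffAt, sub_div]

theorem taylorCoeff_const_mul (c : ℂ) (f : ℂ → ℂ) (n : ℕ) :
    taylorCoeff (fun z => c * f z) n = c * taylorCoeff f n := by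
  simp only [taylorCoeff]
  rw [iteratedDeriv_const_mul_field, mul_div_assoc]

theorem taylorCoeff_cexp_mul (c : ℂ) (n : ℕ) :
    taylorCoeff (fun z => Complex.exp (c * z)) n = c ^ n / (Nat.factorial n : ℂ) := by
  simp [taylorCoeff, iteratedDeriv_cexp_const_mul]

theorem norm_taylorCoeff_le {f : ℂ → ℂ} {r R C : ℝ} (hr : 0 < r) (hrR : r < R)
    (hf : DifferentiableOn ℂ f (Metric.ball 0 R)) (hC : ∀ z : ℂ, ‖z‖ ≤ r → ‖f z‖ ≤ C) (n : ℕ) :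
    ‖taylorCoeff f n‖ ≤ C / r ^ n := by
  have h1 : DiffContOnCl ℂ f (Metric.ball 0 r) :=
    (hf.mono (by
      rw [closure_ball _ hr.ne']
      exact Metric.closedBall_subset_ball hrR)).diffContOnCl
  have h2 := Complex.norm_iteratedDeriv_le_of_forall_mem_sphere_norm_le n hr h1
    (fun z hz => hC z (mem_sphere_zero_iff_norm.1 hz).le)
  have h3 : (0 : ℝ) < Nat.factorial n := by exact_mod_cast Nat.factorial_pos n
  rw [taylorCoeff, norm_div, Complex.norm_natCast, div_le_iff₀ h3]
  refine h2.trans (le_of_eq ?_)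
  ring

theorem analyticAt_zero_of_differentiableOn {f : ℂ → ℂ} {R : ℝ} (hR : 0 < R)
    (hf : DifferentiableOn ℂ f (Metric.ball 0 R)) : AnalyticAt ℂ f 0 :=
  hf.analyticAt (Metric.ball_mem_nhds 0 hR)

/-! ### The generating function of `λ_ν(p, ·)` -/

theorem nu_one (ν : PrimeCount) : nu ν 1 = 0 := by cases ν <;> simp [nu]

theorem nu_mul (ν : PrimeCount) {m n : ℕ} (hm : m ≠ 0) (hn : n ≠ 0) (h : m.Coprime n) :
    nu ν (m * n) = nu ν m + nu ν n := by
  cases ν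
  · exact ArithmeticFunction.cardDistinctFactors_mul h
  · exact ArithmeticFunction.cardFactors_mul hm hn

theorem tsum_prime_pow (ν : PrimeCount) {z : ℂ} (hz : ‖z‖ < 1) {q : ℕ} (hq : q.Prime) :
    ∑' e : ℕ, z ^ nu ν (q ^ e) / ((q ^ e : ℕ) : ℂ) = localFactor ν z q := by
  have h2 : (2 : ℝ) ≤ q := by exact_mod_cast hq.two_le
  have hq0 : (q : ℂ) ≠ 0 := by exact_mod_cast hq.ne_zero
  cases ν with
  | om =>
    have hlt : ‖(q : ℂ)⁻¹‖ < 1 := by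
      rw [norm_inv, Complex.norm_natCast]; exact inv_lt_one_of_one_lt₀ (by linarith)
    have h1 := (hasSum_geometric_of_norm_lt_one hlt).mul_left (z * (q : ℂ)⁻¹)
    have h3 : HasSum (fun e : ℕ => z ^ nu .om (q ^ (e + 1)) / ((q ^ (e + 1) : ℕ) : ℂ))
        (z * (q : ℂ)⁻¹ * (1 - (q : ℂ)⁻¹)⁻¹) := by
      refine h1.congr_fun (fun e => ?_)
      simp only [nu]
      rw [ArithmeticFunction.cardDistinctFactors_apply_prime_pow hq (Nat.succ_ne_zero e)]
      push_cast
      rw [pow_one, inv_pow, pow_succ]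
      field_simp
    have h4 : HasSum (fun e : ℕ => z ^ nu .om (q ^ e) / ((q ^ e : ℕ) : ℂ))
        (1 + z * (q : ℂ)⁻¹ * (1 - (q : ℂ)⁻¹)⁻¹) :=
      (hasSum_nat_add_iff' 1).1 (by simpa [nu] using h3)
    rw [h4.tsum_eq, localFactor]
    have h5 : (q : ℂ) - 1 ≠ 0 := by
      rw [sub_ne_zero]; exact_mod_cast hq.ne_one
    have h6 : 1 - (q : ℂ)⁻¹ ≠ 0 := by
      rw [show 1 - (q : ℂ)⁻¹ = (q - 1) / q by field_simp]
      exact div_ne_zero h5 hq0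
    field_simp
  | Om =>
    have hlt : ‖z / (q : ℂ)‖ < 1 := by
      rw [norm_div, Complex.norm_natCast, div_lt_one (by linarith)]; linarith
    rw [localFactor, ← tsum_geometric_of_norm_lt_one hlt]
    refine tsum_congr fun e => ?_
    simp only [nu]
    rw [ArithmeticFunction.cardFactors_apply_prime_pow hq, div_pow]
    push_cast
    rfl

/-- The Euler product of the multiplicative function a ↦ z^{ν(a)}/a over p-smooth integers,
regrouped by the value of ν. For |z| < 1 the terms are at most 1/a in modulus, and the germ at 0 is
all that extracting coefficients requires. -/
theorem hasSum_lambda_mul_pow (ν : PrimeCount) (p : ℕ) {z : ℂ} (hz : ‖z‖ < 1) :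
    HasSum (fun k : ℕ => (lambda ν p k : ℂ) * z ^ k)
      (∏ q ∈ Nat.primesBelow p, localFactor ν z q) := by
  set f : ℕ → ℂ := fun a => z ^ nu ν a / (a : ℂ) with hf
  have h1 : f 1 = 1 := by simp [hf, nu_one]
  have hmul : ∀ {m n : ℕ}, m.Coprime n → f (m * n) = f m * f n := by
    intro m n h
    by_cases hm : m = 0
    · simp [hf, hm]
    by_cases hn : n = 0
    · simp [hf, hn]
    simp only [hf]
    rw [nu_mul ν hm hn h, pow_add, Nat.cast_mul, div_mul_div_comm]
  have hsum : ∀ {q : ℕ}, q.Prime → Summable fun e : ℕ => ‖f (q ^ e)‖ := by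
    intro q hq
    have h2 : (2 : ℝ) ≤ q := by exact_mod_cast hq.two_le
    refine Summable.of_nonneg_of_le (fun _ => norm_nonneg _) (fun e => ?_)
      (summable_geometric_of_lt_one (r := (q : ℝ)⁻¹) (by positivity)
        (inv_lt_one_of_one_lt₀ (by linarith)))
    simp only [hf]
    rw [norm_div, norm_pow, Complex.norm_natCast, inv_pow, Nat.cast_pow, div_eq_mul_inv]
    exact mul_le_of_le_one_left (by positivity) (pow_le_one₀ (norm_nonneg _) hz.le)
  have h2 := (EulerProduct.summable_and_hasSum_smoothNumbers_prod_primesBelow_tsum h1 hmul hsum p).2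
  have h3 := h2.tsum_fiberwise (fun a : Nat.smoothNumbers p => nu ν (a : ℕ))
  have h4 : ∏ q ∈ Nat.primesBelow p, ∑' e : ℕ, f (q ^ e) =
      ∏ q ∈ Nat.primesBelow p, localFactor ν z q :=
    Finset.prod_congr rfl fun q hq => tsum_prime_pow ν hz (Nat.prime_of_mem_primesBelow hq)
  rw [h4] at h3
  refine h3.congr_fun (fun k => ?_)
  let e : ((fun a : Nat.smoothNumbers p => nu ν (a : ℕ)) ⁻¹' {k}) ≃ lambdaSet ν p k :=
    { toFun := fun b => ⟨b.1.1, b.1.2, b.2⟩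
      invFun := fun a => ⟨⟨a.1, a.2.1⟩, a.2.2⟩
      left_inv := fun _ => rfl
      right_inv := fun _ => rfl }
  rw [lambda, Complex.ofReal_tsum, ← tsum_mul_right, ← e.tsum_eq]
  refine tsum_congr fun b => ?_
  have hb : nu ν (b.1 : ℕ) = k := b.2
  simp only [hf, e, Equiv.coe_fn_mk, hb]
  push_cast
  ring

theorem exists_radius_between (ν : PrimeCount) {b : ℝ} (hb : (b : EReal) < radius ν) :
    ∃ R : ℝ, b < R ∧ (R : EReal) < radius ν := by
  obtain ⟨R, h1, h2⟩ := EReal.lt_iff_exists_real_btwn.1 hb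
  exact ⟨R, by exact_mod_cast h1, h2⟩

theorem zero_lt_radius (ν : PrimeCount) : ((0 : ℝ) : EReal) < radius ν := by
  cases ν <;> simp [radius]

theorem lambda_eq_sum (ν : PrimeCount) (p k : ℕ) :
    (lambda ν p k : ℂ) = ∑ j ∈ Finset.range (k + 1),
      taylorCoeff (partialF ν p) j * ((loglog p : ℂ) ^ (k - j) / (Nat.factorial (k - j) : ℂ)) := by
  obtain ⟨R, hR0, hR⟩ := exists_radius_between ν (zero_lt_radius ν)
  have hF := analyticAt_zero_of_differentiableOn hR0 (differentiableOn_partialF ν hR p)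
  have h1 : ∀ᶠ z in 𝓝 (0 : ℂ), HasSum (fun k : ℕ => (lambda ν p k : ℂ) * z ^ k)
      (partialF ν p z * Complex.exp (loglog p * z)) := by
    filter_upwards [Metric.ball_mem_nhds (0 : ℂ) one_pos] with z hz
    rw [mul_comm (partialF ν p z), exp_loglog_mul_partialF]
    exact hasSum_lambda_mul_pow ν p (mem_ball_zero_iff.1 hz)
  rw [← taylorCoeff_eq_of_hasSum h1 k, taylorCoeff_mul hF (by fun_prop)]
  simp only [taylorCoeff_cexp_mul]

/-! ### Falling factorials -/

/-- The coefficient of `y ^ m` in `∏_{i < j} (1 - i y)`. -/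
noncomputable def fallingCoeff : ℕ → ℕ → ℝ
  | 0, _ => 1
  | _ + 1, 0 => 0
  | m + 1, j + 1 => fallingCoeff (m + 1) j - j * fallingCoeff m j

/-- The induction step in j shared by the two bounds below: j² + j ≤ (j+1)². -/
theorem pow_add_mul_pow_le (j : ℝ) (hj : 0 ≤ j) (m : ℕ) :
    (j ^ 2) ^ (m + 1) + j * (j ^ 2) ^ m ≤ ((j + 1) ^ 2) ^ (m + 1) := by
  have h1 : (j ^ 2) ^ m ≤ ((j + 1) ^ 2) ^ m := by gcongr; linarith
  have h2 : 0 ≤ ((j + 1) ^ 2) ^ m := by positivity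
  calc (j ^ 2) ^ (m + 1) + j * (j ^ 2) ^ m = (j ^ 2 + j) * (j ^ 2) ^ m := by ring
    _ ≤ (j + 1) ^ 2 * ((j + 1) ^ 2) ^ m := by
        refine mul_le_mul (by nlinarith) h1 (by positivity) (by positivity)
    _ = _ := by ring

theorem abs_fallingCoeff_le (m j : ℕ) : |fallingCoeff m j| ≤ ((j : ℝ) ^ 2) ^ m := by
  induction m generalizing j with
  | zero => simp [fallingCoeff]
  | succ m ihm =>
    induction j with
    | zero => simp [fallingCoeff]
    | succ j ihj =>
      rw [fallingCoeff]
      push_cast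
      refine le_trans ?_ (pow_add_mul_pow_le j (by positivity) m)
      refine (abs_sub _ _).trans (add_le_add ihj ?_)
      rw [abs_mul, Nat.abs_cast]
      exact mul_le_mul_of_nonneg_left (ihm j) (by positivity)

theorem descFactorial_div_pow_succ {k : ℕ} (hk : 0 < k) (j : ℕ) :
    (k.descFactorial (j + 1) : ℝ) / (k : ℝ) ^ (j + 1) =
      k.descFactorial j / (k : ℝ) ^ j * (1 - j / k) := by
  have hk0 : (k : ℝ) ≠ 0 := by exact_mod_cast hk.ne'
  rw [Nat.descFactorial_succ]
  rcases le_or_gt j k with h | h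
  · rw [Nat.cast_mul, Nat.cast_sub h]
    field_simp
    ring
  · rw [Nat.descFactorial_eq_zero_iff_lt.2 h]
    simp

/-- Induction on M, then on j. The product P and its truncation S pass from j to j+1 by the same
rule, so the error becomes (P - S) - (j/k)(P - T), where T has one term fewer. For M = 0 the claim
is 0 ≤ P ≤ 1, and j > k is allowed. -/
theorem abs_descFactorial_div_sub_sum_le {k : ℕ} (hk : 0 < k) (M j : ℕ) :
    |(k.descFactorial j : ℝ) / (k : ℝ) ^ j -
      ∑ m ∈ Finset.range M, fallingCoeff m j / (k : ℝ) ^ m| ≤ ((j : ℝ) ^ 2) ^ M / (k : ℝ) ^ M := by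
  have hk0 : (0 : ℝ) < k := by exact_mod_cast hk
  induction M generalizing j with
  | zero =>
    simp only [Finset.range_zero, Finset.sum_empty, sub_zero, pow_zero, div_one]
    rw [abs_of_nonneg (by positivity), div_le_one (by positivity)]
    exact_mod_cast Nat.descFactorial_le_pow k j
  | succ M ihM =>
    induction j with
    | zero =>
      rw [Finset.sum_range_succ']
      simp [fallingCoeff]
    | succ j ihj =>
      have hsum : ∑ m ∈ Finset.range (M + 1), fallingCoeff m (j + 1) / (k : ℝ) ^ m =
          ∑ m ∈ Finset.range (M + 1), fallingCoeff m j / (k : ℝ) ^ m -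
            j / k * ∑ m ∈ Finset.range M, fallingCoeff m j / (k : ℝ) ^ m := by
        rw [Finset.sum_range_succ', Finset.sum_range_succ' (fun m => fallingCoeff m j / (k : ℝ) ^ m),
          Finset.mul_sum]
        simp only [fallingCoeff]
        rw [add_sub_right_comm, ← Finset.sum_sub_distrib]
        congr 1
        refine Finset.sum_congr rfl fun m _ => ?_
        field_simp
        ring
      rw [descFactorial_div_pow_succ hk, hsum]
      set P := (k.descFactorial j : ℝ) / (k : ℝ) ^ j
      set S := ∑ m ∈ Finset.range (M + 1), fallingCoeff m j / (k : ℝ) ^ m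
      set T := ∑ m ∈ Finset.range M, fallingCoeff m j / (k : ℝ) ^ m
      have e : P * (1 - j / k) - (S - j / k * T) = (P - S) - j / k * (P - T) := by ring
      rw [e]
      have h1 : |(j : ℝ) / k * (P - T)| ≤ j / k * (((j : ℝ) ^ 2) ^ M / (k : ℝ) ^ M) := by
        rw [abs_mul, abs_of_nonneg (by positivity)]
        exact mul_le_mul_of_nonneg_left (ihM j) (by positivity)
      refine (abs_sub _ _).trans ((add_le_add ihj h1).trans ?_)
      have h2 := div_le_div_of_nonneg_right (pow_add_mul_pow_le (j : ℝ) (by positivity) M)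
        (show (0 : ℝ) ≤ (k : ℝ) ^ (M + 1) by positivity)
      push_cast
      refine le_trans (le_of_eq ?_) h2
      rw [pow_succ (k : ℝ) M]
      field_simp

theorem factorial_mul_pow_eq_descFactorial {L : ℝ} (hL : 0 < L) {k j : ℕ} (hk : 0 < k) (hj : j ≤ k) :
    L ^ (k - j) / (Nat.factorial (k - j) : ℝ) =
      L ^ k / (Nat.factorial k : ℝ) *
        ((k / L) ^ j * ((k.descFactorial j : ℝ) / (k : ℝ) ^ j)) := by
  have hk0 : (k : ℝ) ≠ 0 := by exact_mod_cast hk.ne'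
  have h1 : ((Nat.factorial (k - j) : ℕ) : ℝ) * (k.descFactorial j : ℝ) = (Nat.factorial k : ℝ) := by
    exact_mod_cast congrArg (Nat.cast (R := ℝ)) (Nat.factorial_mul_descFactorial hj)
  have h2 : ((Nat.factorial (k - j) : ℕ) : ℝ) ≠ 0 := by exact_mod_cast Nat.factorial_ne_zero _
  have h3 : (k.descFactorial j : ℝ) ≠ 0 := by
    have : k.descFactorial j ≠ 0 := by
      rw [Ne, Nat.descFactorial_eq_zero_iff_lt]; omega
    exact_mod_cast this
  have h4 : L ^ k = L ^ (k - j) * L ^ j := by rw [← pow_add]; congr 1; omega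
  rw [← h1, h4, div_pow]
  field_simp

/-- The saddle-point expansion of `[z^k] e^{Lz} F(z)` for a perturbation of a fixed function `F`,
in terms of the Taylor coefficients of `F`. -/
theorem exists_norm_sum_taylorCoeff_sub_le (F : ℂ → ℂ) {b r R : ℝ} (hb : 0 < b) (hbr : b < r)
    (hrR : r < R) (hF : DifferentiableOn ℂ F (Metric.ball 0 R)) (M : ℕ) :
    ∃ K : ℝ, 0 ≤ K ∧ ∀ (G : ℂ → ℂ) (η L : ℝ) (k : ℕ), DifferentiableOn ℂ G (Metric.ball 0 R) →
      (∀ z : ℂ, ‖z‖ ≤ r → ‖G z - F z‖ ≤ η) → 0 < L → 0 < k → k / L ≤ b →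
      ‖∑ j ∈ Finset.range (k + 1),
          taylorCoeff G j * ((L : ℂ) ^ (k - j) / (Nat.factorial (k - j) : ℂ)) -
        ((L ^ k / (Nat.factorial k : ℝ) : ℝ) : ℂ) * ∑ m ∈ Finset.range (M + 1),
          (∑' j : ℕ, taylorCoeff F j * ((k / L : ℝ) : ℂ) ^ j * (fallingCoeff m j : ℂ)) /
            (k : ℂ) ^ m‖ ≤ K * (L ^ k / (Nat.factorial k : ℝ)) * (η + 1 / (k : ℝ) ^ (M + 1)) := by
  have hr0 : 0 < r := hb.trans hbr
  have hR0 : 0 < R := hr0.trans hrR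
  obtain ⟨C, hC⟩ : ∃ C, ∀ z : ℂ, ‖z‖ ≤ r → ‖F z‖ ≤ C := by
    obtain ⟨C, hC⟩ := (isCompact_closedBall (0 : ℂ) r).exists_bound_of_continuousOn
      (hF.continuousOn.mono (Metric.closedBall_subset_ball hrR))
    exact ⟨C, fun z hz => hC z (mem_closedBall_zero_iff.2 hz)⟩
  have hC0 : 0 ≤ C := (norm_nonneg _).trans (hC 0 (by simpa using hr0.le))
  -- Cauchy's estimate on |z| = r gives |f_j| v^j ≤ C x^j, and this geometric decay beats the powers
  -- of j coming from `fallingCoeff`.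
  set x := b / r with hx
  have hx0 : 0 < x := by positivity
  have hx1 : x < 1 := (div_lt_one hr0).2 hbr
  have hsx : ∀ m : ℕ, Summable fun j : ℕ => ((j : ℝ) ^ 2) ^ m * x ^ j := by
    intro m
    have := summable_pow_mul_geometric_of_norm_lt_one (2 * m) (r := x)
      (by rwa [Real.norm_of_nonneg hx0.le])
    simpa [pow_mul] using this
  set S₀ := ∑' j : ℕ, x ^ j with hS₀
  set S₁ := ∑' j : ℕ, ((j : ℝ) ^ 2) ^ (M + 1) * x ^ j with hS₁
  have hs₀ : Summable fun j : ℕ => x ^ j := by simpa using hsx 0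
  have hS₀' : 0 ≤ S₀ := tsum_nonneg fun j => by positivity
  have hS₁' : 0 ≤ S₁ := tsum_nonneg fun j => by positivity
  -- Replacing G by F costs η S₀; truncating the falling factorials costs C S₁/k^{M+1}.
  refine ⟨S₀ + C * S₁, by positivity, fun G η L k hG hη hL hk hkb => ?_⟩
  have hk0 : (0 : ℝ) < k := by exact_mod_cast hk
  have hη0 : 0 ≤ η := (norm_nonneg _).trans (hη 0 (by simpa using hr0.le))
  set v : ℝ := k / L with hv
  have hv0 : 0 < v := by positivity
  set f := taylorCoeff F
  set g := taylorCoeff G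
  set P : ℕ → ℝ := fun j => (k.descFactorial j : ℝ) / (k : ℝ) ^ j with hP
  have hP1 : ∀ j, |P j| ≤ 1 := fun j => by
    simpa using abs_descFactorial_div_sub_sum_le hk 0 j
  have hfa := analyticAt_zero_of_differentiableOn hR0 hF
  have hga := analyticAt_zero_of_differentiableOn hR0 hG
  have hfb : ∀ j, ‖f j * (v : ℂ) ^ j‖ ≤ C * x ^ j := fun j => by
    rw [norm_mul, norm_pow, Complex.norm_real, Real.norm_of_nonneg hv0.le]
    calc ‖f j‖ * v ^ j ≤ (C / r ^ j) * b ^ j := by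
          have := norm_taylorCoeff_le hr0 hrR hF hC j
          gcongr
      _ = C * x ^ j := by rw [hx, div_pow]; ring
  have hgfb : ∀ j, ‖(g j - f j) * (v : ℂ) ^ j‖ ≤ η * x ^ j := fun j => by
    rw [norm_mul, norm_pow, Complex.norm_real, Real.norm_of_nonneg hv0.le]
    calc ‖g j - f j‖ * v ^ j ≤ (η / r ^ j) * b ^ j := by
          have := norm_taylorCoeff_le hr0 hrR (hG.sub hF) (C := η)
            (fun z hz => hη z hz) j
          rw [show (G - F) = fun z => G z - F z from rfl, taylorCoeff_sub hga hfa] at this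
          gcongr
      _ = η * x ^ j := by rw [hx, div_pow]; ring
  have e1 : ∑ j ∈ Finset.range (k + 1), g j * ((L : ℂ) ^ (k - j) / (Nat.factorial (k - j) : ℂ)) =
      ((L ^ k / (Nat.factorial k : ℝ) : ℝ) : ℂ) * ∑' j : ℕ, g j * (v : ℂ) ^ j * (P j : ℂ) := by
    -- The finite sum extends to a full series since the falling factorial vanishes for j > k.
    rw [tsum_eq_sum (s := Finset.range (k + 1)), Finset.mul_sum]
    · refine Finset.sum_congr rfl fun j hj => ?_
      have h1 := factorial_mul_pow_eq_descFactorial hL hk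
        (Nat.lt_succ_iff.1 (Finset.mem_range.1 hj))
      have h2 := congrArg (Complex.ofReal) h1
      simp only [hP, hv]
      push_cast at h2 ⊢
      rw [h2]
      ring
    · intro j hj
      have : k < j := by rw [Finset.mem_range] at hj; omega
      simp [hP, Nat.descFactorial_eq_zero_iff_lt.2 this]
  have hsm : ∀ m : ℕ, Summable fun j : ℕ => f j * (v : ℂ) ^ j * (fallingCoeff m j : ℂ) := by
    intro m
    refine Summable.of_norm_bounded ((hsx m).mul_left C) fun j => ?_
    rw [norm_mul, Complex.norm_real, Real.norm_eq_abs]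
    calc _ ≤ (C * x ^ j) * ((j : ℝ) ^ 2) ^ m :=
          mul_le_mul (hfb j) (abs_fallingCoeff_le m j) (abs_nonneg _) (by positivity)
      _ = _ := by ring
  have e2 : ∑ m ∈ Finset.range (M + 1),
      (∑' j : ℕ, f j * (v : ℂ) ^ j * (fallingCoeff m j : ℂ)) / (k : ℂ) ^ m =
      ∑' j : ℕ, f j * (v : ℂ) ^ j *
        ((∑ m ∈ Finset.range (M + 1), fallingCoeff m j / (k : ℝ) ^ m : ℝ) : ℂ) := by
    simp only [← tsum_div_const]
    rw [← Summable.tsum_finsetSum fun m _ => (hsm m).div_const _]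
    refine tsum_congr fun j => ?_
    push_cast
    rw [Finset.mul_sum]
    refine Finset.sum_congr rfl fun m _ => ?_
    ring
  have hsg : Summable fun j : ℕ => (g j - f j) * (v : ℂ) ^ j * (P j : ℂ) := by
    refine Summable.of_norm_bounded (hs₀.mul_left η) fun j => ?_
    rw [norm_mul, Complex.norm_real, Real.norm_eq_abs]
    exact (mul_le_of_le_one_right (norm_nonneg _) (hP1 j)).trans (hgfb j)
  set Q : ℕ → ℝ := fun j => P j - ∑ m ∈ Finset.range (M + 1), fallingCoeff m j / (k : ℝ) ^ m with hQ
  have hQb : ∀ j, ‖f j * (v : ℂ) ^ j * (Q j : ℂ)‖ ≤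
      C / (k : ℝ) ^ (M + 1) * (((j : ℝ) ^ 2) ^ (M + 1) * x ^ j) := by
    intro j
    rw [norm_mul, Complex.norm_real, Real.norm_eq_abs]
    calc _ ≤ (C * x ^ j) * (((j : ℝ) ^ 2) ^ (M + 1) / (k : ℝ) ^ (M + 1)) :=
          mul_le_mul (hfb j) (abs_descFactorial_div_sub_sum_le hk (M + 1) j) (abs_nonneg _)
            (by positivity)
      _ = _ := by ring
  have hsQ : Summable fun j : ℕ => f j * (v : ℂ) ^ j * (Q j : ℂ) :=
    Summable.of_norm_bounded ((hsx (M + 1)).mul_left _) hQb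
  have hsfs : Summable fun j : ℕ => f j * (v : ℂ) ^ j *
        ((∑ m ∈ Finset.range (M + 1), fallingCoeff m j / (k : ℝ) ^ m : ℝ) : ℂ) := by
    have := summable_sum (s := Finset.range (M + 1))
      (fun m _ => (hsm m).div_const ((k : ℂ) ^ m))
    refine this.congr fun j => ?_
    push_cast
    rw [Finset.mul_sum]
    refine Finset.sum_congr rfl fun m _ => ?_
    ring
  have e3 : ∑' j : ℕ, g j * (v : ℂ) ^ j * (P j : ℂ) =
      ∑' j : ℕ, (g j - f j) * (v : ℂ) ^ j * (P j : ℂ) +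
      (∑' j : ℕ, f j * (v : ℂ) ^ j * (Q j : ℂ) +
      ∑' j : ℕ, f j * (v : ℂ) ^ j *
        ((∑ m ∈ Finset.range (M + 1), fallingCoeff m j / (k : ℝ) ^ m : ℝ) : ℂ)) := by
    rw [← hsQ.tsum_add hsfs, ← hsg.tsum_add (hsQ.add hsfs)]
    refine tsum_congr fun j => ?_
    simp only [hQ]
    push_cast
    ring
  rw [e1, e2, ← mul_sub, e3, ← add_assoc, add_sub_cancel_right, norm_mul, Complex.norm_real,
    Real.norm_of_nonneg (by positivity)]
  have n1 : ‖∑' j : ℕ, (g j - f j) * (v : ℂ) ^ j * (P j : ℂ)‖ ≤ η * S₀ := by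
    rw [hS₀, ← tsum_mul_left]
    refine tsum_of_norm_bounded (hs₀.mul_left η).hasSum fun j => ?_
    rw [norm_mul, Complex.norm_real, Real.norm_eq_abs]
    exact (mul_le_of_le_one_right (norm_nonneg _) (hP1 j)).trans (hgfb j)
  have n2 : ‖∑' j : ℕ, f j * (v : ℂ) ^ j * (Q j : ℂ)‖ ≤ C / (k : ℝ) ^ (M + 1) * S₁ := by
    rw [hS₁, ← tsum_mul_left]
    exact tsum_of_norm_bounded ((hsx (M + 1)).mul_left _).hasSum hQb
  have n3 := (norm_add_le _ _).trans (add_le_add n1 n2)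
  have hLk : 0 ≤ L ^ k / (Nat.factorial k : ℝ) := by positivity
  refine (mul_le_mul_of_nonneg_left n3 hLk).trans ?_
  have h5 : 0 ≤ C * S₁ * η + S₀ * (1 / (k : ℝ) ^ (M + 1)) := by positivity
  have h6 : (S₀ + C * S₁) * (L ^ k / (Nat.factorial k : ℝ)) * (η + 1 / (k : ℝ) ^ (M + 1)) =
      L ^ k / (Nat.factorial k : ℝ) * (η * S₀ + C / (k : ℝ) ^ (M + 1) * S₁) +
      L ^ k / (Nat.factorial k : ℝ) * (C * S₁ * η + S₀ * (1 / (k : ℝ) ^ (M + 1))) := by ring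
  rw [h6]
  exact le_add_of_nonneg_right (mul_nonneg hLk h5)

/-! ### Lagrange inversion -/

theorem taylorCoeff_zero (f : ℂ → ℂ) : taylorCoeff f 0 = f 0 := by simp [taylorCoeff]

theorem taylorCoeff_pow (i n : ℕ) :
    taylorCoeff (fun z => z ^ i) n = if n = i then 1 else 0 := by
  refine taylorCoeff_eq_of_hasSum (c := fun n => if n = i then 1 else 0)
    (Eventually.of_forall fun z => ?_) n
  have := hasSum_ite_eq (L := SummationFilter.unconditional ℕ) i (z ^ i)
  refine this.congr_fun fun j => ?_
  by_cases h : j = i <;> simp [h]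

theorem taylorCoeff_pow_mul {f : ℂ → ℂ} (hf : AnalyticAt ℂ f 0) (i n : ℕ) :
    taylorCoeff (fun z => z ^ i * f z) n = if i ≤ n then taylorCoeff f (n - i) else 0 := by
  rw [taylorCoeff_mul (by fun_prop) hf]
  simp only [taylorCoeff_pow, ite_mul, one_mul, zero_mul]
  rw [Finset.sum_ite_eq']
  simp

theorem taylorCoeff_deriv (f : ℂ → ℂ) (n : ℕ) :
    taylorCoeff (deriv f) n = (n + 1) * taylorCoeff f (n + 1) := by
  have h1 : (n : ℂ) + 1 ≠ 0 := by exact_mod_cast Nat.succ_ne_zero n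
  have h2 : (Nat.factorial n : ℂ) ≠ 0 := by exact_mod_cast Nat.factorial_ne_zero n
  simp only [taylorCoeff]
  rw [iteratedDeriv_succ', Nat.factorial_succ]
  push_cast
  field_simp

theorem taylorCoeff_sum {ι : Type*} (s : Finset ι) {f : ι → ℂ → ℂ}
    (hf : ∀ i ∈ s, AnalyticAt ℂ (f i) 0) (n : ℕ) :
    taylorCoeff (fun z => ∑ i ∈ s, f i z) n = ∑ i ∈ s, taylorCoeff (f i) n := by
  simp only [taylorCoeff]
  rw [iteratedDeriv_fun_sum fun i hi => (hf i hi).contDiffAt, Finset.sum_div]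

theorem taylorCoeff_add {f g : ℂ → ℂ} (hf : AnalyticAt ℂ f 0) (hg : AnalyticAt ℂ g 0) (n : ℕ) :
    taylorCoeff (fun z => f z + g z) n = taylorCoeff f n + taylorCoeff g n := by
  simp only [taylorCoeff]
  rw [iteratedDeriv_fun_add hf.contDiffAt hg.contDiffAt, add_div]

theorem exists_eq_sum_taylorCoeff_add {f : ℂ → ℂ} (hf : AnalyticAt ℂ f 0) (n : ℕ) :
    ∃ E : ℂ → ℂ, AnalyticAt ℂ E 0 ∧
      ∀ z, f z = ∑ i ∈ Finset.range n, taylorCoeff f i * z ^ i + z ^ n * E z := by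
  obtain ⟨E, hE, h⟩ := hf.exists_eq_sum_add_pow_mul n
  refine ⟨E, hE, fun z => (h z).trans ?_⟩
  rw [smul_eq_mul]
  congr 1
  refine Finset.sum_congr rfl fun i _ => ?_
  rw [smul_eq_mul, taylorCoeff]
  ring

/-- This is the residue of ρ'/ρ^{m+1}, an exact derivative unless m = 0. Without poles: for P =
Q^{-m} the function equals P - (1/m) t P', and the coefficient of t^m in tP' is m times that in P.
-/
theorem taylorCoeff_inv_pow_mul_deriv {Q ρ : ℂ → ℂ} (hQ : AnalyticAt ℂ Q 0) (hQ0 : Q 0 ≠ 0)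
    (hρ : ∀ᶠ t in 𝓝 0, ρ t = t * Q t) (m : ℕ) :
    taylorCoeff (fun t => (Q t)⁻¹ ^ (m + 1) * deriv ρ t) m = if m = 0 then 1 else 0 := by
  have hd : ∀ᶠ t in 𝓝 0, deriv ρ t = Q t + t * deriv Q t := by
    filter_upwards [hρ.eventually_nhds, hQ.eventually_analyticAt] with t ht hQt
    rw [EventuallyEq.deriv_eq (ht : ρ =ᶠ[𝓝 t] fun t => t * Q t),
      deriv_fun_mul differentiableAt_fun_id hQt.differentiableAt]
    simp
  have hne : ∀ᶠ t in 𝓝 0, Q t ≠ 0 := hQ.continuousAt.eventually_ne hQ0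
  split_ifs with h0
  · subst h0
    rw [taylorCoeff_zero, hd.self_of_nhds]
    simp [hQ0]
  · set P : ℂ → ℂ := fun t => (Q t)⁻¹ ^ m with hP
    have hPa : AnalyticAt ℂ P 0 := (hQ.fun_inv hQ0).fun_pow m
    have hm : (m : ℂ) ≠ 0 := by exact_mod_cast h0
    obtain ⟨l, rfl⟩ : ∃ l, m = l + 1 := ⟨m - 1, by omega⟩
    have hPd : ∀ᶠ t in 𝓝 0, deriv P t = -((l + 1 : ℕ) : ℂ) * ((Q t)⁻¹ ^ (l + 2) * deriv Q t) := by
      filter_upwards [hne, hQ.eventually_analyticAt] with t ht hQt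
      have h1 := ((hQt.differentiableAt.hasDerivAt.fun_inv ht).fun_pow (l + 1)).deriv
      rw [hP, h1, div_eq_mul_inv, ← inv_pow]
      simp only [Nat.add_sub_cancel]
      ring
    have e : (fun t => (Q t)⁻¹ ^ (l + 1 + 1) * deriv ρ t) =ᶠ[𝓝 0]
        fun t => P t - ((l + 1 : ℕ) : ℂ)⁻¹ * (t ^ 1 * deriv P t) := by
      filter_upwards [hd, hne, hPd] with t h1 h2 h3
      rw [h1, h3, hP]
      have h4 : Q t * (Q t)⁻¹ = 1 := mul_inv_cancel₀ h2
      have h5 : ((l + 1 : ℕ) : ℂ)⁻¹ * ((l + 1 : ℕ) : ℂ) = 1 := inv_mul_cancel₀ hm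
      linear_combination (Q t)⁻¹ ^ (l + 1) * h4 - t * ((Q t)⁻¹ ^ (l + 2) * deriv Q t) * h5
    rw [taylorCoeff_congr e, taylorCoeff_sub hPa (by
      exact analyticAt_const.mul ((analyticAt_id.pow 1).mul hPa.deriv)), taylorCoeff_const_mul,
      taylorCoeff_pow_mul hPa.deriv, if_pos (by omega), Nat.add_sub_cancel, taylorCoeff_deriv]
    push_cast at hm ⊢
    field_simp
    ring

/-- Invariance of residues under a local change of variable `ρ(t) = t Q(t)`. -/
theorem taylorCoeff_eq_taylorCoeff_comp {Q ρ ψ : ℂ → ℂ} (hQ : AnalyticAt ℂ Q 0) (hQ0 : Q 0 ≠ 0)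
    (hρa : AnalyticAt ℂ ρ 0) (hρ : ∀ᶠ t in 𝓝 0, ρ t = t * Q t) (hψ : AnalyticAt ℂ ψ 0) (n : ℕ) :
    taylorCoeff (fun t => ψ (ρ t) * deriv ρ t * (Q t)⁻¹ ^ (n + 1)) n = taylorCoeff ψ n := by
  have hρ0 : ρ 0 = 0 := by rw [hρ.self_of_nhds, zero_mul]
  -- The monomial z^i of ψ contributes the residue of the previous lemma with m = n - i, so only i =
  -- n survives. The remainder carries t^{n+1} and does not reach order n.
  obtain ⟨E, hE, hEq⟩ := exists_eq_sum_taylorCoeff_add hψ (n + 1)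
  have hne : ∀ᶠ t in 𝓝 0, Q t ≠ 0 := hQ.continuousAt.eventually_ne hQ0
  have hEρ : AnalyticAt ℂ (fun t => E (ρ t)) 0 := by
    have : AnalyticAt ℂ E (ρ 0) := by rwa [hρ0]
    exact this.fun_comp hρa
  have hterm : ∀ i, AnalyticAt ℂ (fun t => (Q t)⁻¹ ^ (n - i + 1) * deriv ρ t) 0 := fun i =>
    ((hQ.fun_inv hQ0).fun_pow _).mul hρa.deriv
  have hterm2 : AnalyticAt ℂ (fun t => E (ρ t) * deriv ρ t) 0 := hEρ.mul hρa.deriv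
  have e : (fun t => ψ (ρ t) * deriv ρ t * (Q t)⁻¹ ^ (n + 1)) =ᶠ[𝓝 0] fun t =>
      ∑ i ∈ Finset.range (n + 1),
        taylorCoeff ψ i * (t ^ i * ((Q t)⁻¹ ^ (n - i + 1) * deriv ρ t)) +
      t ^ (n + 1) * (E (ρ t) * deriv ρ t) := by
    filter_upwards [hρ, hne] with t h1 h2
    rw [hEq (ρ t), add_mul, add_mul, Finset.sum_mul, Finset.sum_mul]
    congr 1
    · refine Finset.sum_congr rfl fun i hi => ?_
      have hi' : i ≤ n := Nat.lt_succ_iff.1 (Finset.mem_range.1 hi)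
      have h3 : (Q t)⁻¹ ^ (n + 1) = (Q t)⁻¹ ^ i * (Q t)⁻¹ ^ (n - i + 1) := by
        rw [← pow_add]; congr 1; omega
      have h4 : (Q t) ^ i * (Q t)⁻¹ ^ i = 1 := by rw [← mul_pow, mul_inv_cancel₀ h2, one_pow]
      rw [h3, h1, mul_pow]
      linear_combination (taylorCoeff ψ i * t ^ i * deriv ρ t * (Q t)⁻¹ ^ (n - i + 1)) * h4
    · have h4 : (Q t) ^ (n + 1) * (Q t)⁻¹ ^ (n + 1) = 1 := by
        rw [← mul_pow, mul_inv_cancel₀ h2, one_pow]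
      have h5 : ρ t ^ (n + 1) = t ^ (n + 1) * Q t ^ (n + 1) := by rw [h1, mul_pow]
      rw [h5]
      linear_combination (t ^ (n + 1) * E (ρ t) * deriv ρ t) * h4
  have hA : ∀ i, AnalyticAt ℂ (fun t => taylorCoeff ψ i *
      (t ^ i * ((Q t)⁻¹ ^ (n - i + 1) * deriv ρ t))) 0 := fun i =>
    analyticAt_const.mul ((analyticAt_id.pow i).mul (hterm i))
  rw [taylorCoeff_congr e, taylorCoeff_add (Finset.analyticAt_fun_sum _ fun i _ => hA i)
    (show AnalyticAt ℂ (fun t => t ^ (n + 1) * (E (ρ t) * deriv ρ t)) 0 from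
      (analyticAt_id.pow _).mul hterm2), taylorCoeff_pow_mul hterm2, if_neg (by omega), add_zero,
    taylorCoeff_sum _ fun i _ => hA i]
  rw [Finset.sum_eq_single_of_mem n (by simp)]
  · rw [taylorCoeff_const_mul, taylorCoeff_pow_mul (hterm n), if_pos le_rfl, Nat.sub_self,
      taylorCoeff_inv_pow_mul_deriv hQ hQ0 hρ, if_pos rfl, mul_one]
  · intro i hi hin
    have hi' : i < n := lt_of_le_of_ne (Nat.lt_succ_iff.1 (Finset.mem_range.1 hi)) hin
    rw [taylorCoeff_const_mul, taylorCoeff_pow_mul (hterm i), if_pos hi'.le,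
      taylorCoeff_inv_pow_mul_deriv hQ hQ0 hρ, if_neg (by omega), mul_zero]

/-- Lagrange inversion: the Taylor coefficients of the solution of `ρ(t) = t q(ρ(t))`. -/
theorem taylorCoeff_succ_eq_of_eq_mul_comp {q ρ : ℂ → ℂ} (hq : AnalyticAt ℂ q 0) (hq0 : q 0 ≠ 0)
    (hρa : AnalyticAt ℂ ρ 0) (hρ : ∀ᶠ t in 𝓝 0, ρ t = t * q (ρ t)) (n : ℕ) :
    taylorCoeff ρ (n + 1) =
      iteratedDeriv n (fun z => q z ^ (n + 1)) 0 / (Nat.factorial (n + 1) : ℂ) := by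
  have hρ0 : ρ 0 = 0 := by rw [hρ.self_of_nhds, zero_mul]
  have hQ : AnalyticAt ℂ (fun t => q (ρ t)) 0 := by
    have : AnalyticAt ℂ q (ρ 0) := by rwa [hρ0]
    exact this.fun_comp hρa
  have hQ0 : q (ρ 0) ≠ 0 := by rwa [hρ0]
  -- With ψ = q^{n+1} the factor Q^{-(n+1)} cancels ψ ∘ ρ and leaves ρ' alone.
  have h1 := taylorCoeff_eq_taylorCoeff_comp hQ hQ0 hρa hρ (hq.fun_pow (n + 1)) n
  have h2 : (fun t => q (ρ t) ^ (n + 1) * deriv ρ t * (q (ρ t))⁻¹ ^ (n + 1)) =ᶠ[𝓝 0] deriv ρ := by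
    filter_upwards [hQ.continuousAt.eventually_ne hQ0] with t ht
    have h4 : q (ρ t) ^ (n + 1) * (q (ρ t))⁻¹ ^ (n + 1) = 1 := by
      rw [← mul_pow, mul_inv_cancel₀ ht, one_pow]
    linear_combination deriv ρ t * h4
  rw [taylorCoeff_congr h2, taylorCoeff_deriv, taylorCoeff] at h1
  have h3 : (n : ℂ) + 1 ≠ 0 := by exact_mod_cast Nat.succ_ne_zero n
  have h5 : (Nat.factorial n : ℂ) ≠ 0 := by exact_mod_cast Nat.factorial_ne_zero n
  have h6 : taylorCoeff ρ (n + 1) = ((n : ℂ) + 1)⁻¹ *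
      (iteratedDeriv n (fun z => q z ^ (n + 1)) 0 / (Nat.factorial n : ℂ)) := by
    simp only [taylorCoeff]
    rw [taylorCoeff] at h1
    rw [← h1]
    field_simp
  rw [h6, Nat.factorial_succ]
  push_cast
  field_simp

/-! ### Normal form of a nondegenerate critical point -/

/-- A phase `h(z) = z ^ 2 / 2 + ⋯` is `t ^ 2 / 2` in the coordinate `t = z / q(z)`, whose inverse
is `ρ`. -/
theorem exists_normal_form {h : ℂ → ℂ} (hh : AnalyticAt ℂ h 0) (h0 : h 0 = 0)
    (h1 : deriv h 0 = 0) (h2 : iteratedDeriv 2 h 0 = 1) :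
    ∃ q ρ : ℂ → ℂ, AnalyticAt ℂ q 0 ∧ q 0 = 1 ∧ AnalyticAt ℂ ρ 0 ∧ ρ 0 = 0 ∧
      (∀ᶠ z in 𝓝 0, q z = if z = 0 then 1 else (z ^ 2 / (2 * h z)) ^ (1 / 2 : ℂ)) ∧
      (∀ᶠ t in 𝓝 0, ρ t = t * q (ρ t)) ∧ (∀ᶠ z in 𝓝 0, ρ (z / q z) = z) ∧
      (∀ᶠ z in 𝓝 0, (z / q z) ^ 2 = 2 * h z) := by
  obtain ⟨E, hE, hEq⟩ := hh.exists_eq_sum_add_pow_mul 3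
  -- g is 2h/z² with its singularity removed. As g(0) = 1, the principal root of 1/g is analytic
  -- near 0.
  set g : ℂ → ℂ := fun z => 1 + 2 * z * E z with hg
  have hga : AnalyticAt ℂ g 0 := by fun_prop
  have hg0 : g 0 = 1 := by simp [hg]
  have hhg : ∀ z, 2 * h z = z ^ 2 * g z := by
    intro z
    rw [hEq z]
    simp only [Finset.sum_range_succ, Finset.range_zero, Finset.sum_empty, iteratedDeriv_zero, h0,
      iteratedDeriv_one, h1, h2, hg, smul_eq_mul]
    norm_num
    ring
  set q : ℂ → ℂ := fun z => (1 / g z) ^ (1 / 2 : ℂ) with hq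
  have hqa : AnalyticAt ℂ q 0 := by
    refine AnalyticAt.cpow ?_ analyticAt_const ?_
    · exact analyticAt_const.div hga (by rw [hg0]; exact one_ne_zero)
    · simp [hg0]
  have hq0 : q 0 = 1 := by simp [hq, hg0]
  have hgne : ∀ᶠ z in 𝓝 0, g z ≠ 0 :=
    hga.continuousAt.eventually_ne (by rw [hg0]; exact one_ne_zero)
  have hqne : ∀ᶠ z in 𝓝 0, q z ≠ 0 :=
    hqa.continuousAt.eventually_ne (by rw [hq0]; exact one_ne_zero)
  have hq2 : ∀ z, q z ^ 2 = 1 / g z := fun z => by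
    have := Complex.cpow_nat_inv_pow (1 / g z) two_ne_zero
    rw [Nat.cast_ofNat, ← one_div] at this
    exact this
  -- An analytic branch of √(2h) with derivative 1 at 0. Its local inverse is ρ, and ρ(t) = t
  -- q(ρ(t)) is s(ρ(t)) = t rewritten.
  set s : ℂ → ℂ := fun z => z / q z with hs
  have hsa : AnalyticAt ℂ s 0 := analyticAt_id.div hqa (by rw [hq0]; exact one_ne_zero)
  have hs0 : s 0 = 0 := by simp [hs]
  have hsd : deriv s 0 ≠ 0 := by
    have h3 := ((hasDerivAt_id (0 : ℂ)).fun_div hqa.differentiableAt.hasDerivAt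
      (by rw [hq0]; exact one_ne_zero)).deriv
    have h4 : deriv s 0 = 1 := by
      refine h3.trans ?_
      simp [hq0]
    rw [h4]
    exact one_ne_zero
  have hra := hsa.analyticAt_localInverse hsd
  set ρ := hsa.hasStrictDerivAt.localInverse s (deriv s 0) 0 hsd with hρ
  have hρ1 : ∀ᶠ z in 𝓝 0, ρ (s z) = z := HasStrictFDerivAt.eventually_left_inverse _
  have hρ2 : ∀ᶠ t in 𝓝 (s 0), s (ρ t) = t := HasStrictFDerivAt.eventually_right_inverse _
  have hρ0 : ρ 0 = 0 := by
    have := hρ1.self_of_nhds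
    rwa [hs0] at this
  rw [hs0] at hra hρ2
  refine ⟨q, ρ, hqa, hq0, hra, hρ0, ?_, ?_, hρ1, ?_⟩
  · filter_upwards with z
    split_ifs with hz
    · rw [hz, hq0]
    · simp only [hq]
      rw [hhg z]
      congr 1
      have : z ^ 2 ≠ 0 := pow_ne_zero 2 hz
      by_cases hgz : g z = 0
      · simp [hgz]
      · field_simp
  · have h3 : Tendsto ρ (𝓝 0) (𝓝 0) := by
      have := hra.continuousAt.tendsto
      rwa [hρ0] at this
    filter_upwards [hρ2, h3.eventually hqne] with t ht hne
    have h4 : ρ t / q (ρ t) = t := ht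
    rw [div_eq_iff hne] at h4
    exact h4
  · filter_upwards [hgne] with z hz
    rw [div_pow, hq2, hhg z]
    field_simp

/-! ### The function `mu` -/

/-- The phase `1 + iz - e^{iz}`. -/
noncomputable def phase (z : ℂ) : ℂ := 1 + Complex.I * z - Complex.exp (Complex.I * z)

theorem differentiable_phase : Differentiable ℂ phase := by unfold phase; fun_prop

theorem deriv_phase (z : ℂ) :
    deriv phase z = Complex.I - Complex.I * Complex.exp (Complex.I * z) := by
  have h1 : HasDerivAt (fun z => Complex.I * z) Complex.I z := by
    simpa using (hasDerivAt_id z).const_mul Complex.I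
  have h2 := ((h1.const_add 1).sub h1.cexp).deriv
  refine h2.trans ?_
  ring

theorem iteratedDeriv_two_phase : iteratedDeriv 2 phase 0 = 1 := by
  rw [iteratedDeriv_succ', iteratedDeriv_one]
  have h0 : deriv phase = fun z => Complex.I - Complex.I * Complex.exp (Complex.I * z) :=
    funext deriv_phase
  have h1 : HasDerivAt (fun z => Complex.I * z) Complex.I 0 := by
    simpa using (hasDerivAt_id (0 : ℂ)).const_mul Complex.I
  have h2 := ((h1.cexp.const_mul Complex.I).const_sub Complex.I).deriv
  rw [h0]
  refine h2.trans ?_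
  simp

/-- By Lagrange inversion the series `mu` has the Taylor coefficients of the inverse ρ from
`exists_normal_form`, hence equals it near 0. Nothing is claimed elsewhere. -/
theorem exists_mu_normal_form :
    ∃ q : ℂ → ℂ, AnalyticAt ℂ q 0 ∧ q 0 = 1 ∧ AnalyticAt ℂ mu 0 ∧ mu 0 = 0 ∧
      (∀ᶠ t in 𝓝 0, mu t = t * q (mu t)) ∧ (∀ᶠ z in 𝓝 0, mu (z / q z) = z) ∧
      (∀ᶠ z in 𝓝 0, (z / q z) ^ 2 = 2 * phase z) := by
  obtain ⟨q, ρ, hqa, hq0, hρa, hρ0, hqeq, hfix, hinv, hsq⟩ :=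
    exists_normal_form (differentiable_phase.analyticAt 0) (by simp [phase])
      (by rw [deriv_phase]; simp) iteratedDeriv_two_phase
  have hqfun : qfun =ᶠ[𝓝 0] q := by
    filter_upwards [hqeq] with z hz
    rw [hz, qfun, phase]
  have hmu : mu =ᶠ[𝓝 0] ρ := by
    filter_upwards [eventually_hasSum_taylorCoeff hρa] with s hs
    have h1 : HasSum (fun n => taylorCoeff ρ (n + 1) * s ^ (n + 1)) (ρ s) := by
      have h2 := (hasSum_nat_add_iff' (f := fun n => taylorCoeff ρ n * s ^ n) 1).2 hs
      simpa [taylorCoeff_zero, hρ0] using h2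
    rw [mu, ← h1.tsum_eq]
    refine tsum_congr fun n => ?_
    rw [taylorCoeff_succ_eq_of_eq_mul_comp hqa (by rw [hq0]; exact one_ne_zero) hρa hfix]
    have h3 : (fun z => qfun z ^ (n + 1)) =ᶠ[𝓝 0] fun z => q z ^ (n + 1) := by
      filter_upwards [hqfun] with z hz
      rw [hz]
    rw [h3.iteratedDeriv_eq]
    ring
  have hs0 : Tendsto (fun z => z / q z) (𝓝 0) (𝓝 0) := by
    have : ContinuousAt (fun z => z / q z) 0 :=
      continuousAt_id.div hqa.continuousAt (by rw [hq0]; exact one_ne_zero)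
    simpa using this.tendsto
  refine ⟨q, hqa, hq0, hρa.congr hmu.symm, by rw [hmu.self_of_nhds, hρ0], ?_, ?_, hsq⟩
  · filter_upwards [hfix, hmu] with t h1 h2
    rw [h2]
    exact h1
  · filter_upwards [hinv, hs0.eventually hmu] with z h1 h2
    rw [h2, h1]

theorem analyticAt_mu : AnalyticAt ℂ mu 0 := exists_mu_normal_form.choose_spec.2.2.1

theorem mu_zero : mu 0 = 0 := exists_mu_normal_form.choose_spec.2.2.2.1

theorem eventually_sq_eq_phase_mu : ∀ᶠ t in 𝓝 (0 : ℂ), t ^ 2 = 2 * phase (mu t) := by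
  obtain ⟨q, hqa, hq0, hma, hm0, hfix, hinv, hsq⟩ := exists_mu_normal_form
  have h1 : Tendsto mu (𝓝 0) (𝓝 0) := by
    have := hma.continuousAt.tendsto
    rwa [hm0] at this
  have hqne : ∀ᶠ z in 𝓝 0, q z ≠ 0 :=
    hqa.continuousAt.eventually_ne (by rw [hq0]; exact one_ne_zero)
  filter_upwards [hfix, h1.eventually hsq, h1.eventually hqne] with t h2 h3 h4
  rw [← h3]
  congr 1
  rw [eq_div_iff h4]
  exact h2.symm

/-- The differential equation satisfied by `mu`. -/
theorem eventually_eq_deriv_mu : ∀ᶠ t in 𝓝 (0 : ℂ),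
    t = Complex.I * (deriv mu t * (1 - Complex.exp (Complex.I * mu t))) := by
  filter_upwards [eventually_sq_eq_phase_mu.eventually_nhds,
    analyticAt_mu.eventually_analyticAt] with t ht hmt
  have h1 := EventuallyEq.deriv_eq (ht : (fun t : ℂ => t ^ 2) =ᶠ[𝓝 t] fun t => 2 * phase (mu t))
  have h2 : HasDerivAt (fun t => 2 * phase (mu t)) (2 * (deriv phase (mu t) * deriv mu t)) t :=
    (((differentiable_phase (mu t)).hasDerivAt).comp t hmt.differentiableAt.hasDerivAt).const_mul 2
  rw [h2.deriv, deriv_phase] at h1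
  have h3 : deriv (fun t : ℂ => t ^ 2) t = 2 * t := by simp
  rw [h3] at h1
  linear_combination h1 / 2

/-! ### Laplace's method -/

/-- The normalised Gaussian moments `1, 1, 3, 15, …`. -/
noncomputable def gaussMoment (l : ℕ) : ℝ := Real.Gamma ((l : ℝ) + 1 / 2) * 2 ^ l / √Real.pi

theorem gaussMoment_zero : gaussMoment 0 = 1 := by
  have : √Real.pi ≠ 0 := (Real.sqrt_pos.2 Real.pi_pos).ne'
  rw [gaussMoment, Nat.cast_zero, zero_add, Real.Gamma_one_half_eq]
  field_simp

theorem gaussMoment_succ (l : ℕ) : gaussMoment (l + 1) = (2 * l + 1) * gaussMoment l := by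
  have h1 : ((l + 1 : ℕ) : ℝ) + 1 / 2 = ((l : ℝ) + 1 / 2) + 1 := by push_cast; ring
  rw [gaussMoment, gaussMoment, h1, Real.Gamma_add_one (by positivity), pow_succ]
  ring

/-- `exp (-x w ^ 2 / 2)`. -/
noncomputable def gaussKernel (x : ℝ) (w : ℂ) : ℂ := Complex.exp (((-(x / 2) : ℝ) : ℂ) * w ^ 2)

theorem norm_gaussKernel (x : ℝ) (w : ℂ) :
    ‖gaussKernel x w‖ = Real.exp (-(x / 2) * (w ^ 2).re) := by
  rw [gaussKernel, Complex.norm_exp, Complex.re_ofReal_mul]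

theorem differentiable_gaussKernel (x : ℝ) : Differentiable ℂ (gaussKernel x) := by
  unfold gaussKernel; fun_prop

theorem hasDerivAt_gaussKernel (x : ℝ) (w : ℂ) :
    HasDerivAt (gaussKernel x) (-(x * w * gaussKernel x w)) w := by
  have h1 : HasDerivAt (fun w : ℂ => ((-(x / 2) : ℝ) : ℂ) * w ^ 2)
      (((-(x / 2) : ℝ) : ℂ) * (2 * w)) w := by
    simpa using (hasDerivAt_pow 2 w).const_mul ((-(x / 2) : ℝ) : ℂ)
  refine h1.cexp.congr_deriv ?_
  rw [gaussKernel]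
  push_cast
  ring

theorem gaussKernel_ofReal (x u : ℝ) :
    gaussKernel x u = ((Real.exp (-(x / 2) * u ^ 2) : ℝ) : ℂ) := by
  rw [gaussKernel]
  push_cast
  rfl

/-! ### Gaussian moments along a nearly straight arc -/

/-- `s` is analytic and close to the identity on the closed disc of radius `δ`. -/
structure IsNearIdentity (s : ℂ → ℂ) (δ : ℝ) : Prop where
  pos : 0 < δ
  analyticAt : ∀ z : ℂ, ‖z‖ ≤ δ → AnalyticAt ℂ s z
  norm_sub_le : ∀ z : ℂ, ‖z‖ ≤ δ → ‖s z - z‖ ≤ ‖z‖ / 4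

namespace IsNearIdentity

variable {s : ℂ → ℂ} {δ : ℝ}

theorem re_sub_le (hs : IsNearIdentity s δ) {θ : ℝ} (hθ : |θ| ≤ δ) :
    |(s θ).re - θ| ≤ |θ| / 4 := by
  have h1 := hs.norm_sub_le θ (by rwa [Complex.norm_real])
  have h2 := Complex.abs_re_le_norm (s θ - θ)
  rw [Complex.sub_re, Complex.ofReal_re] at h2
  rw [Complex.norm_real] at h1
  exact h2.trans h1

theorem abs_im_le (hs : IsNearIdentity s δ) {θ : ℝ} (hθ : |θ| ≤ δ) : |(s θ).im| ≤ |θ| / 4 := by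
  have h1 := hs.norm_sub_le θ (by rwa [Complex.norm_real])
  have h2 := Complex.abs_im_le_norm (s θ - θ)
  rw [Complex.sub_im, Complex.ofReal_im, sub_zero] at h2
  rw [Complex.norm_real] at h1
  exact h2.trans h1

theorem norm_lt (hs : IsNearIdentity s δ) {θ : ℝ} (hθ : |θ| ≤ δ) : ‖s θ‖ < 2 * δ := by
  have h1 := hs.norm_sub_le θ (by rwa [Complex.norm_real])
  rw [Complex.norm_real, Real.norm_eq_abs] at h1
  have h2 := norm_le_norm_add_norm_sub (θ : ℂ) (s θ)
  rw [Complex.norm_real, Real.norm_eq_abs, norm_sub_rev] at h2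
  have := hs.pos
  linarith

/-- |Re s| ≥ 3|θ|/4 and |Im s| ≤ |θ|/4, and 9/16 - 1/16 = 1/2. So the Gaussian kernel still decays
along the arc. -/
theorem re_sq_ge (hs : IsNearIdentity s δ) {θ : ℝ} (hθ : |θ| ≤ δ) :
    θ ^ 2 / 2 ≤ (s θ ^ 2).re := by
  have h1 := hs.re_sub_le hθ
  have h2 := hs.abs_im_le hθ
  have h3 : (s θ ^ 2).re = (s θ).re ^ 2 - (s θ).im ^ 2 := by
    rw [sq, Complex.mul_re]; ring
  have h4 : (s θ).im ^ 2 ≤ (|θ| / 4) ^ 2 := sq_le_sq' (by linarith [neg_abs_le (s θ).im])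
    ((le_abs_self _).trans h2)
  have h5 : (3 * |θ| / 4) ^ 2 ≤ (s θ).re ^ 2 := by
    rw [← sq_abs (s θ).re]
    have : 3 * |θ| / 4 ≤ |(s θ).re| := by
      have := abs_sub_abs_le_abs_sub θ (s θ).re
      rw [abs_sub_comm] at this
      linarith
    have h6 := abs_nonneg θ
    gcongr
  rw [h3]
  have h6 : (|θ| / 4) ^ 2 = θ ^ 2 / 16 := by rw [div_pow, sq_abs]; norm_num
  have h7 : (3 * |θ| / 4) ^ 2 = 9 * θ ^ 2 / 16 := by
    rw [div_pow, mul_pow, sq_abs]; norm_num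
  rw [h6] at h4
  rw [h7] at h5
  nlinarith [sq_nonneg θ]

theorem continuousOn_comp (hs : IsNearIdentity s δ) :
    ContinuousOn (fun θ : ℝ => s θ) (Set.Icc (-δ) δ) := fun θ hθ =>
  ((hs.analyticAt θ (by rw [Complex.norm_real]; exact abs_le.2 hθ)).continuousAt.comp
    Complex.continuous_ofReal.continuousAt).continuousWithinAt

theorem continuousOn_deriv (hs : IsNearIdentity s δ) :
    ContinuousOn (fun θ : ℝ => deriv s θ) (Set.Icc (-δ) δ) := fun θ hθ =>
  ((hs.analyticAt θ (by rw [Complex.norm_real]; exact abs_le.2 hθ)).deriv.continuousAt.comp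
    Complex.continuous_ofReal.continuousAt).continuousWithinAt

theorem neg_le_self (hs : IsNearIdentity s δ) : -δ ≤ δ := by have := hs.pos; linarith

theorem intervalIntegrable (hs : IsNearIdentity s δ) {φ : ℂ → ℂ} (hφ : Continuous φ) :
    IntervalIntegrable (fun θ : ℝ => φ (s θ) * deriv s θ) MeasureTheory.volume (-δ) δ := by
  refine ContinuousOn.intervalIntegrable ?_
  rw [Set.uIcc_of_le hs.neg_le_self]
  exact (hφ.comp_continuousOn hs.continuousOn_comp).mul hs.continuousOn_deriv

theorem integral_comp_mul_deriv (hs : IsNearIdentity s δ) {φ Φ : ℂ → ℂ} (hφ : Continuous φ)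
    (hΦ : ∀ w : ℂ, ‖w‖ < 2 * δ → HasDerivAt Φ (φ w) w) :
    ∫ θ : ℝ in (-δ)..δ, φ (s θ) * deriv s θ = Φ (s δ) - Φ (s (-δ)) := by
  have h := intervalIntegral.integral_eq_sub_of_hasDerivAt (a := -δ) (b := δ)
    (f := fun θ : ℝ => Φ (s θ)) (f' := fun θ : ℝ => φ (s θ) * deriv s θ) (fun θ hθ => ?_)
    (hs.intervalIntegrable hφ)
  · simpa using h
  · rw [Set.uIcc_of_le hs.neg_le_self] at hθ
    have hθ' : |θ| ≤ δ := abs_le.2 hθ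
    have h1 := (hs.analyticAt θ (by rwa [Complex.norm_real])).differentiableAt.hasDerivAt
    exact ((hΦ (s θ) (hs.norm_lt hθ')).comp (θ : ℂ) h1).comp_ofReal

/-- The `i`-th moment of `exp (-x s ^ 2 / 2)` along the arc `s([-δ, δ])`. -/
noncomputable def moment (s : ℂ → ℂ) (δ : ℝ) (i : ℕ) (x : ℝ) : ℂ :=
  ∫ θ : ℝ in (-δ)..δ, s θ ^ i * gaussKernel x (s θ) * deriv s θ

theorem norm_boundary_le (hs : IsNearIdentity s δ) (i : ℕ) {x : ℝ} (hx : 0 ≤ x) {θ : ℝ}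
    (hθ : |θ| = δ) :
    ‖s θ ^ i * gaussKernel x (s θ)‖ ≤ (2 * δ) ^ i * Real.exp (-(δ ^ 2 / 8) * x) := by
  rw [norm_mul, norm_pow, norm_gaussKernel]
  have h1 := hs.norm_lt hθ.le
  have h2 := hs.re_sq_ge hθ.le
  have h3 : θ ^ 2 = δ ^ 2 := by rw [← sq_abs, hθ]
  rw [h3] at h2
  have h4 : -(x / 2) * (s θ ^ 2).re ≤ -(δ ^ 2 / 8) * x := by nlinarith [sq_nonneg δ]
  have hδ := hs.pos
  gcongr

/-- Off the interval, xu²/2 ≥ u²/4 + cx: half of the exponent gives the decay in x, the other half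
the integrability. -/
theorem integral_gauss_sub_le {x₁ x₂ c x : ℝ} (h12 : x₁ ≤ x₂) (hx : 1 ≤ x)
    (h : ∀ u, u ∉ Set.Ioc x₁ x₂ → 4 * c ≤ u ^ 2) :
    |(∫ u in x₁..x₂, Real.exp (-(x / 2) * u ^ 2)) - √(2 * Real.pi / x)| ≤
      √(4 * Real.pi) * Real.exp (-c * x) := by
  have hx0 : 0 < x := by linarith
  have hi : MeasureTheory.Integrable fun u : ℝ => Real.exp (-(x / 2) * u ^ 2) :=
    integrable_exp_neg_mul_sq (by positivity)
  have hg : ∫ u : ℝ, Real.exp (-(x / 2) * u ^ 2) = √(2 * Real.pi / x) := by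
    rw [integral_gaussian]; congr 1; field_simp
  have hg2 : ∫ u : ℝ, Real.exp (-(1 / 4) * u ^ 2) = √(4 * Real.pi) := by
    rw [integral_gaussian]; congr 1; ring
  have hi2 : MeasureTheory.Integrable fun u : ℝ => Real.exp (-(1 / 4) * u ^ 2) :=
    integrable_exp_neg_mul_sq (by norm_num)
  have hsplit := MeasureTheory.integral_add_compl (s := Set.Ioc x₁ x₂) measurableSet_Ioc hi
  rw [intervalIntegral.integral_of_le h12, ← hg, ← hsplit, sub_add_cancel_left, abs_neg,
    abs_of_nonneg (MeasureTheory.integral_nonneg fun u => (Real.exp_pos _).le)]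
  calc ∫ u in (Set.Ioc x₁ x₂)ᶜ, Real.exp (-(x / 2) * u ^ 2)
      ≤ ∫ u in (Set.Ioc x₁ x₂)ᶜ, Real.exp (-(1 / 4) * u ^ 2) * Real.exp (-c * x) := by
        refine MeasureTheory.setIntegral_mono_on hi.integrableOn
          (hi2.mul_const _).integrableOn measurableSet_Ioc.compl fun u hu => ?_
        rw [← Real.exp_add]
        refine Real.exp_le_exp.2 ?_
        have h1 := h u hu
        nlinarith [sq_nonneg u]
    _ ≤ ∫ u, Real.exp (-(1 / 4) * u ^ 2) * Real.exp (-c * x) :=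
        MeasureTheory.setIntegral_le_integral (hi2.mul_const _)
          (Eventually.of_forall fun u => mul_nonneg (Real.exp_pos _).le (Real.exp_pos _).le)
    _ = √(4 * Real.pi) * Real.exp (-c * x) := by
        rw [MeasureTheory.integral_mul_const, hg2]

/-- On the vertical segment from an end of the arc to the real axis, Re w² is smallest at the end of
the arc, where it is at least δ²/2. The kernel is therefore exponentially small there. -/
theorem norm_primitive_sub_le (hs : IsNearIdentity s δ) {x : ℝ} (hx : 0 ≤ x) {P : ℂ → ℂ}
    (hP : ∀ w : ℂ, ‖w‖ < 2 * δ → HasDerivAt P (gaussKernel x w) w) {θ : ℝ} (hθ : |θ| = δ) :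
    ‖P (s θ) - P ((s θ).re : ℂ)‖ ≤ δ * Real.exp (-(δ ^ 2 / 8) * x) := by
  set a : ℂ := ((s θ).re : ℂ) with ha
  have h2 := hs.re_sq_ge hθ.le
  have h3 : θ ^ 2 = δ ^ 2 := by rw [← sq_abs, hθ]
  rw [h3] at h2
  have h5 : (s θ ^ 2).re = (s θ).re ^ 2 - (s θ).im ^ 2 := by
    rw [sq, Complex.mul_re]; ring
  have hseg : ∀ w ∈ segment ℝ a (s θ), w.re = (s θ).re ∧ w.im ^ 2 ≤ (s θ).im ^ 2 := by
    rintro w ⟨u, v, hu, hv, huv, rfl⟩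
    have hv1 : v ≤ 1 := by linarith
    simp only [ha, Complex.add_re, Complex.add_im, Complex.real_smul, Complex.re_ofReal_mul,
      Complex.im_ofReal_mul, Complex.ofReal_re, Complex.ofReal_im, mul_zero, zero_add]
    refine ⟨by rw [← add_mul, huv, one_mul], ?_⟩
    rw [mul_pow]
    exact mul_le_of_le_one_left (sq_nonneg _) (pow_le_one₀ hv hv1)
  have hnorm : ∀ w ∈ segment ℝ a (s θ), ‖w‖ < 2 * δ := by
    intro w hw
    obtain ⟨e1, e2⟩ := hseg w hw
    refine lt_of_le_of_lt ?_ (hs.norm_lt hθ.le)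
    rw [← Real.sqrt_sq (norm_nonneg w), ← Real.sqrt_sq (norm_nonneg (s θ))]
    refine Real.sqrt_le_sqrt ?_
    rw [← Complex.normSq_eq_norm_sq, ← Complex.normSq_eq_norm_sq, Complex.normSq_apply,
      Complex.normSq_apply, e1]
    nlinarith
  have key := Convex.norm_image_sub_le_of_norm_hasDerivWithin_le (f := P)
    (f' := gaussKernel x) (C := Real.exp (-(δ ^ 2 / 8) * x)) (s := segment ℝ a (s θ))
    (fun w hw => (hP w (hnorm w hw)).hasDerivWithinAt) (fun w hw => ?_) (convex_segment _ _)
    (left_mem_segment ℝ _ _) (right_mem_segment ℝ _ _)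
  · have h6 : ‖s θ - a‖ ≤ δ := by
      have h7 : s θ - a = ((s θ).im : ℂ) * Complex.I := by
        rw [ha, sub_eq_iff_eq_add, add_comm]; exact (Complex.re_add_im _).symm
      rw [h7, norm_mul, Complex.norm_I, mul_one, Complex.norm_real, Real.norm_eq_abs]
      have := hs.abs_im_le hθ.le
      have := hs.pos
      linarith
    refine key.trans ?_
    rw [mul_comm]
    exact mul_le_mul_of_nonneg_right h6 (Real.exp_pos _).le
  · rw [norm_gaussKernel]
    refine Real.exp_le_exp.2 ?_
    obtain ⟨e1, e2⟩ := hseg w hw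
    have h8 : (w ^ 2).re = w.re ^ 2 - w.im ^ 2 := by rw [sq, Complex.mul_re]; ring
    rw [h8, e1]
    nlinarith [sq_nonneg δ]

/-- Deformation of the arc by means of a primitive of the kernel: it becomes a real interval plus
two vertical segments. The segments and the missing real tails are exponentially small. -/
theorem exists_norm_moment_zero_sub_le (hs : IsNearIdentity s δ) :
    ∃ C : ℝ, ∀ x : ℝ, 1 ≤ x →
      ‖moment s δ 0 x - ((√(2 * Real.pi / x) : ℝ) : ℂ)‖ ≤ C * Real.exp (-(δ ^ 2 / 8) * x) := by
  refine ⟨δ + δ + √(4 * Real.pi), fun x hx => ?_⟩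
  have hδ := hs.pos
  obtain ⟨P, hP⟩ := DifferentiableOn.isExactOn_ball (c := 0) (r := 2 * δ)
    (differentiable_gaussKernel x).differentiableOn
  have hP' : ∀ w : ℂ, ‖w‖ < 2 * δ → HasDerivAt P (gaussKernel x w) w := fun w hw =>
    hP w (mem_ball_zero_iff.2 hw)
  have e1 : moment s δ 0 x = P (s δ) - P (s (-δ)) := by
    rw [← hs.integral_comp_mul_deriv (differentiable_gaussKernel x).continuous hP', moment]
    simp
  have ab1 : |δ| = δ := abs_of_pos hδ
  have ab2 : |-δ| = δ := by rw [abs_neg, ab1]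
  have b1 := hs.norm_primitive_sub_le (by linarith : (0 : ℝ) ≤ x) hP' ab1
  have b2 := hs.norm_primitive_sub_le (by linarith : (0 : ℝ) ≤ x) hP' ab2
  set x₂ := (s δ).re with hx₂
  set x₁ := (s ((-δ : ℝ) : ℂ)).re with hx₁
  have r2 := abs_le.1 (hs.re_sub_le ab1.le)
  have r1 := abs_le.1 (hs.re_sub_le ab2.le)
  rw [ab1] at r2
  rw [ab2] at r1
  have hx2 : 3 * δ / 4 ≤ x₂ := by linarith [r2.1]
  have hx1 : x₁ ≤ -(3 * δ / 4) := by linarith [r1.2]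
  have hx2' : x₂ ≤ 5 * δ / 4 := by linarith [r2.2]
  have hx1' : -(5 * δ / 4) ≤ x₁ := by linarith [r1.1]
  have h12 : x₁ ≤ x₂ := by linarith
  have e2 : P x₂ - P x₁ = ((∫ u in x₁..x₂, Real.exp (-(x / 2) * u ^ 2) : ℝ) : ℂ) := by
    rw [← intervalIntegral.integral_ofReal]
    simp only [← gaussKernel_ofReal]
    symm
    refine intervalIntegral.integral_eq_sub_of_hasDerivAt (f := fun u : ℝ => P u)
      (fun u hu => ?_) ?_
    · rw [Set.uIcc_of_le h12] at hu
      refine (hP' u ?_).comp_ofReal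
      rw [Complex.norm_real, Real.norm_eq_abs, abs_lt]
      constructor <;> linarith [hu.1, hu.2]
    · exact ((differentiable_gaussKernel x).continuous.comp
        Complex.continuous_ofReal).intervalIntegrable _ _
  have b3 := integral_gauss_sub_le h12 hx (c := δ ^ 2 / 8) (fun u hu => by
    rw [Set.mem_Ioc, not_and_or, not_lt, not_le] at hu
    rcases hu with hu | hu
    · nlinarith
    · nlinarith)
  have e3 : moment s δ 0 x - ((√(2 * Real.pi / x) : ℝ) : ℂ) =
      (P (s δ) - P x₂) - (P (s ((-δ : ℝ) : ℂ)) - P x₁) +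
        (((∫ u in x₁..x₂, Real.exp (-(x / 2) * u ^ 2)) - √(2 * Real.pi / x) : ℝ) : ℂ) := by
    have : P (s ((-δ : ℝ) : ℂ)) = P (s (-δ)) := by push_cast; rfl
    rw [e1, Complex.ofReal_sub, ← e2, this]
    ring
  rw [e3]
  refine (norm_add_le _ _).trans ?_
  rw [Complex.norm_real, Real.norm_eq_abs, add_mul, add_mul]
  exact add_le_add ((_root_.norm_sub_le _ _).trans (add_le_add b1 b2)) b3

/-- Integration by parts, with primitive w^{i+1} e^{-xw²/2}. -/
theorem mul_moment_add_two (hs : IsNearIdentity s δ) (i : ℕ) (x : ℝ) :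
    x * moment s δ (i + 2) x = (i + 1) * moment s δ i x -
      (s δ ^ (i + 1) * gaussKernel x (s δ) - s (-δ) ^ (i + 1) * gaussKernel x (s (-δ))) := by
  have hc := (differentiable_gaussKernel x).continuous
  have h1 := hs.integral_comp_mul_deriv
    (φ := fun w => (i + 1) * (w ^ i * gaussKernel x w) - x * (w ^ (i + 2) * gaussKernel x w))
    (Φ := fun w => w ^ (i + 1) * gaussKernel x w) (by fun_prop) (fun w _ => by
      refine ((hasDerivAt_pow (i + 1) w).fun_mul (hasDerivAt_gaussKernel x w)).congr_deriv ?_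
      rw [Nat.add_sub_cancel]
      push_cast
      ring)
  have i1 := hs.intervalIntegrable (φ := fun w => w ^ i * gaussKernel x w) (by fun_prop)
  have i2 := hs.intervalIntegrable (φ := fun w => w ^ (i + 2) * gaussKernel x w) (by fun_prop)
  have h2 : ∫ θ : ℝ in (-δ)..δ, ((i + 1) * (s θ ^ i * gaussKernel x (s θ)) -
      x * (s θ ^ (i + 2) * gaussKernel x (s θ))) * deriv s θ =
      (i + 1) * moment s δ i x - x * moment s δ (i + 2) x := by
    rw [moment, moment, ← intervalIntegral.integral_const_mul,
      ← intervalIntegral.integral_const_mul,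
      ← intervalIntegral.integral_sub (i1.const_mul _) (i2.const_mul _)]
    refine intervalIntegral.integral_congr fun θ _ => ?_
    ring
  rw [h2] at h1
  linear_combination -h1

theorem mul_moment_one (hs : IsNearIdentity s δ) (x : ℝ) :
    x * moment s δ 1 x = -(gaussKernel x (s δ) - gaussKernel x (s (-δ))) := by
  have hc := (differentiable_gaussKernel x).continuous
  have h1 := hs.integral_comp_mul_deriv (φ := fun w => -(x * w * gaussKernel x w))
    (Φ := gaussKernel x) (by fun_prop) (fun w _ => hasDerivAt_gaussKernel x w)
  rw [← h1, moment, ← intervalIntegral.integral_const_mul, ← intervalIntegral.integral_neg]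
  refine intervalIntegral.integral_congr fun θ _ => ?_
  ring

/-- The moments of the Gaussian `exp (-x u ^ 2 / 2)` on the real line. -/
noncomputable def fullMoment (x : ℝ) : ℕ → ℝ
  | 0 => √(2 * Real.pi / x)
  | 1 => 0
  | i + 2 => (i + 1) / x * fullMoment x i

theorem exists_norm_moment_sub_le (hs : IsNearIdentity s δ) (i : ℕ) :
    ∃ C : ℝ, 0 ≤ C ∧ ∀ x : ℝ, 1 ≤ x →
      ‖moment s δ i x - (fullMoment x i : ℂ)‖ ≤ C * Real.exp (-(δ ^ 2 / 8) * x) := by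
  have hδ := hs.pos
  have ab1 : |δ| = δ := abs_of_pos hδ
  have ab2 : |-δ| = δ := by rw [abs_neg, ab1]
  have hbd : ∀ (j : ℕ) (x : ℝ), 1 ≤ x →
      ‖s δ ^ j * gaussKernel x (s δ) - s (-δ) ^ j * gaussKernel x (s (-δ))‖ ≤
        2 * (2 * δ) ^ j * Real.exp (-(δ ^ 2 / 8) * x) := by
    intro j x hx
    have b1 := hs.norm_boundary_le j (by linarith : (0 : ℝ) ≤ x) ab1
    have b2 := hs.norm_boundary_le j (by linarith : (0 : ℝ) ≤ x) ab2
    rw [Complex.ofReal_neg] at b2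
    refine (_root_.norm_sub_le _ _).trans ((add_le_add b1 b2).trans (le_of_eq ?_))
    ring
  induction i using Nat.twoStepInduction with
  | zero =>
    obtain ⟨C, hC⟩ := hs.exists_norm_moment_zero_sub_le
    refine ⟨|C|, abs_nonneg C, fun x hx => (hC x hx).trans ?_⟩
    gcongr
    exact le_abs_self C
  | one =>
    refine ⟨2 * (2 * δ) ^ 0, by positivity, fun x hx => ?_⟩
    have hx0 : 0 < x := by linarith
    have h1 := hs.mul_moment_one x
    have h2 := hbd 0 x hx
    simp only [pow_zero, one_mul] at h2
    have h3 : ‖(x : ℂ) * moment s δ 1 x‖ ≤ 2 * 1 * Real.exp (-(δ ^ 2 / 8) * x) := by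
      rw [h1, norm_neg]; exact h2
    rw [norm_mul, Complex.norm_real, Real.norm_of_nonneg hx0.le] at h3
    rw [fullMoment, Complex.ofReal_zero, sub_zero, pow_zero]
    refine le_trans ?_ h3
    exact le_mul_of_one_le_left (norm_nonneg _) hx
  | more i ih _ =>
    obtain ⟨C, hC0, hC⟩ := ih
    refine ⟨(i + 1) * C + 2 * (2 * δ) ^ (i + 1), by positivity, fun x hx => ?_⟩
    have hx0 : 0 < x := by linarith
    have hxc : (x : ℂ) ≠ 0 := by exact_mod_cast hx0.ne'
    have h1 := hs.mul_moment_add_two i x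
    have h2 := hbd (i + 1) x hx
    set B := s δ ^ (i + 1) * gaussKernel x (s δ) - s (-δ) ^ (i + 1) * gaussKernel x (s (-δ))
    have h3 : (x : ℂ) * (moment s δ (i + 2) x - (fullMoment x (i + 2) : ℂ)) =
        (i + 1) * (moment s δ i x - (fullMoment x i : ℂ)) - B := by
      rw [mul_sub, h1, fullMoment]
      push_cast
      field_simp
      ring
    have h4 : ‖(x : ℂ) * (moment s δ (i + 2) x - (fullMoment x (i + 2) : ℂ))‖ ≤
        ((i + 1) * C + 2 * (2 * δ) ^ (i + 1)) * Real.exp (-(δ ^ 2 / 8) * x) := by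
      rw [h3]
      refine (_root_.norm_sub_le _ _).trans ?_
      rw [add_mul (((i : ℝ) + 1) * C)]
      refine add_le_add ?_ h2
      rw [norm_mul, mul_assoc]
      have h5 : ‖(i : ℂ) + 1‖ = i + 1 := by
        have : (i : ℂ) + 1 = ((i + 1 : ℕ) : ℂ) := by push_cast; rfl
        rw [this, Complex.norm_natCast]
        push_cast
        rfl
      rw [h5]
      exact mul_le_mul_of_nonneg_left (hC x hx) (by positivity)
    rw [norm_mul, Complex.norm_real, Real.norm_of_nonneg hx0.le] at h4
    refine le_trans ?_ h4
    exact le_mul_of_one_le_left (norm_nonneg _) hx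

theorem fullMoment_odd (x : ℝ) (l : ℕ) : fullMoment x (2 * l + 1) = 0 := by
  induction l with
  | zero => rfl
  | succ l ih =>
    rw [show 2 * (l + 1) + 1 = (2 * l + 1) + 2 by ring, fullMoment, ih, mul_zero]

theorem fullMoment_even (x : ℝ) (l : ℕ) :
    fullMoment x (2 * l) = √(2 * Real.pi / x) * (gaussMoment l / x ^ l) := by
  induction l with
  | zero => simp [fullMoment, gaussMoment_zero]
  | succ l ih =>
    rw [show 2 * (l + 1) = 2 * l + 2 by ring, fullMoment, ih, gaussMoment_succ]
    push_cast
    by_cases hx : x = 0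
    · simp [hx]
    · field_simp
      ring

/-- Odd moments vanish, so only even Taylor coefficients enter the expansion. -/
theorem sum_range_fullMoment (c : ℕ → ℂ) (x : ℝ) (N : ℕ) :
    ∑ i ∈ Finset.range (2 * N), c i * (fullMoment x i : ℂ) =
      ((√(2 * Real.pi / x) : ℝ) : ℂ) *
        ∑ l ∈ Finset.range N, c (2 * l) * (gaussMoment l : ℂ) / (x : ℂ) ^ l := by
  induction N with
  | zero => simp
  | succ N ih =>
    rw [show 2 * (N + 1) = 2 * N + 1 + 1 by ring, Finset.sum_range_succ, Finset.sum_range_succ, ih,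
      Finset.sum_range_succ, fullMoment_odd, fullMoment_even]
    push_cast
    ring

end IsNearIdentity

/-- The extra factor x is there to absorb the normalisation √(x/2π) ≤ x. -/
theorem exists_mul_exp_neg_le {c : ℝ} (hc : 0 < c) (m : ℕ) :
    ∃ C : ℝ, 0 ≤ C ∧ ∀ x : ℝ, 1 ≤ x → x * Real.exp (-c * x) ≤ C / x ^ m := by
  refine ⟨(Nat.factorial (m + 1) : ℝ) / c ^ (m + 1), by positivity, fun x hx => ?_⟩
  have hx0 : 0 < x := by linarith
  have h1 := Real.pow_div_factorial_le_exp (c * x) (by positivity) (m + 1)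
  rw [neg_mul, Real.exp_neg]
  have h2 : 0 < (c * x) ^ (m + 1) / (Nat.factorial (m + 1) : ℝ) := by positivity
  calc x * (Real.exp (c * x))⁻¹ ≤ x * ((c * x) ^ (m + 1) / (Nat.factorial (m + 1) : ℝ))⁻¹ := by
        gcongr
    _ = _ := by
        rw [mul_pow]
        field_simp
        ring

/-- Half of the exponent pays for the power, by (xθ²/8)^m ≤ m! e^{xθ²/8}; the other half is
integrated over the whole line. -/
theorem integral_pow_mul_exp_le {δ x : ℝ} (hδ : 0 < δ) (hx : 0 < x) (m : ℕ) :
    ∫ θ in (-δ)..δ, |θ| ^ (2 * m) * Real.exp (-(x / 4) * θ ^ 2) ≤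
      (Nat.factorial m : ℝ) * (8 / x) ^ m * √(8 * Real.pi / x) := by
  have hi : MeasureTheory.Integrable fun u : ℝ => Real.exp (-(x / 8) * u ^ 2) :=
    integrable_exp_neg_mul_sq (by positivity)
  have hg : ∫ u : ℝ, Real.exp (-(x / 8) * u ^ 2) = √(8 * Real.pi / x) := by
    rw [integral_gaussian]; congr 1; field_simp
  rw [intervalIntegral.integral_of_le (by linarith), ← hg, ← MeasureTheory.integral_const_mul]
  refine le_trans (MeasureTheory.setIntegral_mono_on (g := fun θ =>
    (Nat.factorial m : ℝ) * (8 / x) ^ m * Real.exp (-(x / 8) * θ ^ 2)) ?_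
    (hi.const_mul _).integrableOn measurableSet_Ioc fun θ _ => ?_)
    (MeasureTheory.setIntegral_le_integral (hi.const_mul _)
      (Eventually.of_forall fun u => by positivity))
  · exact (Continuous.integrableOn_Icc (by fun_prop)).mono_set Set.Ioc_subset_Icc_self
  · have h1 := Real.pow_div_factorial_le_exp (x / 8 * θ ^ 2) (by positivity) m
    rw [div_le_iff₀ (by positivity), mul_pow] at h1
    have h2 : Real.exp (-(x / 4) * θ ^ 2) = Real.exp (-(x / 8) * θ ^ 2) *
        (Real.exp (x / 8 * θ ^ 2))⁻¹ := by
      rw [← Real.exp_neg, ← Real.exp_add]; congr 1; ring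
    have h3 : |θ| ^ (2 * m) = (8 / x) ^ m * ((x / 8) ^ m * (θ ^ 2) ^ m) := by
      rw [← mul_assoc, ← mul_pow, pow_mul, sq_abs]
      have : 8 / x * (x / 8) = 1 := by field_simp
      rw [this, one_pow, one_mul]
    rw [h2, h3]
    have h4 := Real.exp_pos (x / 8 * θ ^ 2)
    have h5 : (x / 8) ^ m * (θ ^ 2) ^ m * (Real.exp (x / 8 * θ ^ 2))⁻¹ ≤ (Nat.factorial m : ℝ) := by
      rw [← div_eq_mul_inv, div_le_iff₀ h4]
      linarith
    calc _ = (8 / x) ^ m * ((x / 8) ^ m * (θ ^ 2) ^ m * (Real.exp (x / 8 * θ ^ 2))⁻¹) *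
          Real.exp (-(x / 8) * θ ^ 2) := by ring
      _ ≤ (8 / x) ^ m * (Nat.factorial m : ℝ) * Real.exp (-(x / 8) * θ ^ 2) := by gcongr
      _ = _ := by ring

theorem eventually_forall_norm_le {P : ℂ → Prop} (h : ∀ᶠ z in 𝓝 (0 : ℂ), P z) :
    ∀ᶠ δ : ℝ in 𝓝[>] 0, ∀ z : ℂ, ‖z‖ ≤ δ → P z := by
  obtain ⟨ε, hε, hb⟩ := Metric.eventually_nhds_iff.1 h
  filter_upwards [Ioo_mem_nhdsGT hε] with δ hδ z hz
  exact hb (by rw [dist_zero_right]; exact hz.trans_lt hδ.2)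

theorem eventually_isNearIdentity {s : ℂ → ℂ} (hs : AnalyticAt ℂ s 0) (h0 : s 0 = 0)
    (h1 : deriv s 0 = 1) : ∀ᶠ δ : ℝ in 𝓝[>] 0, IsNearIdentity s δ := by
  have hd := hs.differentiableAt.hasDerivAt
  rw [h1, hasDerivAt_iff_isLittleO] at hd
  have hd' := hd.def (by norm_num : (0 : ℝ) < 1 / 4)
  have h2 : ∀ᶠ z in 𝓝 (0 : ℂ), AnalyticAt ℂ s z ∧ ‖s z - z‖ ≤ ‖z‖ / 4 := by
    filter_upwards [hd', hs.eventually_analyticAt] with z hz ha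
    refine ⟨ha, ?_⟩
    simp only [h0, sub_zero, smul_eq_mul, mul_one] at hz
    linarith
  filter_upwards [eventually_forall_norm_le h2, self_mem_nhdsWithin] with δ hδ hp
  exact ⟨hp, fun z hz => (hδ z hz).1, fun z hz => (hδ z hz).2⟩

/-- By the chain rule ρ'(s) s' = 1. Taylor expansion of ρ' thus writes the constant 1 as a
polynomial in s times s', up to O(z^n), which turns ∫ e^{-xh} into moments along the arc. -/
theorem eventually_one_sub_sum_le {s ρ : ℂ → ℂ} (hs : AnalyticAt ℂ s 0) (h0 : s 0 = 0)
    (h1 : deriv s 0 = 1) (hρ : AnalyticAt ℂ ρ 0) (hρs : ∀ᶠ z in 𝓝 0, ρ (s z) = z) (n : ℕ) :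
    ∃ K : ℝ, 0 ≤ K ∧ ∀ᶠ z in 𝓝 (0 : ℂ),
      ‖1 - (∑ i ∈ Finset.range n, taylorCoeff (deriv ρ) i * s z ^ i) * deriv s z‖ ≤
        K * ‖z‖ ^ n := by
  obtain ⟨E, hE, hEeq⟩ := exists_eq_sum_taylorCoeff_add hρ.deriv n
  have hst : Tendsto s (𝓝 0) (𝓝 0) := by simpa [h0] using hs.continuousAt.tendsto
  have hderiv : ∀ᶠ z in 𝓝 (0 : ℂ), deriv ρ (s z) * deriv s z = 1 := by
    have e1 : ∀ᶠ z in 𝓝 (0 : ℂ), AnalyticAt ℂ ρ (s z) := hst.eventually hρ.eventually_analyticAt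
    filter_upwards [e1, hs.eventually_analyticAt, hρs.eventually_nhds] with z ha hb hc
    have hcomp := ha.differentiableAt.hasDerivAt.comp z hb.differentiableAt.hasDerivAt
    have hid : HasDerivAt (ρ ∘ s) 1 z := (hasDerivAt_id z).congr_of_eventuallyEq hc
    exact hcomp.unique hid
  have hcont : Tendsto (fun z => ‖E (s z) * deriv s z‖) (𝓝 0) (𝓝 ‖E 0 * 1‖) := by
    have e1 : Tendsto (fun z => E (s z)) (𝓝 0) (𝓝 (E 0)) := hE.continuousAt.tendsto.comp hst
    have e2 : Tendsto (deriv s) (𝓝 0) (𝓝 1) := by simpa [h1] using hs.deriv.continuousAt.tendsto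
    exact (e1.mul e2).norm
  have hd := hs.differentiableAt.hasDerivAt
  rw [h1, hasDerivAt_iff_isLittleO] at hd
  have hd' := hd.def (by norm_num : (0 : ℝ) < 1)
  refine ⟨2 ^ n * (‖E 0 * 1‖ + 1), by positivity, ?_⟩
  filter_upwards [hderiv, hcont.eventually_le_const (lt_add_one _), hd'] with z hz1 hz2 hz3
  simp only [h0, sub_zero, smul_eq_mul, mul_one, one_mul] at hz3
  have hz4 : ‖s z‖ ≤ 2 * ‖z‖ := by
    have := norm_le_norm_add_norm_sub z (s z)
    rw [norm_sub_rev] at this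
    linarith
  have e : 1 - (∑ i ∈ Finset.range n, taylorCoeff (deriv ρ) i * s z ^ i) * deriv s z =
      s z ^ n * (E (s z) * deriv s z) := by
    rw [← hz1, hEeq]
    ring
  rw [e, norm_mul, norm_pow]
  calc ‖s z‖ ^ n * ‖E (s z) * deriv s z‖ ≤ (2 * ‖z‖) ^ n * (‖E 0 * 1‖ + 1) := by gcongr
    _ = _ := by rw [mul_pow]; ring

/-- Laplace's method at a nondegenerate saddle point `0`, in terms of the local inverse `ρ` of
`s = √(2h)`. -/
theorem eventually_exists_norm_laplace_sub_le {h s ρ : ℂ → ℂ} (hs : AnalyticAt ℂ s 0)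
    (h0 : s 0 = 0) (h1 : deriv s 0 = 1) (hρ : AnalyticAt ℂ ρ 0)
    (hρs : ∀ᶠ z in 𝓝 0, ρ (s z) = z) (hh : ∀ᶠ z in 𝓝 0, s z ^ 2 = 2 * h z) (N : ℕ) :
    ∀ᶠ δ : ℝ in 𝓝[>] 0, ∃ C : ℝ, ∀ x : ℝ, 1 ≤ x →
      ‖((√(x / (2 * Real.pi)) : ℝ) : ℂ) * (∫ θ : ℝ in (-δ)..δ, Complex.exp (-x * h θ)) -
        ∑ l ∈ Finset.range (N + 1),
          taylorCoeff (deriv ρ) (2 * l) * (gaussMoment l : ℂ) / (x : ℂ) ^ l‖ ≤ C / x ^ (N + 1) := by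
  -- The even indices below n give the N + 1 terms wanted, and a remainder of size |θ|^n integrates,
  -- after normalisation, to O(x^{-(N+1)}).
  set n := 2 * (N + 1) with hn
  set c := taylorCoeff (deriv ρ) with hc
  obtain ⟨K, hK0, hK⟩ := eventually_one_sub_sum_le hs h0 h1 hρ hρs n
  filter_upwards [eventually_isNearIdentity hs h0 h1, eventually_forall_norm_le hK,
    eventually_forall_norm_le hh] with δ hδ hKδ hhδ
  choose Cm hCm0 hCm using hδ.exists_norm_moment_sub_le
  obtain ⟨Ce, hCe0, hCe⟩ := exists_mul_exp_neg_le
    (c := δ ^ 2 / 8) (by have := hδ.pos; positivity) (N + 1)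
  refine ⟨(∑ i ∈ Finset.range n, ‖c i‖ * Cm i) * Ce +
    2 * K * ((Nat.factorial (N + 1) : ℝ) * 8 ^ (N + 1)), fun x hx => ?_⟩
  have hx0 : 0 < x := by linarith
  set w := √(x / (2 * Real.pi)) with hw
  have hpi := Real.pi_pos
  have hδ0 := hδ.pos
  have hw1 : w * √(2 * Real.pi / x) = 1 := by
    rw [hw, ← Real.sqrt_mul (by positivity)]
    have : x / (2 * Real.pi) * (2 * Real.pi / x) = 1 := by field_simp
    rw [this, Real.sqrt_one]
  have hw2 : w * √(8 * Real.pi / x) = 2 := by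
    rw [hw, ← Real.sqrt_mul (by positivity)]
    have : x / (2 * Real.pi) * (8 * Real.pi / x) = 2 ^ 2 := by field_simp; norm_num
    rw [this, Real.sqrt_sq (by norm_num)]
  have hwx : w ≤ x := by
    rw [hw]
    refine Real.sqrt_le_iff.2 ⟨hx0.le, ?_⟩
    rw [div_le_iff₀ (by positivity)]
    nlinarith [Real.pi_gt_three, mul_self_nonneg x]
  have hw0 : 0 ≤ w := Real.sqrt_nonneg _
  set r : ℝ → ℂ := fun θ =>
    1 - (∑ i ∈ Finset.range n, c i * s θ ^ i) * deriv s θ with hr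
  have hint : ∀ i, IntervalIntegrable
      (fun θ : ℝ => c i * (s θ ^ i * gaussKernel x (s θ) * deriv s θ))
      MeasureTheory.volume (-δ) δ := fun i => by
    have hcont := (differentiable_gaussKernel x).continuous
    exact (hδ.intervalIntegrable (φ := fun w => w ^ i * gaussKernel x w) (by fun_prop)).const_mul _
  have hrint : IntervalIntegrable (fun θ : ℝ => gaussKernel x (s θ) * r θ)
      MeasureTheory.volume (-δ) δ := by
    refine ContinuousOn.intervalIntegrable ?_
    rw [Set.uIcc_of_le hδ.neg_le_self]
    refine ((differentiable_gaussKernel x).continuous.comp_continuousOn hδ.continuousOn_comp).mul ?_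
    refine continuousOn_const.sub (ContinuousOn.mul ?_ hδ.continuousOn_deriv)
    exact continuousOn_finsetSum _ fun i _ => continuousOn_const.mul (hδ.continuousOn_comp.pow i)
  have hsplit : ∫ θ : ℝ in (-δ)..δ, Complex.exp (-x * h θ) =
      ∑ i ∈ Finset.range n, c i * IsNearIdentity.moment s δ i x +
        ∫ θ : ℝ in (-δ)..δ, gaussKernel x (s θ) * r θ := by
    have : ∀ i ∈ Finset.range n, c i * IsNearIdentity.moment s δ i x =
        ∫ θ : ℝ in (-δ)..δ, c i * (s θ ^ i * gaussKernel x (s θ) * deriv s θ) := fun i _ => by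
      rw [intervalIntegral.integral_const_mul, IsNearIdentity.moment]
    rw [Finset.sum_congr rfl this, ← intervalIntegral.integral_finsetSum fun i _ => hint i,
      ← intervalIntegral.integral_add _ hrint]
    · refine intervalIntegral.integral_congr fun θ hθ => ?_
      rw [Set.uIcc_of_le hδ.neg_le_self] at hθ
      have hθ' : ‖(θ : ℂ)‖ ≤ δ := by rw [Complex.norm_real]; exact abs_le.2 hθ
      have e1 : Complex.exp (-x * h θ) = gaussKernel x (s θ) := by
        rw [gaussKernel, hhδ θ hθ']
        congr 1
        push_cast
        ring
      have e2 : ∑ i ∈ Finset.range n, c i * (s θ ^ i * gaussKernel x (s θ) * deriv s θ) =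
          gaussKernel x (s θ) * ((∑ i ∈ Finset.range n, c i * s θ ^ i) * deriv s θ) := by
        rw [Finset.sum_mul, Finset.mul_sum]
        exact Finset.sum_congr rfl fun i _ => by ring
      simp only [e1, e2, hr]
      ring
    · simpa only [Finset.sum_fn] using IntervalIntegrable.sum (Finset.range n) fun i _ => hint i
  have hmain : ∑ l ∈ Finset.range (N + 1), c (2 * l) * (gaussMoment l : ℂ) / (x : ℂ) ^ l =
      (w : ℂ) * ∑ i ∈ Finset.range n, c i * (IsNearIdentity.fullMoment x i : ℂ) := by
    rw [IsNearIdentity.sum_range_fullMoment, ← mul_assoc, ← Complex.ofReal_mul, hw1,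
      Complex.ofReal_one, one_mul]
  have hrem : ‖∫ θ : ℝ in (-δ)..δ, gaussKernel x (s θ) * r θ‖ ≤
      K * ((Nat.factorial (N + 1) : ℝ) * (8 / x) ^ (N + 1) * √(8 * Real.pi / x)) := by
    calc ‖∫ θ : ℝ in (-δ)..δ, gaussKernel x (s θ) * r θ‖
        ≤ ∫ θ : ℝ in (-δ)..δ, K * (|θ| ^ (2 * (N + 1)) * Real.exp (-(x / 4) * θ ^ 2)) := by
          refine intervalIntegral.norm_integral_le_of_norm_le hδ.neg_le_self
            (Eventually.of_forall fun θ hθ => ?_) (Continuous.intervalIntegrable (by fun_prop) _ _)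
          have hθ1 : |θ| ≤ δ := abs_le.2 ⟨hθ.1.le, hθ.2⟩
          have hθ' : ‖(θ : ℂ)‖ ≤ δ := by rwa [Complex.norm_real]
          have k1 := hKδ θ hθ'
          rw [Complex.norm_real, Real.norm_eq_abs] at k1
          have k2 : ‖gaussKernel x (s θ)‖ ≤ Real.exp (-(x / 4) * θ ^ 2) := by
            rw [norm_gaussKernel]
            refine Real.exp_le_exp.2 ?_
            have := hδ.re_sq_ge hθ1
            nlinarith
          rw [norm_mul, mul_comm, ← mul_assoc]
          exact mul_le_mul k1 k2 (norm_nonneg _) (by positivity)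
      _ ≤ _ := by
          rw [intervalIntegral.integral_const_mul]
          exact mul_le_mul_of_nonneg_left (integral_pow_mul_exp_le hδ0 hx0 (N + 1)) hK0
  have htotal : (w : ℂ) * (∫ θ : ℝ in (-δ)..δ, Complex.exp (-x * h θ)) -
      ∑ l ∈ Finset.range (N + 1), c (2 * l) * (gaussMoment l : ℂ) / (x : ℂ) ^ l =
      (w : ℂ) * (∑ i ∈ Finset.range n,
        c i * (IsNearIdentity.moment s δ i x - (IsNearIdentity.fullMoment x i : ℂ))) +
      (w : ℂ) * ∫ θ : ℝ in (-δ)..δ, gaussKernel x (s θ) * r θ := by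
    rw [hsplit, hmain]
    simp only [mul_sub, Finset.sum_sub_distrib]
    ring
  rw [htotal, add_div]
  refine (norm_add_le _ _).trans (add_le_add ?_ ?_)
  · rw [norm_mul, Complex.norm_real, Real.norm_of_nonneg hw0]
    have hsum : ‖∑ i ∈ Finset.range n,
        c i * (IsNearIdentity.moment s δ i x - (IsNearIdentity.fullMoment x i : ℂ))‖ ≤
        (∑ i ∈ Finset.range n, ‖c i‖ * Cm i) * Real.exp (-(δ ^ 2 / 8) * x) := by
      rw [Finset.sum_mul]
      refine norm_sum_le_of_le _ fun i _ => ?_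
      rw [norm_mul, mul_assoc]
      exact mul_le_mul_of_nonneg_left (hCm i x hx) (norm_nonneg _)
    have hS : 0 ≤ ∑ i ∈ Finset.range n, ‖c i‖ * Cm i :=
      Finset.sum_nonneg fun i _ => mul_nonneg (norm_nonneg _) (hCm0 i)
    calc _ ≤ x * ((∑ i ∈ Finset.range n, ‖c i‖ * Cm i) * Real.exp (-(δ ^ 2 / 8) * x)) := by gcongr
      _ = (∑ i ∈ Finset.range n, ‖c i‖ * Cm i) * (x * Real.exp (-(δ ^ 2 / 8) * x)) := by ring
      _ ≤ (∑ i ∈ Finset.range n, ‖c i‖ * Cm i) * (Ce / x ^ (N + 1)) :=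
          mul_le_mul_of_nonneg_left (hCe x hx) hS
      _ = _ := by ring
  · rw [norm_mul, Complex.norm_real, Real.norm_of_nonneg hw0]
    calc _ ≤ w * (K * ((Nat.factorial (N + 1) : ℝ) * (8 / x) ^ (N + 1) * √(8 * Real.pi / x))) := by
          gcongr
      _ = (w * √(8 * Real.pi / x)) * K * ((Nat.factorial (N + 1) : ℝ) * (8 / x) ^ (N + 1)) := by
          ring
      _ = _ := by rw [hw2, div_pow]; ring

/-! ### Stirling's series -/

/-- The integrand in `Γ(x + 1) = x ^ (x + 1) e ^ (-x) ∫ (τ e ^ (1 - τ)) ^ x dτ`. -/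
noncomputable def stirlingKernel (x τ : ℝ) : ℝ := Real.exp (x * (Real.log τ + 1 - τ))

theorem stirlingKernel_eq {x τ : ℝ} (hτ : 0 < τ) :
    stirlingKernel x τ = Real.exp x * (τ ^ x * Real.exp (-(x * τ))) := by
  rw [stirlingKernel, Real.rpow_def_of_pos hτ, ← Real.exp_add, ← Real.exp_add]
  congr 1
  ring

theorem integrableOn_stirlingKernel {x : ℝ} (hx : 0 < x) :
    MeasureTheory.IntegrableOn (stirlingKernel x) (Set.Ioi 0) := by
  have h := (integrableOn_rpow_mul_exp_neg_mul_rpow (p := 1) (s := x) (b := x) (by linarith)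
    one_pos hx).const_mul (Real.exp x)
  refine MeasureTheory.IntegrableOn.congr_fun h (fun τ hτ => ?_) measurableSet_Ioi
  simp only [Real.rpow_one, neg_mul]
  exact (stirlingKernel_eq hτ).symm

theorem stirlingRatio_eq_integral {x : ℝ} (hx : 0 < x) :
    stirlingRatio x = √(x / (2 * Real.pi)) * ∫ τ in Set.Ioi (0 : ℝ), stirlingKernel x τ := by
  have h1 : ∫ τ in Set.Ioi (0 : ℝ), stirlingKernel x τ =
      Real.exp x * ((1 / x) ^ (x + 1) * Real.Gamma (x + 1)) := by
    rw [← Real.integral_rpow_mul_exp_neg_mul_Ioi (by linarith) hx,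
      ← MeasureTheory.integral_const_mul]
    refine MeasureTheory.setIntegral_congr_fun measurableSet_Ioi fun τ hτ => ?_
    rw [add_sub_cancel_right]
    exact stirlingKernel_eq hτ
  have hpi := Real.pi_pos
  have h2 : √(x / (2 * Real.pi)) * √(2 * Real.pi * x) = x := by
    rw [← Real.sqrt_mul (by positivity)]
    have : x / (2 * Real.pi) * (2 * Real.pi * x) = x ^ 2 := by field_simp
    rw [this, Real.sqrt_sq hx.le]
  have h3 : (0 : ℝ) < √(2 * Real.pi * x) := Real.sqrt_pos.2 (by positivity)
  have h4 : 0 < x ^ x := Real.rpow_pos_of_pos hx x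
  have h5 : (1 / x) ^ (x + 1) = 1 / (x ^ x * x) := by
    rw [Real.div_rpow zero_le_one hx.le, Real.one_rpow, Real.rpow_add_one hx.ne']
  rw [h1, h5, stirlingRatio, div_eq_iff (by positivity)]
  calc Real.Gamma (x + 1) * Real.exp x
      = x * (Real.exp x * (1 / (x ^ x * x) * Real.Gamma (x + 1))) * x ^ x := by field_simp
    _ = √(x / (2 * Real.pi)) * √(2 * Real.pi * x) *
          (Real.exp x * (1 / (x ^ x * x) * Real.Gamma (x + 1))) * x ^ x := by rw [h2]
    _ = _ := by ring

/-- The tangent to log at 1 + η. The sign condition puts τ beyond 1 + η as seen from the maximum at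
1. -/
theorem log_add_one_sub_le {η τ : ℝ} (hη : -1 < η) (hτ : 0 < τ) (h : 0 ≤ (τ - (1 + η)) * η) :
    Real.log τ + 1 - τ ≤ Real.log (1 + η) - η := by
  have h0 : 0 < 1 + η := by linarith
  have h1 := Real.log_le_sub_one_of_pos (div_pos hτ h0)
  rw [Real.log_div hτ.ne' h0.ne'] at h1
  have h2 : τ - η - τ / (1 + η) = (τ - (1 + η)) * η / (1 + η) := by field_simp; ring
  have h3 : 0 ≤ (τ - (1 + η)) * η / (1 + η) := div_nonneg h h0.le
  linarith

theorem exists_log_add_one_sub_le {δ : ℝ} (hδ : 0 < δ) (hδ1 : δ < 1) :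
    ∃ κ : ℝ, 0 < κ ∧ ∀ τ : ℝ, 0 < τ → δ ≤ |τ - 1| → Real.log τ + 1 - τ ≤ -κ := by
  have h1 := Real.log_lt_sub_one_of_pos (x := 1 + δ) (by linarith) (by linarith)
  have h2 := Real.log_lt_sub_one_of_pos (x := 1 + -δ) (by linarith) (by linarith)
  refine ⟨min (δ - Real.log (1 + δ)) (-δ - Real.log (1 + -δ)),
    lt_min (by linarith) (by linarith), fun τ hτ h => ?_⟩
  rcases le_abs'.1 h with h | h
  · have h3 := log_add_one_sub_le (η := -δ) (by linarith) hτ (by nlinarith)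
    linarith [min_le_right (δ - Real.log (1 + δ)) (-δ - Real.log (1 + -δ))]
  · have h3 := log_add_one_sub_le (η := δ) (by linarith) hτ (by nlinarith)
    linarith [min_le_left (δ - Real.log (1 + δ)) (-δ - Real.log (1 + -δ))]

/-- Away from 1 the exponent is at most -κ. Spending x - 1 copies of it on this bound leaves the
kernel with x = 1, which is integrable. -/
theorem exists_stirlingKernel_tail_le {δ : ℝ} (hδ : 0 < δ) (hδ1 : δ < 1) :
    ∃ κ C : ℝ, 0 < κ ∧ 0 ≤ C ∧ ∀ x : ℝ, 1 ≤ x →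
      |(∫ τ in Set.Ioi (0 : ℝ), stirlingKernel x τ) -
        ∫ w in (-δ)..δ, stirlingKernel x (1 + w)| ≤ C * Real.exp (-κ * x) := by
  obtain ⟨κ, hκ, hκle⟩ := exists_log_add_one_sub_le hδ hδ1
  have hpos : ∀ x τ, 0 ≤ stirlingKernel x τ := fun x τ => (Real.exp_pos _).le
  have hi1 := integrableOn_stirlingKernel one_pos
  refine ⟨κ, Real.exp κ * ∫ τ in Set.Ioi (0 : ℝ), stirlingKernel 1 τ, hκ,
    mul_nonneg (Real.exp_pos _).le (MeasureTheory.integral_nonneg fun τ => hpos 1 τ),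
    fun x hx => ?_⟩
  have hi := integrableOn_stirlingKernel (by linarith : 0 < x)
  have hsub : Set.Ioc (1 + -δ) (1 + δ) ⊆ Set.Ioi (0 : ℝ) := fun τ hτ => by
    have := hτ.1
    simp only [Set.mem_Ioi]
    linarith
  rw [intervalIntegral.integral_comp_add_left (stirlingKernel x) 1,
    intervalIntegral.integral_of_le (by linarith),
    ← MeasureTheory.setIntegral_sdiff measurableSet_Ioc hi hsub,
    abs_of_nonneg (MeasureTheory.integral_nonneg fun τ => hpos x τ)]
  have hd : MeasurableSet (Set.Ioi (0 : ℝ) \ Set.Ioc (1 + -δ) (1 + δ)) :=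
    measurableSet_Ioi.diff measurableSet_Ioc
  calc ∫ τ in Set.Ioi (0 : ℝ) \ Set.Ioc (1 + -δ) (1 + δ), stirlingKernel x τ
      ≤ ∫ τ in Set.Ioi (0 : ℝ) \ Set.Ioc (1 + -δ) (1 + δ),
          Real.exp (-κ * (x - 1)) * stirlingKernel 1 τ := by
        refine MeasureTheory.setIntegral_mono_on (hi.mono_set Set.sdiff_subset)
          ((hi1.mono_set Set.sdiff_subset).const_mul _) hd fun τ hτ => ?_
        have hτ0 : 0 < τ := hτ.1
        have hτ1 : δ ≤ |τ - 1| := by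
          have := hτ.2
          rw [Set.mem_Ioc, not_and_or, not_lt, not_le] at this
          rcases this with h | h
          · exact le_abs'.2 (Or.inl (by linarith))
          · exact le_abs'.2 (Or.inr (by linarith))
        rw [stirlingKernel, stirlingKernel, ← Real.exp_add]
        refine Real.exp_le_exp.2 ?_
        have := hκle τ hτ0 hτ1
        nlinarith
    _ = Real.exp (-κ * (x - 1)) *
          ∫ τ in Set.Ioi (0 : ℝ) \ Set.Ioc (1 + -δ) (1 + δ), stirlingKernel 1 τ :=
        MeasureTheory.integral_const_mul _ _
    _ ≤ Real.exp (-κ * (x - 1)) * ∫ τ in Set.Ioi (0 : ℝ), stirlingKernel 1 τ := by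
        refine mul_le_mul_of_nonneg_left ?_ (Real.exp_pos _).le
        exact MeasureTheory.setIntegral_mono_set hi1
          (Eventually.of_forall fun τ => hpos 1 τ) (Eventually.of_forall Set.sdiff_subset)
    _ = _ := by
        have : Real.exp (-κ * (x - 1)) = Real.exp κ * Real.exp (-κ * x) := by
          rw [← Real.exp_add]; congr 1; ring
        rw [this]
        ring

theorem sqrt_div_two_pi_le {x : ℝ} (hx : 1 ≤ x) : √(x / (2 * Real.pi)) ≤ x := by
  refine Real.sqrt_le_iff.2 ⟨by linarith, ?_⟩
  rw [div_le_iff₀ (by positivity)]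
  nlinarith [Real.pi_gt_three, mul_self_nonneg x]

/-- The phase `w - log (1 + w)` of Euler's integral. -/
noncomputable def gammaPhase (w : ℂ) : ℂ := w - Complex.log (1 + w)

theorem analyticAt_gammaPhase : AnalyticAt ℂ gammaPhase 0 := by
  unfold gammaPhase
  refine analyticAt_id.sub ((analyticAt_const.add analyticAt_id).clog ?_)
  simp

theorem eventually_hasDerivAt_gammaPhase :
    ∀ᶠ w in 𝓝 (0 : ℂ), HasDerivAt gammaPhase (1 - (1 + w)⁻¹) w := by
  have h : ∀ᶠ w in 𝓝 (0 : ℂ), 1 + w ∈ Complex.slitPlane :=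
    (continuous_const.add continuous_id).continuousAt.eventually_mem
      (Complex.isOpen_slitPlane.mem_nhds (by simp))
  filter_upwards [h] with w hw
  have h1 : HasDerivAt (fun w : ℂ => 1 + w) 1 w := (hasDerivAt_id w).const_add 1
  have h2 := h1.clog hw
  rw [one_div] at h2
  exact (hasDerivAt_id w).sub h2

theorem deriv_gammaPhase_zero : deriv gammaPhase 0 = 0 := by
  have := eventually_hasDerivAt_gammaPhase.self_of_nhds.deriv
  simpa using this

theorem iteratedDeriv_two_gammaPhase : iteratedDeriv 2 gammaPhase 0 = 1 := by
  rw [iteratedDeriv_succ, iteratedDeriv_one]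
  have h1 : deriv gammaPhase =ᶠ[𝓝 0] fun w => 1 - (1 + w)⁻¹ := by
    filter_upwards [eventually_hasDerivAt_gammaPhase] with w hw using hw.deriv
  rw [h1.deriv_eq]
  have h2 : HasDerivAt (fun w : ℂ => 1 + w) 1 0 := (hasDerivAt_id (0 : ℂ)).const_add 1
  have h3 := (h2.inv (by simp)).const_sub 1
  have := h3.deriv
  simpa using this

theorem cexp_neg_mul_gammaPhase {x w : ℝ} (hw : 0 ≤ 1 + w) :
    Complex.exp (-x * gammaPhase w) = (stirlingKernel x (1 + w) : ℂ) := by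
  have : Complex.log (1 + (w : ℂ)) = (Real.log (1 + w) : ℂ) := by
    rw [Complex.ofReal_log hw]; push_cast; rfl
  rw [gammaPhase, this, stirlingKernel]
  push_cast
  congr 1
  ring

theorem exists_lt_one_and_norm_laplace_sub_le {h s ρ : ℂ → ℂ} (hs : AnalyticAt ℂ s 0)
    (h0 : s 0 = 0) (h1 : deriv s 0 = 1) (hρ : AnalyticAt ℂ ρ 0)
    (hρs : ∀ᶠ z in 𝓝 0, ρ (s z) = z) (hh : ∀ᶠ z in 𝓝 0, s z ^ 2 = 2 * h z) (N : ℕ) :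
    ∃ δ : ℝ, 0 < δ ∧ δ < 1 ∧ ∃ C : ℝ, ∀ x : ℝ, 1 ≤ x →
      ‖((√(x / (2 * Real.pi)) : ℝ) : ℂ) * (∫ θ : ℝ in (-δ)..δ, Complex.exp (-x * h θ)) -
        ∑ l ∈ Finset.range (N + 1),
          taylorCoeff (deriv ρ) (2 * l) * (gaussMoment l : ℂ) / (x : ℂ) ^ l‖ ≤ C / x ^ (N + 1) := by
  obtain ⟨δ, hδ, hδ2⟩ := ((eventually_exists_norm_laplace_sub_le hs h0 h1 hρ hρs hh N).and
    (Ioo_mem_nhdsGT (zero_lt_one' ℝ))).exists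
  exact ⟨δ, hδ2.1, hδ2.2, hδ⟩

theorem deriv_div_self_zero {q : ℂ → ℂ} (hq : AnalyticAt ℂ q 0) (hq0 : q 0 = 1) :
    AnalyticAt ℂ (fun z => z / q z) 0 ∧ deriv (fun z => z / q z) 0 = 1 := by
  refine ⟨analyticAt_id.fun_div hq (by simp [hq0]), ?_⟩
  have := ((hasDerivAt_id (0 : ℂ)).fun_div hq.differentiableAt.hasDerivAt (by simp [hq0])).deriv
  simpa [hq0] using this

theorem exists_stirlingRatio_expansion :
    ∃ d : ℕ → ℝ, ∀ N : ℕ, ∃ C : ℝ, ∀ x : ℝ, 1 ≤ x →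
      |stirlingRatio x - ∑ l ∈ Finset.range (N + 1), d l / x ^ l| ≤ C / x ^ (N + 1) := by
  obtain ⟨q, ρ, hqa, hq0, hρa, -, -, -, hinv, hsq⟩ :=
    exists_normal_form analyticAt_gammaPhase (by simp [gammaPhase]) deriv_gammaPhase_zero
      iteratedDeriv_two_gammaPhase
  obtain ⟨hsa, hs1⟩ := deriv_div_self_zero hqa hq0
  -- The coefficients depend on ρ only, not on N, although δ and the constants may. Real parts
  -- suffice because the integral is real.
  refine ⟨fun l => (taylorCoeff (deriv ρ) (2 * l) * (gaussMoment l : ℂ)).re, fun N => ?_⟩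
  obtain ⟨δ, hδ, hδ1, C₁, hC₁⟩ := exists_lt_one_and_norm_laplace_sub_le hsa (by simp) hs1 hρa
    hinv hsq N
  obtain ⟨κ, C₂, hκ, hC₂0, hC₂⟩ := exists_stirlingKernel_tail_le hδ hδ1
  obtain ⟨C₃, hC₃0, hC₃⟩ := exists_mul_exp_neg_le hκ (N + 1)
  refine ⟨C₂ * C₃ + C₁, fun x hx => ?_⟩
  have hx0 : 0 < x := by linarith
  set w := √(x / (2 * Real.pi)) with hw
  have hw0 : 0 ≤ w := Real.sqrt_nonneg _
  have h1 : (∫ θ : ℝ in (-δ)..δ, Complex.exp (-x * gammaPhase θ)) =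
      ((∫ θ : ℝ in (-δ)..δ, stirlingKernel x (1 + θ) : ℝ) : ℂ) := by
    rw [← intervalIntegral.integral_ofReal]
    refine intervalIntegral.integral_congr fun θ hθ => ?_
    rw [Set.uIcc_of_le (by linarith)] at hθ
    exact cexp_neg_mul_gammaPhase (by linarith [hθ.1])
  have h2 := hC₁ x hx
  rw [h1] at h2
  have h3 := (Complex.abs_re_le_norm _).trans h2
  rw [Complex.sub_re, ← Complex.ofReal_mul, Complex.ofReal_re, Complex.re_sum] at h3
  have h4 : ∀ l ∈ Finset.range (N + 1),
      (taylorCoeff (deriv ρ) (2 * l) * (gaussMoment l : ℂ) / (x : ℂ) ^ l).re =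
      (taylorCoeff (deriv ρ) (2 * l) * (gaussMoment l : ℂ)).re / x ^ l := fun l _ => by
    rw [← Complex.ofReal_pow, Complex.div_ofReal_re]
  rw [Finset.sum_congr rfl h4] at h3
  have h5 : stirlingRatio x - ∑ l ∈ Finset.range (N + 1),
      (taylorCoeff (deriv ρ) (2 * l) * (gaussMoment l : ℂ)).re / x ^ l =
      w * ((∫ τ in Set.Ioi (0 : ℝ), stirlingKernel x τ) -
        ∫ θ in (-δ)..δ, stirlingKernel x (1 + θ)) +
      (w * (∫ θ in (-δ)..δ, stirlingKernel x (1 + θ)) - ∑ l ∈ Finset.range (N + 1),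
        (taylorCoeff (deriv ρ) (2 * l) * (gaussMoment l : ℂ)).re / x ^ l) := by
    rw [stirlingRatio_eq_integral hx0]
    ring
  rw [h5, add_div]
  refine (abs_add_le _ _).trans (add_le_add ?_ h3)
  rw [abs_mul, abs_of_nonneg hw0]
  calc _ ≤ x * (C₂ * Real.exp (-κ * x)) :=
        mul_le_mul (sqrt_div_two_pi_le hx) (hC₂ x hx) (abs_nonneg _) hx0.le
    _ = C₂ * (x * Real.exp (-κ * x)) := by ring
    _ ≤ C₂ * (C₃ / x ^ (N + 1)) := mul_le_mul_of_nonneg_left (hC₃ x hx) hC₂0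
    _ = _ := by ring

/-- An asymptotic expansion determines its coefficients: by strong induction each limit defining
`stirlingCoeff` exists and equals the coefficient found above, so `limUnder` has no default value
here. -/
theorem exists_abs_stirlingRatio_sub_le (N : ℕ) : ∃ C : ℝ, ∀ x : ℝ, 1 ≤ x →
    |stirlingRatio x - ∑ l ∈ Finset.range (N + 1), stirlingCoeff l / x ^ l| ≤ C / x ^ (N + 1) := by
  obtain ⟨d, hd⟩ := exists_stirlingRatio_expansion
  have key : ∀ n, stirlingCoeff n = d n := by
    intro n
    induction n using Nat.strong_induction_on with
    | _ n ih =>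
      rw [stirlingCoeff]
      refine Filter.Tendsto.limUnder_eq ?_
      obtain ⟨C, hC⟩ := hd n
      rw [tendsto_iff_norm_sub_tendsto_zero]
      refine squeeze_zero' (g := fun x => C / x) (Eventually.of_forall fun x => norm_nonneg _) ?_
        (tendsto_const_nhds.div_atTop tendsto_id)
      filter_upwards [eventually_ge_atTop 1] with x hx
      have hx0 : 0 < x := by linarith
      have h1 : ∑ j : Fin n, stirlingCoeff (j : ℕ) / x ^ (j : ℕ) =
          ∑ j ∈ Finset.range n, d j / x ^ j := by
        rw [← Fin.sum_univ_eq_sum_range fun j => d j / x ^ j]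
        exact Finset.sum_congr rfl fun j _ => by rw [ih j j.2]
      have h2 := hC x hx
      rw [Finset.sum_range_succ] at h2
      have h3 : x ^ n * (stirlingRatio x - ∑ j ∈ Finset.range n, d j / x ^ j) - d n =
          x ^ n * (stirlingRatio x - (∑ j ∈ Finset.range n, d j / x ^ j + d n / x ^ n)) := by
        field_simp
        ring
      rw [h1, h3, Real.norm_eq_abs, abs_mul, abs_of_pos (by positivity)]
      calc _ ≤ x ^ n * (C / x ^ (n + 1)) := by gcongr
        _ = C / x := by rw [pow_succ]; field_simp
  simp only [key]
  exact hd N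

/-! ### The reciprocal of the Stirling ratio as an integral over the unit circle -/

theorem periodic_cexp_neg_mul_phase (k : ℕ) :
    Function.Periodic (fun θ : ℝ => Complex.exp (-k * phase θ)) (2 * Real.pi) := by
  intro θ
  have h1 : Complex.exp (Complex.I * ((θ + 2 * Real.pi : ℝ) : ℂ)) =
      Complex.exp (Complex.I * θ) := by
    rw [← Complex.exp_periodic (Complex.I * θ)]
    congr 1
    push_cast
    ring
  simp only [phase, h1]
  refine Complex.exp_eq_exp_iff_exists_int.2 ⟨-k, ?_⟩
  push_cast
  ring

/-- Cauchy's formula on |z| = 1 for the k-th Taylor coefficient of e^{kz}, whose saddle point is z =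
1. -/
theorem integral_cexp_neg_mul_phase (k : ℕ) :
    ∫ θ : ℝ in (-Real.pi)..Real.pi, Complex.exp (-k * phase θ) =
      2 * Real.pi * (k ^ k * Complex.exp (-k) / (Nat.factorial k : ℂ)) := by
  have h1 := DifferentiableOn.circleIntegral_one_div_sub_center_pow_smul (R := 1) (c := (0 : ℂ))
    (f := fun z => Complex.exp (k * z)) one_pos k (by fun_prop)
  have h2 : iteratedDeriv k (fun z : ℂ => Complex.exp (k * z)) 0 = k ^ k := by
    rw [iteratedDeriv_cexp_const_mul]
    simp
  have h3 : ∀ θ : ℝ, deriv (circleMap 0 1) θ • ((1 / (circleMap 0 1 θ - 0) ^ (k + 1)) •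
      Complex.exp (k * circleMap 0 1 θ)) =
      Complex.I * Complex.exp k * Complex.exp (-k * phase θ) := by
    intro θ
    have hz : circleMap 0 1 θ = Complex.exp (Complex.I * θ) := by
      rw [circleMap_zero, Complex.ofReal_one, one_mul, mul_comm]
    rw [deriv_circleMap, hz, sub_zero, one_div, smul_eq_mul, smul_eq_mul, ← Complex.exp_nat_mul,
      ← Complex.exp_neg]
    have h4 : Complex.exp (Complex.I * θ) * (Complex.exp (-(((k + 1 : ℕ) : ℂ) * (Complex.I * θ))) *
        Complex.exp (k * Complex.exp (Complex.I * θ))) =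
        Complex.exp k * Complex.exp (-k * phase θ) := by
      rw [← Complex.exp_add, ← Complex.exp_add, ← Complex.exp_add, phase]
      congr 1
      push_cast
      ring
    rw [mul_assoc Complex.I, ← h4]
    ring
  rw [circleIntegral] at h1
  simp only [h3] at h1
  rw [intervalIntegral.integral_const_mul, h2] at h1
  have h5 := (periodic_cexp_neg_mul_phase k).intervalIntegral_add_eq 0 (-Real.pi)
  rw [show -Real.pi + 2 * Real.pi = Real.pi by ring, zero_add] at h5
  rw [h5] at h1
  have h6 : Complex.exp (-k : ℂ) * Complex.exp k = 1 := by
    rw [← Complex.exp_add]; simp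
  rw [smul_eq_mul] at h1
  have hI := Complex.I_ne_zero
  have h7 : Complex.exp k * ∫ θ : ℝ in (-Real.pi)..Real.pi, Complex.exp (-k * phase θ) =
      2 * Real.pi / (Nat.factorial k : ℂ) * k ^ k := by
    refine mul_left_cancel₀ hI ?_
    rw [← mul_assoc, h1]
    ring
  calc _ = Complex.exp (-k : ℂ) * (Complex.exp k *
        ∫ θ : ℝ in (-Real.pi)..Real.pi, Complex.exp (-k * phase θ)) := by
        rw [← mul_assoc, h6, one_mul]
    _ = _ := by rw [h7]; ring

theorem stirlingRatio_natCast (k : ℕ) :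
    stirlingRatio k = (Nat.factorial k : ℝ) * Real.exp k / ((k : ℝ) ^ k * √(2 * Real.pi * k)) := by
  rw [stirlingRatio, Real.Gamma_nat_eq_factorial, Real.rpow_natCast]

theorem stirlingRatio_natCast_mul {k : ℕ} (hk : 1 ≤ k) :
    (stirlingRatio k : ℂ) * (((√((k : ℝ) / (2 * Real.pi)) : ℝ) : ℂ) *
      ∫ θ : ℝ in (-Real.pi)..Real.pi, Complex.exp (-k * phase θ)) = 1 := by
  have hk0 : (0 : ℝ) < k := by exact_mod_cast hk
  have hpi := Real.pi_pos
  have h1 : √((k : ℝ) / (2 * Real.pi)) * (2 * Real.pi) = √(2 * Real.pi * k) := by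
    rw [← Real.sqrt_mul_self (by positivity : 0 ≤ 2 * Real.pi), ← Real.sqrt_mul (by positivity),
      Real.sqrt_mul_self (by positivity)]
    congr 1
    field_simp
  have h2 : (0 : ℝ) < √(2 * Real.pi * k) := Real.sqrt_pos.2 (by positivity)
  have h3 : stirlingRatio k * (√((k : ℝ) / (2 * Real.pi)) *
      (2 * Real.pi * ((k : ℝ) ^ k * Real.exp (-k) / (Nat.factorial k : ℝ)))) = 1 := by
    rw [← mul_assoc √((k : ℝ) / (2 * Real.pi)), h1, stirlingRatio_natCast, Real.exp_neg]
    have := Real.exp_pos k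
    have : (0 : ℝ) < (k : ℝ) ^ k := by positivity
    have : (0 : ℝ) < (Nat.factorial k : ℝ) := by positivity
    field_simp
  rw [integral_cexp_neg_mul_phase]
  have := congrArg (fun y : ℝ => (y : ℂ)) h3
  push_cast at this
  exact this

theorem norm_cexp_neg_mul_phase (k : ℕ) (θ : ℝ) :
    ‖Complex.exp (-k * phase θ)‖ = Real.exp (-k * (1 - Real.cos θ)) := by
  have h : phase θ = ((1 - Real.cos θ : ℝ) : ℂ) + ((θ - Real.sin θ : ℝ) : ℂ) * Complex.I := by
    rw [phase, mul_comm, Complex.exp_mul_I]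
    push_cast
    ring
  have h2 : (-k : ℂ) * phase θ = ((-k * (1 - Real.cos θ) : ℝ) : ℂ) +
      ((-k * (θ - Real.sin θ) : ℝ) : ℂ) * Complex.I := by
    rw [h]
    push_cast
    ring
  rw [Complex.norm_exp, h2, Complex.add_re, Complex.ofReal_re, Complex.re_ofReal_mul, Complex.I_re,
    mul_zero, add_zero]

/-- The modulus e^{-k(1-cos θ)} decreases with |θ| up to π, so outside [-δ, δ] its value at δ bounds
it. -/
theorem norm_integral_phase_sub_le {δ : ℝ} (hδ : 0 < δ) (hδ1 : δ < 1) (k : ℕ) :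
    ‖(∫ θ : ℝ in (-Real.pi)..Real.pi, Complex.exp (-k * phase θ)) -
      ∫ θ : ℝ in (-δ)..δ, Complex.exp (-k * phase θ)‖ ≤
        2 * Real.pi * Real.exp (-(1 - Real.cos δ) * k) := by
  have hpi := Real.pi_gt_three
  have hi : ∀ a b : ℝ, IntervalIntegrable (fun θ : ℝ => Complex.exp (-k * phase θ))
      MeasureTheory.volume a b := fun a b => by
    have := differentiable_phase.continuous
    exact Continuous.intervalIntegrable (by fun_prop) _ _
  have hsplit : (∫ θ : ℝ in (-Real.pi)..Real.pi, Complex.exp (-k * phase θ)) -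
      ∫ θ : ℝ in (-δ)..δ, Complex.exp (-k * phase θ) =
      (∫ θ : ℝ in (-Real.pi)..(-δ), Complex.exp (-k * phase θ)) +
        ∫ θ : ℝ in δ..Real.pi, Complex.exp (-k * phase θ) := by
    rw [← intervalIntegral.integral_add_adjacent_intervals (hi (-Real.pi) (-δ)) (hi (-δ) Real.pi),
      ← intervalIntegral.integral_add_adjacent_intervals (hi (-δ) δ) (hi δ Real.pi)]
    ring
  have hbd : ∀ θ : ℝ, δ ≤ |θ| → |θ| ≤ Real.pi →
      ‖Complex.exp (-k * phase θ)‖ ≤ Real.exp (-(1 - Real.cos δ) * k) := by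
    intro θ h1 h2
    rw [norm_cexp_neg_mul_phase]
    refine Real.exp_le_exp.2 ?_
    have h3 := Real.cos_le_cos_of_nonneg_of_le_pi hδ.le h2 h1
    rw [Real.cos_abs] at h3
    have : (0 : ℝ) ≤ k := Nat.cast_nonneg k
    nlinarith
  have b1 : ‖∫ θ : ℝ in (-Real.pi)..(-δ), Complex.exp (-k * phase θ)‖ ≤
      Real.exp (-(1 - Real.cos δ) * k) * |-δ - -Real.pi| :=
    intervalIntegral.norm_integral_le_of_norm_le_const fun θ hθ => by
      rw [Set.uIoc_of_le (by linarith)] at hθ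
      have : |θ| = -θ := abs_of_neg (by linarith [hθ.2])
      exact hbd θ (by linarith [hθ.2]) (by linarith [hθ.1])
  have b2 : ‖∫ θ : ℝ in δ..Real.pi, Complex.exp (-k * phase θ)‖ ≤
      Real.exp (-(1 - Real.cos δ) * k) * |Real.pi - δ| :=
    intervalIntegral.norm_integral_le_of_norm_le_const fun θ hθ => by
      rw [Set.uIoc_of_le (by linarith)] at hθ
      have : |θ| = θ := abs_of_pos (by linarith [hθ.1])
      exact hbd θ (by linarith [hθ.1]) (by linarith [hθ.2])
  rw [abs_of_nonneg (by linarith)] at b1 b2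
  rw [hsplit]
  refine (norm_add_le _ _).trans ((add_le_add b1 b2).trans ?_)
  nlinarith [Real.exp_pos (-(1 - Real.cos δ) * k)]

theorem exists_norm_inv_stirlingRatio_sub_le (N : ℕ) : ∃ C : ℝ, ∀ k : ℕ, 1 ≤ k →
    ‖((√((k : ℝ) / (2 * Real.pi)) : ℝ) : ℂ) *
        (∫ θ : ℝ in (-Real.pi)..Real.pi, Complex.exp (-k * phase θ)) -
      ∑ l ∈ Finset.range (N + 1),
        taylorCoeff (deriv mu) (2 * l) * (gaussMoment l : ℂ) / (k : ℂ) ^ l‖ ≤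
      C / (k : ℝ) ^ (N + 1) := by
  obtain ⟨q, hqa, hq0, hμa, -, -, hinv, hsq⟩ := exists_mu_normal_form
  obtain ⟨hsa, hs1⟩ := deriv_div_self_zero hqa hq0
  obtain ⟨δ, hδ, hδ1, C₁, hC₁⟩ := exists_lt_one_and_norm_laplace_sub_le hsa (by simp) hs1 hμa
    hinv hsq N
  have hcos : 0 < 1 - Real.cos δ := by
    have := Real.cos_lt_cos_of_nonneg_of_le_pi le_rfl (by linarith [Real.pi_gt_three]) hδ
    rw [Real.cos_zero] at this
    linarith
  obtain ⟨C₃, hC₃0, hC₃⟩ := exists_mul_exp_neg_le hcos (N + 1)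
  refine ⟨2 * Real.pi * C₃ + C₁, fun k hk => ?_⟩
  have hk1 : (1 : ℝ) ≤ k := by exact_mod_cast hk
  have h2 := hC₁ k hk1
  simp only [Complex.ofReal_natCast] at h2
  rw [add_div, ← sub_add_sub_cancel _ (((√((k : ℝ) / (2 * Real.pi)) : ℝ) : ℂ) *
    ∫ θ : ℝ in (-δ)..δ, Complex.exp (-k * phase θ))]
  refine (norm_add_le _ _).trans (add_le_add ?_ h2)
  rw [← mul_sub, norm_mul, Complex.norm_real, Real.norm_of_nonneg (Real.sqrt_nonneg _)]
  calc _ ≤ (k : ℝ) * (2 * Real.pi * Real.exp (-(1 - Real.cos δ) * k)) :=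
        mul_le_mul (sqrt_div_two_pi_le hk1) (norm_integral_phase_sub_le hδ hδ1 k) (norm_nonneg _)
          (by positivity)
    _ = 2 * Real.pi * (k * Real.exp (-(1 - Real.cos δ) * k)) := by ring
    _ ≤ 2 * Real.pi * (C₃ / (k : ℝ) ^ (N + 1)) :=
        mul_le_mul_of_nonneg_left (hC₃ k hk1) (by positivity)
    _ = _ := by ring

/-- Factors X are removed one at a time: while the bound leaves room, the cofactor at 1/k tends both
to its value at 0 and to 0. -/
theorem coeff_eq_zero_of_eval_inv_le {R : Polynomial ℂ} {N : ℕ} {C : ℝ}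
    (h : ∀ k : ℕ, 1 ≤ k → ‖R.eval ((k : ℂ)⁻¹)‖ ≤ C / (k : ℝ) ^ (N + 1)) {m : ℕ} (hm : m ≤ N) :
    R.coeff m = 0 := by
  have key : ∀ n ≤ N + 1, (Polynomial.X ^ n : Polynomial ℂ) ∣ R := by
    intro n
    induction n with
    | zero => intro _; simp
    | succ n ih =>
      intro hn
      obtain ⟨S, hS⟩ := ih (by omega)
      have hlim : Tendsto (fun k : ℕ => ((k : ℂ))⁻¹) atTop (𝓝 0) :=
        tendsto_inv_atTop_nhds_zero_nat (𝕜 := ℂ)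
      have h1 : Tendsto (fun k : ℕ => S.eval ((k : ℂ)⁻¹)) atTop (𝓝 (S.eval 0)) :=
        (S.continuous.tendsto 0).comp hlim
      have h2 : Tendsto (fun k : ℕ => S.eval ((k : ℂ)⁻¹)) atTop (𝓝 0) := by
        refine squeeze_zero_norm' (a := fun k : ℕ => |C| / (k : ℝ)) ?_
          (tendsto_const_nhds.div_atTop tendsto_natCast_atTop_atTop)
        filter_upwards [eventually_ge_atTop 1] with k hk
        have hk1 : (1 : ℝ) ≤ k := by exact_mod_cast hk
        have hk0 : (0 : ℝ) < k := by linarith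
        have h3 := h k hk
        rw [hS, Polynomial.eval_mul, Polynomial.eval_pow, Polynomial.eval_X, norm_mul, norm_pow,
          norm_inv, Complex.norm_natCast, inv_pow, inv_mul_le_iff₀ (by positivity)] at h3
        refine h3.trans ?_
        calc (k : ℝ) ^ n * (C / (k : ℝ) ^ (N + 1)) ≤ (k : ℝ) ^ n * (|C| / (k : ℝ) ^ (n + 1)) := by
              gcongr
              · exact le_abs_self C
          _ = |C| / k := by rw [pow_succ]; field_simp
      have h4 := tendsto_nhds_unique h1 h2
      have h5 : S.coeff 0 = 0 := by rw [Polynomial.coeff_zero_eq_eval_zero, h4]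
      obtain ⟨T, hT⟩ := Polynomial.X_dvd_iff.2 h5
      exact ⟨T, by rw [hS, hT]; ring⟩
  exact Polynomial.X_pow_dvd_iff.1 (key (N + 1) le_rfl) m (by omega)

/-- At x = k the Stirling ratio and the normalised circle integral multiply to exactly 1. Their
truncated expansions P and Q, as polynomials in 1/k, therefore satisfy PQ - 1 = O(k^{-(m+1)}), which
settles the coefficient of X^m. -/
theorem sum_stirlingCoeff_mul (m : ℕ) :
    ∑ l ∈ Finset.range (m + 1), (stirlingCoeff (m - l) : ℂ) *
      (taylorCoeff (deriv mu) (2 * l) * (gaussMoment l : ℂ)) = if m = 0 then 1 else 0 := by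
  set a : ℕ → ℂ := fun l => taylorCoeff (deriv mu) (2 * l) * (gaussMoment l : ℂ) with ha
  set P : Polynomial ℂ := ∑ i ∈ Finset.range (m + 1),
    Polynomial.C (stirlingCoeff i : ℂ) * Polynomial.X ^ i with hP
  set Q : Polynomial ℂ := ∑ i ∈ Finset.range (m + 1), Polynomial.C (a i) * Polynomial.X ^ i with hQ
  obtain ⟨C₁, hC₁⟩ := exists_abs_stirlingRatio_sub_le m
  obtain ⟨C₂, hC₂⟩ := exists_norm_inv_stirlingRatio_sub_le m
  have hPev : ∀ k : ℕ, P.eval ((k : ℂ)⁻¹) =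
      ((∑ l ∈ Finset.range (m + 1), stirlingCoeff l / (k : ℝ) ^ l : ℝ) : ℂ) := fun k => by
    rw [hP, Polynomial.eval_finsetSum]
    push_cast
    exact Finset.sum_congr rfl fun i _ => by simp [div_eq_mul_inv]
  have hQev : ∀ k : ℕ, Q.eval ((k : ℂ)⁻¹) =
      ∑ l ∈ Finset.range (m + 1), a l / (k : ℂ) ^ l := fun k => by
    rw [hQ, Polynomial.eval_finsetSum]
    exact Finset.sum_congr rfl fun i _ => by simp [div_eq_mul_inv]
  have hbound : ∀ k : ℕ, 1 ≤ k → ‖(P * Q - 1).eval ((k : ℂ)⁻¹)‖ ≤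
      (|C₁| * (∑ l ∈ Finset.range (m + 1), ‖a l‖) +
        ((∑ l ∈ Finset.range (m + 1), |stirlingCoeff l|) + |C₁|) * |C₂|) /
          (k : ℝ) ^ (m + 1) := by
    intro k hk
    have hk1 : (1 : ℝ) ≤ k := by exact_mod_cast hk
    set J : ℂ := ((√((k : ℝ) / (2 * Real.pi)) : ℝ) : ℂ) *
        (∫ θ : ℝ in (-Real.pi)..Real.pi, Complex.exp (-k * phase θ)) with hJ
    have hrJ : (stirlingRatio k : ℂ) * J = 1 := stirlingRatio_natCast_mul hk
    have hpow : (1 : ℝ) ≤ (k : ℝ) ^ (m + 1) := one_le_pow₀ hk1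
    have b1 : ‖P.eval ((k : ℂ)⁻¹) - stirlingRatio k‖ ≤ |C₁| / (k : ℝ) ^ (m + 1) := by
      rw [hPev, ← Complex.ofReal_sub, Complex.norm_real, Real.norm_eq_abs, abs_sub_comm]
      refine (hC₁ k hk1).trans ?_
      gcongr
      exact le_abs_self C₁
    have b2 : ‖Q.eval ((k : ℂ)⁻¹) - J‖ ≤ |C₂| / (k : ℝ) ^ (m + 1) := by
      rw [hQev, norm_sub_rev]
      refine (hC₂ k hk).trans ?_
      gcongr
      exact le_abs_self C₂
    have hdiv : ∀ (t : ℝ), 0 ≤ t → ∀ l, t / (k : ℝ) ^ l ≤ t := fun t ht l =>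
      div_le_self ht (one_le_pow₀ hk1)
    have b3 : ‖Q.eval ((k : ℂ)⁻¹)‖ ≤ ∑ l ∈ Finset.range (m + 1), ‖a l‖ := by
      rw [hQev]
      refine norm_sum_le_of_le _ fun l _ => ?_
      rw [norm_div, norm_pow, Complex.norm_natCast]
      exact hdiv _ (norm_nonneg _) l
    have b4 : ‖(stirlingRatio k : ℂ)‖ ≤
        (∑ l ∈ Finset.range (m + 1), |stirlingCoeff l|) + |C₁| := by
      rw [Complex.norm_real, Real.norm_eq_abs]
      have e1 : |∑ l ∈ Finset.range (m + 1), stirlingCoeff l / (k : ℝ) ^ l| ≤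
          ∑ l ∈ Finset.range (m + 1), |stirlingCoeff l| := by
        refine Finset.abs_sum_le_sum_abs _ _ |>.trans (Finset.sum_le_sum fun l _ => ?_)
        rw [abs_div, abs_of_pos (by positivity : (0 : ℝ) < (k : ℝ) ^ l)]
        exact hdiv _ (abs_nonneg _) l
      have e2 := (hC₁ k hk1).trans ((div_le_div_of_nonneg_right (le_abs_self C₁)
        (by positivity)).trans (hdiv _ (abs_nonneg C₁) (m + 1)))
      have e3 := abs_sub_abs_le_abs_sub (stirlingRatio k)
        (∑ l ∈ Finset.range (m + 1), stirlingCoeff l / (k : ℝ) ^ l)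
      linarith
    have e : (P * Q - 1).eval ((k : ℂ)⁻¹) =
        (P.eval ((k : ℂ)⁻¹) - stirlingRatio k) * Q.eval ((k : ℂ)⁻¹) +
          stirlingRatio k * (Q.eval ((k : ℂ)⁻¹) - J) := by
      rw [Polynomial.eval_sub, Polynomial.eval_mul, Polynomial.eval_one, ← hrJ]
      ring
    rw [e]
    calc _ ≤ |C₁| / (k : ℝ) ^ (m + 1) * (∑ l ∈ Finset.range (m + 1), ‖a l‖) +
          ((∑ l ∈ Finset.range (m + 1), |stirlingCoeff l|) + |C₁|) *
            (|C₂| / (k : ℝ) ^ (m + 1)) := by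
          refine (norm_add_le _ _).trans ?_
          rw [norm_mul, norm_mul]
          gcongr
      _ = _ := by ring
  have h0 := coeff_eq_zero_of_eval_inv_le hbound le_rfl
  rw [Polynomial.coeff_sub, Polynomial.coeff_one, sub_eq_zero] at h0
  rw [Polynomial.coeff_mul, Finset.Nat.sum_antidiagonal_eq_sum_range_succ_mk,
    ← Finset.sum_range_reflect] at h0
  rw [← Finset.sum_congr rfl fun l hl => ?_, h0]
  have hl' : l ≤ m := by simpa [Nat.lt_succ_iff] using hl
  have h1 : m + 1 - 1 - l = m - l := by omega
  have h2 : m - (m - l) = l := by omega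
  simp only [h1, h2]
  rw [hP, hQ, Polynomial.finsetSum_coeff, Polynomial.finsetSum_coeff]
  simp only [Polynomial.coeff_C_mul, Polynomial.coeff_X_pow, mul_ite, mul_one, mul_zero,
    Finset.sum_ite_eq, Finset.mem_range]
  rw [if_pos (by omega), if_pos (by omega)]

/-! ### The saddle-point coefficients -/

/-- `μ'(t) e^{ijμ(t)}`, the amplitude attached to the monomial `z ^ j`. -/
noncomputable def muAmplitude (j : ℕ) (t : ℂ) : ℂ :=
  deriv mu t * Complex.exp (Complex.I * mu t) ^ j

theorem analyticAt_cexp_mu : AnalyticAt ℂ (fun t => Complex.exp (Complex.I * mu t)) 0 := by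
  have := analyticAt_mu
  fun_prop

theorem analyticAt_muAmplitude (j : ℕ) : AnalyticAt ℂ (muAmplitude j) 0 :=
  analyticAt_mu.deriv.mul (analyticAt_cexp_mu.pow j)

theorem muAmplitude_zero : muAmplitude 0 = deriv mu := by
  funext t; simp [muAmplitude]

/-- The differential equation of μ in the form μ'(e^{iμ} - 1) = it. -/
theorem eventually_muAmplitude_succ (j : ℕ) : ∀ᶠ t in 𝓝 (0 : ℂ),
    muAmplitude (j + 1) t =
      muAmplitude j t + Complex.I * (t ^ 1 * Complex.exp (Complex.I * mu t) ^ j) := by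
  filter_upwards [eventually_eq_deriv_mu] with t ht
  have hI := Complex.I_mul_I
  set e := Complex.exp (Complex.I * mu t) with he
  have h1 : Complex.I * t = -(deriv mu t * (1 - e)) := by
    linear_combination Complex.I * ht + deriv mu t * (1 - e) * hI
  rw [muAmplitude, muAmplitude, ← he, pow_one, ← mul_assoc, h1]
  ring

theorem taylorCoeff_cexp_mu_pow_succ (j n : ℕ) :
    ((n : ℂ) + 1) * taylorCoeff (fun t => Complex.exp (Complex.I * mu t) ^ j) (n + 1) =
      Complex.I * j * taylorCoeff (muAmplitude j) n := by
  rw [← taylorCoeff_deriv, ← taylorCoeff_const_mul]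
  refine taylorCoeff_congr ?_ n
  filter_upwards [analyticAt_mu.eventually_analyticAt] with t ht
  have h1 : HasDerivAt (fun t => Complex.exp (Complex.I * mu t) ^ j)
      (j * Complex.exp (Complex.I * mu t) ^ (j - 1) *
        (Complex.exp (Complex.I * mu t) * (Complex.I * deriv mu t))) t :=
    ((ht.differentiableAt.hasDerivAt.const_mul Complex.I).cexp).fun_pow j
  rw [h1.deriv, muAmplitude]
  rcases j with _ | j
  · simp
  · rw [Nat.add_sub_cancel, pow_succ]
    ring

/-- The coefficients in the expansion of `√(x/2π) ∫ e^{ijθ} exp(-x (1 + iθ - e^{iθ})) dθ`. -/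
noncomputable def saddleMoment (j l : ℕ) : ℂ :=
  taylorCoeff (muAmplitude j) (2 * l) * (gaussMoment l : ℂ)

theorem saddleMoment_succ_zero (j : ℕ) : saddleMoment (j + 1) 0 = saddleMoment j 0 := by
  rw [saddleMoment, saddleMoment, taylorCoeff_zero, taylorCoeff_zero, muAmplitude, muAmplitude,
    mu_zero]
  simp

/-- The new term i t e^{ijμ} contributes i · ij/(2l+1) times the coefficient of order 2l of the
amplitude. The ratio 2l + 1 of consecutive Gaussian moments clears the denominator, leaving the
recursion of `fallingCoeff`. -/
theorem saddleMoment_succ_succ (j l : ℕ) :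
    saddleMoment (j + 1) (l + 1) = saddleMoment j (l + 1) - j * saddleMoment j l := by
  have ha := analyticAt_cexp_mu.fun_pow j
  have h1 : taylorCoeff (muAmplitude (j + 1)) (2 * (l + 1)) =
      taylorCoeff (muAmplitude j) (2 * (l + 1)) +
        Complex.I * taylorCoeff (fun t => Complex.exp (Complex.I * mu t) ^ j) (2 * l + 1) := by
    rw [taylorCoeff_congr (eventually_muAmplitude_succ j),
      taylorCoeff_add (analyticAt_muAmplitude j) (by fun_prop), taylorCoeff_const_mul,
      taylorCoeff_pow_mul ha, if_pos (by omega)]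
    rfl
  have h2 := taylorCoeff_cexp_mu_pow_succ j (2 * l)
  have hI := Complex.I_mul_I
  rw [saddleMoment, saddleMoment, saddleMoment, h1, gaussMoment_succ]
  push_cast at h2 ⊢
  linear_combination (Complex.I * (gaussMoment l : ℂ)) * h2 +
    (j * taylorCoeff (muAmplitude j) (2 * l) * (gaussMoment l : ℂ)) * hI

theorem sum_stirlingCoeff_mul_saddleMoment (m j : ℕ) :
    ∑ l ∈ Finset.range (m + 1), (stirlingCoeff (m - l) : ℂ) * saddleMoment j l =
      (fallingCoeff m j : ℂ) := by
  have h0 : ∀ m, ∑ l ∈ Finset.range (m + 1), (stirlingCoeff (m - l) : ℂ) * saddleMoment 0 l =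
      if m = 0 then 1 else 0 := fun m => by
    simp only [saddleMoment, muAmplitude_zero]
    exact sum_stirlingCoeff_mul m
  induction j generalizing m with
  | zero =>
    rw [h0]
    cases m <;> simp [fallingCoeff]
  | succ j ih =>
    cases m with
    | zero =>
      have := ih 0
      simp only [zero_add, Finset.sum_range_one] at this ⊢
      rw [saddleMoment_succ_zero, this]
      simp [fallingCoeff]
    | succ m =>
      have h1 := ih (m + 1)
      have h2 := ih m
      rw [Finset.sum_range_succ'] at h1 ⊢
      simp only [Nat.add_sub_add_right] at h1 ⊢
      simp only [saddleMoment_succ_zero, saddleMoment_succ_succ, mul_sub, Finset.sum_sub_distrib]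
      have h3 : ∑ l ∈ Finset.range (m + 1), (stirlingCoeff (m - l) : ℂ) * (j * saddleMoment j l) =
          j * (fallingCoeff m j : ℂ) := by
        rw [← h2, Finset.mul_sum]
        exact Finset.sum_congr rfl fun l _ => by ring
      rw [h3, fallingCoeff]
      rw [Nat.sub_zero] at h1 ⊢
      push_cast
      rw [← h1]
      ring

/-- The inner sum of `saddleCoeff` is Leibniz' rule for the product of Φ and μ'. -/
theorem sum_iteratedDeriv_mu_mul {Φ : ℂ → ℂ} (hΦ : AnalyticAt ℂ Φ 0) (j : ℕ) :
    ∑ n ∈ Finset.range (2 * j + 1),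
        iteratedDeriv (2 * j - n + 1) mu 0 / (Nat.factorial n * Nat.factorial (2 * j - n)) *
          iteratedDeriv n Φ 0 = taylorCoeff (fun t => Φ t * deriv mu t) (2 * j) := by
  rw [taylorCoeff_mul hΦ analyticAt_mu.deriv]
  refine Finset.sum_congr rfl fun n _ => ?_
  rw [taylorCoeff, taylorCoeff, ← iteratedDeriv_succ']
  rw [div_mul_eq_mul_div, div_mul_div_comm]
  ring

/-- Expanding the amplitude in powers of `z = v e^{iμ}`. -/
theorem hasSum_taylorCoeff_comp_mu {F : ℂ → ℂ} {R v : ℝ}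
    (hF : DifferentiableOn ℂ F (Metric.ball 0 R)) (hv : 0 < v) (hvR : v < R) (n : ℕ) :
    AnalyticAt ℂ (fun τ => F ((v : ℂ) * Complex.exp (Complex.I * mu τ))) 0 ∧
    HasSum (fun j => taylorCoeff F j * (v : ℂ) ^ j * taylorCoeff (muAmplitude j) n)
      (taylorCoeff (fun τ => F ((v : ℂ) * Complex.exp (Complex.I * mu τ)) * deriv mu τ) n) := by
  set f := taylorCoeff F with hf
  set e : ℂ → ℂ := fun τ => (v : ℂ) * Complex.exp (Complex.I * mu τ) with he
  have hea : AnalyticAt ℂ e 0 := analyticAt_const.mul analyticAt_cexp_mu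
  have he0 : e 0 = v := by simp [he, mu_zero]
  -- For small τ the point v e^{iμ(τ)} stays in |z| < r < R, where the Taylor series of F converges
  -- uniformly. Cauchy's estimate on |τ| = ε/2 carries this over to the n-th coefficients.
  obtain ⟨r, hvr, hrR⟩ := exists_between hvR
  have hr0 : 0 < r := hv.trans hvr
  have hv0 : ‖e 0‖ < r := by rw [he0, Complex.norm_real, Real.norm_of_nonneg hv.le]; exact hvr
  have hFd : ∀ w : ℂ, ‖w‖ < R → DifferentiableAt ℂ F w := fun w hw =>
    hF.differentiableAt (Metric.isOpen_ball.mem_nhds (mem_ball_zero_iff.2 hw))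
  have hFea : AnalyticAt ℂ (fun τ => F (e τ)) 0 :=
    (hF.analyticAt (Metric.isOpen_ball.mem_nhds
      (mem_ball_zero_iff.2 (hv0.trans hrR)))).fun_comp hea
  refine ⟨hFea, ?_⟩
  have hev : ∀ᶠ τ in 𝓝 (0 : ℂ), AnalyticAt ℂ mu τ ∧ ‖e τ‖ < r ∧
      ‖deriv mu τ‖ < ‖deriv mu 0‖ + 1 :=
    analyticAt_mu.eventually_analyticAt.and
      ((hea.continuousAt.norm.eventually_lt_const hv0).and
        (analyticAt_mu.deriv.continuousAt.norm.eventually_lt_const (lt_add_one _)))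
  obtain ⟨ε, hεP, hε0 : 0 < ε⟩ := ((eventually_forall_norm_le hev).and self_mem_nhdsWithin).exists
  set B := ‖deriv mu 0‖ + 1 with hB
  have hB0 : 0 ≤ B := by positivity
  have hsum : Summable fun j => ‖f j‖ * r ^ j := by
    have h1 := (hasSum_taylorCoeff_of_differentiableOn hF (z := (r : ℂ))
      (by rwa [Complex.norm_real, Real.norm_of_nonneg hr0.le])).summable.norm
    refine h1.congr fun j => ?_
    rw [norm_mul, norm_pow, Complex.norm_real, Real.norm_of_nonneg hr0.le]
  have hterm : ∀ j τ, f j * (v : ℂ) ^ j * muAmplitude j τ = f j * e τ ^ j * deriv mu τ := by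
    intro j τ
    simp only [he, muAmplitude, mul_pow]
    ring
  have hd : ∀ τ ∈ Metric.ball (0 : ℂ) ε, DifferentiableAt ℂ mu τ ∧
      DifferentiableAt ℂ (deriv mu) τ ∧ DifferentiableAt ℂ e τ := by
    intro τ hτ
    have h1 := (hεP τ (mem_ball_zero_iff.1 hτ).le).1
    have h2 := h1.differentiableAt
    exact ⟨h2, h1.deriv.differentiableAt, by simp only [he]; fun_prop⟩
  have hbd : ∀ j, ‖f j * (v : ℂ) ^ j * taylorCoeff (muAmplitude j) n‖ ≤
      ‖f j‖ * r ^ j * (B / (ε / 2) ^ n) := by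
    intro j
    have h1 := norm_taylorCoeff_le (f := fun τ => f j * (v : ℂ) ^ j * muAmplitude j τ)
      (C := ‖f j‖ * r ^ j * B) (half_pos hε0) (half_lt_self hε0) (fun τ hτ => ?_)
      (fun τ hτ => ?_) n
    · rw [taylorCoeff_const_mul] at h1
      exact h1.trans (le_of_eq (by ring))
    · obtain ⟨d1, d2, d3⟩ := hd τ hτ
      simp only [hterm]
      exact DifferentiableAt.differentiableWithinAt (by fun_prop)
    · obtain ⟨-, p2, p3⟩ := hεP τ (hτ.trans (half_le_self hε0.le))
      rw [hterm, norm_mul, norm_mul, norm_pow]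
      gcongr
  have hsummable : Summable fun j => f j * (v : ℂ) ^ j * taylorCoeff (muAmplitude j) n :=
    Summable.of_norm_bounded (hsum.mul_right _) hbd
  refine (hsummable.hasSum_iff_tendsto_nat).2 ?_
  rw [tendsto_iff_norm_sub_tendsto_zero]
  have htail : Tendsto (fun N => (∑' j, ‖f (j + N)‖ * r ^ (j + N)) * B / (ε / 2) ^ n) atTop
      (𝓝 0) := by
    have := ((tendsto_sum_nat_add fun j => ‖f j‖ * r ^ j).mul_const B).div_const ((ε / 2) ^ n)
    simpa using this
  refine squeeze_zero (fun N => norm_nonneg _) (fun N => ?_) htail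
  have ha : ∀ j ∈ Finset.range N, AnalyticAt ℂ (fun τ => f j * (v : ℂ) ^ j * muAmplitude j τ) 0 :=
    fun j _ => analyticAt_const.mul (analyticAt_muAmplitude j)
  have e1 : ∑ j ∈ Finset.range N, f j * (v : ℂ) ^ j * taylorCoeff (muAmplitude j) n -
      taylorCoeff (fun τ => F (e τ) * deriv mu τ) n =
      taylorCoeff (fun τ => (∑ j ∈ Finset.range N, f j * (v : ℂ) ^ j * muAmplitude j τ) -
        F (e τ) * deriv mu τ) n := by
    rw [taylorCoeff_sub (Finset.analyticAt_fun_sum _ ha) (hFea.fun_mul analyticAt_mu.deriv),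
      taylorCoeff_sum _ ha]
    simp only [taylorCoeff_const_mul]
  rw [e1]
  have e2 : ∀ τ, (∑ j ∈ Finset.range N, f j * (v : ℂ) ^ j * muAmplitude j τ) -
      F (e τ) * deriv mu τ = ((∑ j ∈ Finset.range N, f j * e τ ^ j) - F (e τ)) * deriv mu τ := by
    intro τ
    simp only [hterm]
    rw [← Finset.sum_mul, sub_mul]
  refine norm_taylorCoeff_le (half_pos hε0) (half_lt_self hε0) (fun τ hτ => ?_)
    (fun τ hτ => ?_) n
  · obtain ⟨d1, d2, d3⟩ := hd τ hτ
    have d4 : DifferentiableAt ℂ (fun τ => F (e τ)) τ :=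
      (hFd (e τ) ((hεP τ (mem_ball_zero_iff.1 hτ).le).2.1.trans hrR)).comp τ d3
    simp only [e2]
    have d5 : DifferentiableAt ℂ (fun τ => ∑ j ∈ Finset.range N, f j * e τ ^ j) τ := by fun_prop
    exact ((d5.fun_sub d4).fun_mul d2).differentiableWithinAt
  · obtain ⟨-, p2, p3⟩ := hεP τ (hτ.trans (half_le_self hε0.le))
    rw [e2, norm_mul]
    refine mul_le_mul ?_ p3.le (norm_nonneg _) (by positivity)
    have h1 := hasSum_taylorCoeff_of_differentiableOn hF (p2.trans hrR)
    rw [norm_sub_rev, ← h1.tsum_eq, ← h1.summable.sum_add_tsum_nat_add N, add_sub_cancel_left]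
    refine tsum_of_norm_bounded ((summable_nat_add_iff N).2 hsum).hasSum fun j => ?_
    rw [norm_mul, norm_pow]
    gcongr

theorem gCoeff_eq_tsum (ν : PrimeCount) {v : ℝ} (hv : 0 < v) (hvν : (v : EReal) < radius ν)
    (m : ℕ) :
    gCoeff ν m v =
      (∑' j, taylorCoeff (eulerF ν) j * (v : ℂ) ^ j * (fallingCoeff m j : ℂ)) / (v : ℂ) ^ m := by
  obtain ⟨R, hvR, hRν⟩ := exists_radius_between ν hvν
  have hF := differentiableOn_eulerF ν (hv.trans hvR).le hRν
  have hS := fun n => (hasSum_taylorCoeff_comp_mu hF hv hvR n).2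
  have hΦ := (hasSum_taylorCoeff_comp_mu hF hv hvR 0).1
  have h1 : HasSum (fun j => ∑ l ∈ Finset.range (m + 1),
      ((stirlingCoeff (m - l) : ℂ) * (gaussMoment l : ℂ)) *
        (taylorCoeff (eulerF ν) j * (v : ℂ) ^ j * taylorCoeff (muAmplitude j) (2 * l)))
      (∑ l ∈ Finset.range (m + 1), ((stirlingCoeff (m - l) : ℂ) * (gaussMoment l : ℂ)) *
        taylorCoeff (fun τ => eulerF ν ((v : ℂ) * Complex.exp (Complex.I * mu τ)) * deriv mu τ)
          (2 * l)) :=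
    hasSum_sum fun l _ => (hS (2 * l)).mul_left _
  have h2 : ∀ j, ∑ l ∈ Finset.range (m + 1),
      ((stirlingCoeff (m - l) : ℂ) * (gaussMoment l : ℂ)) *
        (taylorCoeff (eulerF ν) j * (v : ℂ) ^ j * taylorCoeff (muAmplitude j) (2 * l)) =
      taylorCoeff (eulerF ν) j * (v : ℂ) ^ j * (fallingCoeff m j : ℂ) := by
    intro j
    rw [← sum_stirlingCoeff_mul_saddleMoment, Finset.mul_sum]
    refine Finset.sum_congr rfl fun l _ => ?_
    rw [saddleMoment]
    ring
  simp only [h2] at h1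
  rw [h1.tsum_eq, gCoeff, saddleCoeff, Finset.sum_div]
  refine Finset.sum_congr rfl fun l _ => ?_
  rw [sum_iteratedDeriv_mu_mul hΦ, gaussMoment]
  push_cast
  ring

end LogMean

/-! ### The main theorem -/

theorem mainTheorem3 (ν : LogMean.PrimeCount) (M : ℕ) (a b : ℝ) (ha : 0 < a) (hab : a < b)
    (hb : (b : EReal) < LogMean.radius ν) :
    ∃ C : ℝ, ∀ p k : ℕ, p.Prime → 3 ≤ p →
      a ≤ (k : ℝ) / LogMean.loglog p → (k : ℝ) / LogMean.loglog p ≤ b →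
      ‖(LogMean.lambda ν p k : ℂ) -
          ((LogMean.loglog p ^ k / (Nat.factorial k) : ℝ) : ℂ) *
            ∑ m ∈ Finset.range (M + 1),
              LogMean.gCoeff ν m ((k : ℝ) / LogMean.loglog p)
                / ((LogMean.loglog p : ℝ) : ℂ) ^ m‖
        ≤ C * (LogMean.loglog p ^ k / (Nat.factorial k)) / LogMean.loglog p ^ (M + 1) := by
  obtain ⟨r, hbr, hrν⟩ := LogMean.exists_radius_between ν hb
  obtain ⟨R, hrR, hRν⟩ := LogMean.exists_radius_between ν hrν
  have hb0 : 0 < b := ha.trans hab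
  have hr0 : 0 ≤ r := (hb0.trans hbr).le
  have hR0 : 0 ≤ R := hr0.trans hrR.le
  obtain ⟨K₁, hK₁0, hK₁⟩ := LogMean.exists_norm_partialF_sub_eulerF_le ν hr0 hrν
  obtain ⟨K₂, hK₂0, hK₂⟩ := LogMean.exists_norm_sum_taylorCoeff_sub_le (LogMean.eulerF ν) hb0 hbr
    hrR (LogMean.differentiableOn_eulerF ν hR0 hRν) M
  -- The factorial comes from log p = e^L ≥ L^{M+1}/(M+1)!, the power of a from k = vL ≥ aL.
  refine ⟨K₂ * (K₁ * (Nat.factorial (M + 1) : ℝ) + 1 / a ^ (M + 1)), fun p k hp hp3 hak hkb => ?_⟩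
  have hlog := LogMean.log_pos_of_three_le hp3
  have hL : 0 < LogMean.loglog p := Real.log_pos hlog
  have hexp : Real.exp (LogMean.loglog p) = Real.log p := Real.exp_log (by linarith)
  set L := LogMean.loglog p with hLdef
  set v := (k : ℝ) / L with hv
  have hv0 : 0 < v := ha.trans_le hak
  have hkv : (k : ℝ) = v * L := by rw [hv]; field_simp
  have hk : 0 < k := by
    have : (0 : ℝ) < k := by rw [hkv]; positivity
    exact_mod_cast this
  have hvν : (v : EReal) < LogMean.radius ν :=
    lt_of_le_of_lt (by exact_mod_cast hkb) hb
  have h1 := hK₂ (LogMean.partialF ν p) (K₁ / Real.log p) L k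
    (LogMean.differentiableOn_partialF ν hRν p) (hK₁ p hp hp3) hL hk hkb
  have hsum : ∑ m ∈ Finset.range (M + 1), LogMean.gCoeff ν m v / (L : ℂ) ^ m =
      ∑ m ∈ Finset.range (M + 1), (∑' j, LogMean.taylorCoeff (LogMean.eulerF ν) j * (v : ℂ) ^ j *
        (LogMean.fallingCoeff m j : ℂ)) / (k : ℂ) ^ m := by
    refine Finset.sum_congr rfl fun m _ => ?_
    have hkc : (k : ℂ) = (v : ℂ) * (L : ℂ) := by exact_mod_cast hkv
    rw [LogMean.gCoeff_eq_tsum ν hv0 hvν, hkc, mul_pow, div_div]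
  rw [LogMean.lambda_eq_sum, hsum]
  refine h1.trans ?_
  have h2 : K₁ / Real.log p ≤ K₁ * (Nat.factorial (M + 1) : ℝ) / L ^ (M + 1) := by
    have h3 := Real.pow_div_factorial_le_exp L hL.le (M + 1)
    rw [hexp, div_le_iff₀ (by positivity)] at h3
    rw [div_le_div_iff₀ (by linarith) (by positivity), mul_assoc]
    exact mul_le_mul_of_nonneg_left (by linarith) hK₁0
  have h4 : 1 / (k : ℝ) ^ (M + 1) ≤ 1 / a ^ (M + 1) / L ^ (M + 1) := by
    rw [div_div, ← mul_pow, hkv]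
    gcongr
  have h5 : 0 ≤ L ^ k / (Nat.factorial k : ℝ) := by positivity
  calc _ ≤ K₂ * (L ^ k / (Nat.factorial k : ℝ)) *
        (K₁ * (Nat.factorial (M + 1) : ℝ) / L ^ (M + 1) + 1 / a ^ (M + 1) / L ^ (M + 1)) :=
        mul_le_mul_of_nonneg_left (add_le_add h2 h4) (mul_nonneg hK₂0 h5)
    _ = _ := by ring
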